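/- **Paths and tilings.** A ballot path of length $N$ is a word $\lambda$ of $N$ steps $U=(1,1)$, $D=(1,-1)$, started at the origin, that never goes below $y=0$. If $\mu$ is a word of the same length lying weakly above $\lambda$, the shifted skew shape $\lambda/\mu$ consists of the boxes with vertices $(x\pm1,y),(x,y\pm1)$ and centre $(x,y)$, $1\le x\le N$, that lie between $\lambda$ and $\mu$; the boxes with $x=N$ are called anchor boxes. A ballot tile of length $(2n,n')$ is a set of boxes whose centres are the lattice points of a translate of a ballot path from $(0,0)$ to $(2n+n',n')$. A type BI tiling of $\lambda/\mu$ is a partition of $\lambda/\mu$ into ballot tiles such that (a) each tile with $n'\ge1$ ends on an anchor box; (b) each tile, moved down by one box, lies strictly below $\lambda$ or inside another tile; (c) for every $n$ and every odd $n'$ the number of tiles of length $(2n,n')$ is even, and there are no tiles with $n'$ even and positive. A tile of length $(2n,0)$ has $\mathrm{art}=n+1$, a tile of length $(2n,n')$ with $n'$ odd has $\mathrm{art}=(2n+1+n')/2$; the art of a tiling is the sum over its tiles. Put $P^{I}_{\lambda,*}=\sum_{\mu}\sum_{B}q^{\mathrm{art}(B)}$, where $\mu$ runs over all words weakly above $\lambda$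 and $B$ over the type BI tilings of $\lambda/\mu$. **The tree.** Match the $U$'s and $D$'s of the ballot path $\lambda$ like parentheses and write $\lambda=z_mUz_{m-1}U\cdots z_1Uz_0$ with $z_i$ (possibly empty) Dyck words; number the displayed unpaired $U$'s from the right as $U_1,\dots,U_m$. The planted plane tree $A(\lambda)$ is built as follows: concatenation of words is gluing of trees at the root, from left to right; $A(UzD)$ for a Dyck word $z$ is an edge above $A(z)$; the unpaired $U_1$, and each pair $(U_{2r+1},U_{2r})$ with $r\ge1$, gives an edge marked with a dot ($\bullet$) above the whole tree of the part of the word to the right of $U_1$, respectively $U_{2r+1}$; if $m$ is even, $U_m$ gives no edge. For each odd $i\le m$, consider the edges, from left to right, that connect the components of $A(z_i)$ to their common vertex, followed by the next edge to the right at that vertex, which is the dotted edge of $U_i$ (for $i=1$) or of $(U_i,U_{i-1})$ (for $i\geq 3$); from each of these edges but the first one an arrow goes to the edge immediately to its left. There are no other arrows. With respect to $\lambda_0=U^N$, the capacity of a leaf is the number of $D$'s of $\lambda$ to the left of the $U$ that gives the edge ending in this leaf (a leaf comes from an adjacent pair $UD$, or from a last letter $U$ that is unpaired). The result is the tree with capacities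 $T=A(\lambda/\lambda_0)$. **Labellings and circles.** A labelling $L$ of LS type assigns a non-negative integer $n_e$ to each edge $e$ of $T$ such that the integers do not increase from the leaves to the root and the integer on an edge ending in a leaf is at most the capacity of that leaf. Given $L$, circles are put on edges as follows. (R4) An edge with a dot has no circle. (R5) An edge without a dot and without an incoming arrow has a circle. (R6) If $e(1)\leftarrow\cdots\leftarrow e(p)\leftarrow e$ is a sequence of edges with arrows such that $n_{e(i)}\ge n_e$ for $1\le i\le p$ and either $e(1)$ has no outgoing arrow or it has an arrow to an edge $e(0)$ with $n_{e(0)}<n_e$, then $e(1),\dots,e(p)$ have circles. No other edge has a circle. Let $\mathcal E_\circ(L)$ be the set of edges with a circle, and let $S'(e)\in\{1,2,\dots\}$ be the position of $e$ in the post-order from the right (at each vertex the branches are visited from right to left, and an edge is visited after all edges below it). **Theorem.** For every ballot path $\lambda$ and $T=A(\lambda/\lambda_0)$ with $\lambda_0=U^{N}$, where $N$ is the length of $\lambda$, $$P^{I}_{\lambda,*}=\sum_{L}q^{\sum_{e}n_e}\prod_{e\in\mathcal E_\circ(L)}\bigl(1+q^{S'(e)}\bigr),$$ where $L$ runs over all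 labellings of LS type of $T$ and the sum in the exponent is over all edges of $T$. -/

import Mathlib

open Polynomial

namespace BallotBI

/-! ### Paths -/

/-- The two kinds of steps of a lattice path: `U = (1,1)` and `D = (1,-1)`. -/
inductive Step
  | U
  | D
  deriving DecidableEq

instance : Fintype Step := ⟨{Step.U, Step.D}, by rintro (_ | _) <;> decide⟩

/-- The height of the path `w`, started at the origin, after its first `i` steps. -/
def height (w : List Step) (i : ℕ) : ℤ :=
  ((w.take i).count Step.U : ℤ) - ((w.take i).count Step.D : ℤ)

/-- A ballot path: a lattice path that never goes below the line `y = 0`. -/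
def IsBallot (w : List Step) : Prop := ∀ i, 0 ≤ height w i

/-- `mu` is (weakly) above `lam`: both have the same length and `mu` is nowhere lower. -/
def IsAbove (mu lam : List Step) : Prop :=
  mu.length = lam.length ∧ ∀ i, height lam i ≤ height mu i

/-! ### Ballot tilings of type BI -/

/-- The shifted skew shape with lower path `lam` and upper path `mu`.  A box is the square with
vertices `(x±1,y)`, `(x,y±1)` and is recorded by its centre `(x,y)`.  The boxes are those between
the two paths, with centres on `1 ≤ x ≤ N`, where `N` is the common length of the paths; those
with `x = N` are the anchor boxes. -/
noncomputable def skewShape (lam mu : List Step) : Finset (ℕ × ℤ) :=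
  (Finset.Icc 1 lam.length ×ˢ Finset.Icc (-(lam.length : ℤ)) (lam.length : ℤ)).filter
    fun b => height lam b.1 < b.2 ∧ b.2 < height mu b.1 ∧ Odd (b.2 - height lam b.1)

/-- The boxes whose centres are the lattice points of the path `w` started at `b`. -/
def ribbon (b : ℕ × ℤ) (w : List Step) : Finset (ℕ × ℤ) :=
  (Finset.range (w.length + 1)).image fun i => (b.1 + i, b.2 + height w i)

/-- `t` is a ballot tile of length `(2n,n')`: the centres of its boxes form a ballot path
from some box `b` to `b + (2n+n', n')`.  For `n' = 0` this is a Dyck tile. -/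
def IsBallotTile (n n' : ℕ) (t : Finset (ℕ × ℤ)) : Prop :=
  ∃ (b : ℕ × ℤ) (w : List Step), IsBallot w ∧ w.count Step.D = n ∧ w.count Step.U = n + n' ∧
    t = ribbon b w

open Classical in
/-- The statistic art of a tile, `(area + tiles) / 2`: the area is the number of boxes, and
`tiles` is `1` for a Dyck tile and `0` for a ballot tile with `n' ≥ 1`. -/
noncomputable def tileArt (t : Finset (ℕ × ℤ)) : ℕ :=
  (t.card + if ∃ n, IsBallotTile n 0 t then 1 else 0) / 2

open Classical in
/-- A set partition `B` of the shifted skew shape is a cover-inclusive ballot tiling of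
type BI. -/
structure IsTypeBI {lam mu : List Step} (B : Finpartition (skewShape lam mu)) : Prop where
  /-- Every block is a ballot tile. -/
  tile : ∀ t ∈ B.parts, ∃ n n', IsBallotTile n n' t
  /-- A ballot tile of length `(2n,n')` with `n' ≥ 1` ends on an anchor box. -/
  anchored : ∀ t ∈ B.parts, ∀ n n', IsBallotTile n n' t → 1 ≤ n' → ∃ b ∈ t, b.1 = lam.length
  /-- A tile moved down by one box lies strictly below `lam` or inside another tile. -/
  coverInclusive : ∀ t ∈ B.parts,
    (∀ b ∈ t, b.2 - 2 < height lam b.1) ∨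
      ∃ t' ∈ B.parts, t.image (fun b => (b.1, b.2 - 2)) ⊆ t'
  /-- For `n'` odd, the number of tiles of length `(2n,n')` is even. -/
  even_of_odd : ∀ n n', Odd n' → Even (B.parts.filter (IsBallotTile n n')).card
  /-- For `n'` even and positive there is no tile of length `(2n,n')`. -/
  none_of_even : ∀ n n', Even n' → 0 < n' → ∀ t ∈ B.parts, ¬ IsBallotTile n n' t

/-- The statistic art of a tiling. -/
noncomputable def art {lam mu : List Step} (B : Finpartition (skewShape lam mu)) : ℕ :=
  ∑ t ∈ B.parts, tileArt t

open Classical in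
/-- The generating function of the type BI tilings between `lam` and `mu`. -/
noncomputable def genBetween (lam mu : List Step) : ℤ[X] :=
  ∑ B : Finpartition (skewShape lam mu) with IsTypeBI B, X ^ art B

open Classical in
/-- The generating function of the type BI tilings with fixed lower path `lam`: the sum over all
upper paths. -/
noncomputable def genBI (lam : List Step) : ℤ[X] :=
  ∑ mu : List.Vector Step lam.length with IsAbove mu.toList lam, genBetween lam mu.toList

/-! ### Plane trees -/

/-- Rooted plane trees whose edges may carry a dot and an incoming arrow, and whose leaves carry
a capacity.  `graft dot arrow cap below right` has, as leftmost edge at the root, an edge with the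
given marks and with the tree `below` hanging from its lower end; `right` is the rest of the tree
at the same root.  An arrow always comes from the next edge to the right at the same vertex.  The
capacity counts only if the lower end of the edge is a leaf, that is if `below = empty`. -/
inductive PlaneTree
  | empty
  | graft (dot arrow : Bool) (cap : ℕ) (below right : PlaneTree)

/-- The edges of a plane tree: `head` is the leftmost edge at the root, `under e` an edge of the
tree hanging from it, and `beside e` an edge of the rest of the tree. -/
inductive Edge : PlaneTree → Type
  | head {d a : Bool} {c : ℕ} {b r : PlaneTree} : Edge (.graft d a c b r)
  | under {d a : Bool} {c : ℕ} {b r : PlaneTree} (e : Edge b) : Edge (.graft d a c b r)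
  | beside {d a : Bool} {c : ℕ} {b r : PlaneTree} (e : Edge r) : Edge (.graft d a c b r)

/-- The edges of a grafted tree: the new edge, those below it, and those to the right of it. -/
def Edge.equiv (d a : Bool) (c : ℕ) (b r : PlaneTree) :
    Option (Edge b ⊕ Edge r) ≃ Edge (.graft d a c b r) where
  toFun
    | none => .head
    | some (.inl e) => .under e
    | some (.inr e) => .beside e
  invFun
    | .head => none
    | .under e => some (.inl e)
    | .beside e => some (.inr e)
  left_inv := by rintro (_ | _ | _) <;> rfl
  right_inv := by rintro (_ | _ | _) <;> rfl

/-- A plane tree has finitely many edges. -/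
@[reducible] def Edge.fintype : (T : PlaneTree) → Fintype (Edge T)
  | .empty => ⟨∅, by rintro ⟨⟩⟩
  | .graft d a c b r =>
    letI := Edge.fintype b
    letI := Edge.fintype r
    Fintype.ofEquiv _ (Edge.equiv d a c b r)

instance (T : PlaneTree) : Fintype (Edge T) := Edge.fintype T

/-- The number of edges. -/
def PlaneTree.size : PlaneTree → ℕ
  | .empty => 0
  | .graft _ _ _ b r => b.size + r.size + 1

namespace Edge

/-- The edge carries a dot. -/
def HasDot : {T : PlaneTree} → Edge T → Prop
  | .graft d _ _ _ _, .head => d = true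
  | _, .under e => e.HasDot
  | _, .beside e => e.HasDot

/-- The edge has an incoming arrow. -/
def HasArrow : {T : PlaneTree} → Edge T → Prop
  | .graft _ a _ _ _, .head => a = true
  | _, .under e => e.HasArrow
  | _, .beside e => e.HasArrow

/-- The number recorded on the edge as capacity (meaningful for edges ending in a leaf). -/
def cap : {T : PlaneTree} → Edge T → ℕ
  | .graft _ _ c _ _, .head => c
  | _, .under e => e.cap
  | _, .beside e => e.cap

/-- The lower end of the edge is a leaf. -/
def IsLeaf : {T : PlaneTree} → Edge T → Prop
  | .graft _ _ _ b _, .head => b = .empty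
  | _, .under e => e.IsLeaf
  | _, .beside e => e.IsLeaf

/-- The edge is connected to the root. -/
def AtRoot : {T : PlaneTree} → Edge T → Prop
  | _, .head => True
  | _, .under _ => False
  | _, .beside e => e.AtRoot

/-- The edge is the leftmost edge connected to the root. -/
def IsFirst : {T : PlaneTree} → Edge T → Prop
  | _, .head => True
  | _, .under _ => False
  | _, .beside _ => False

/-- `IsParent e e'`: the upper end of `e'` is the lower end of `e`. -/
def IsParent : {T : PlaneTree} → Edge T → Edge T → Prop
  | _, .head, .under e' => e'.AtRoot
  | _, .under e, .under e' => e.IsParent e'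
  | _, .beside e, .beside e' => e.IsParent e'
  | _, _, _ => False

/-- `IsNext e e'`: both edges have the same upper end and `e'` is the next one to the right
of `e`. -/
def IsNext : {T : PlaneTree} → Edge T → Edge T → Prop
  | _, .head, .beside e' => e'.IsFirst
  | _, .under e, .under e' => e.IsNext e'
  | _, .beside e, .beside e' => e.IsNext e'
  | _, _, _ => False

/-- `ArrowFrom e e'`: there is an arrow from `e` to `e'`, that is `e' ← e`. -/
def ArrowFrom {T : PlaneTree} (e e' : Edge T) : Prop := e'.HasArrow ∧ e'.IsNext e

/-- The position `1, 2, …` of the edge in the post-order from the right: at every vertex the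
branches are visited from right to left, and an edge is visited after all edges below it. -/
def postRight : {T : PlaneTree} → Edge T → ℕ
  | .graft _ _ _ b r, .head => r.size + b.size + 1
  | .graft _ _ _ _ r, .under e => r.size + e.postRight
  | _, .beside e => e.postRight

end Edge

/-! ### The tree of a ballot path -/

/-- The capacity of the `U` at position `i` (counted from `0`) of `lam` with respect to `lam0`:
the number of `U`'s of `lam0` up to and including that position minus the same number for `lam`.
The subtraction does not truncate when `lam0` is above `lam`. -/
def capacity (lam lam0 : List Step) (i : ℕ) : ℕ :=
  (lam0.take (i + 1)).count Step.U - (lam.take (i + 1)).count Step.U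

/-- State while a path is read from right to left. -/
structure ReadState where
  /-- the number of unpaired `U`'s read so far -/
  unpaired : ℕ
  /-- the tree of the part read since the last open `D` -/
  current : PlaneTree
  /-- the trees interrupted by the `D`'s that are still open, the innermost first -/
  stack : List PlaneTree

/-- Reading one more step to the left; `c` is the capacity at its position.

* `D` opens a pair.
* A `U` that closes a pair puts an edge above the tree of the word enclosed by the pair, at the
  left of the tree already there.  It gets an incoming arrow if it lies in no other pair and the
  number of unpaired `U`'s to its right is odd.
* Number the unpaired `U`'s from the right as `U₁, U₂, …`.  Then `U₁` (terminal) and `U₃, U₅, …`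
  (each forming a `UU`-pair with the preceding `U₂, U₄, …`) put a dotted edge above the whole tree
  of what follows.  Those with even index add no edge of their own: each is either the right
  member of a `UU`-pair or extra. -/
def readStep (c : ℕ) : Step → ReadState → ReadState
  | .D, ⟨k, T, st⟩ => ⟨k, .empty, T :: st⟩
  | .U, ⟨k, T, R :: st⟩ => ⟨k, .graft false (st.isEmpty && k % 2 == 1) c T R, st⟩
  | .U, ⟨k, T, []⟩ => ⟨k + 1, if k % 2 = 0 then .graft true false c T .empty else T, []⟩

/-- Reading the word `w`, whose first letter is at position `i`, from right to left. -/
def readWord (cap : ℕ → ℕ) : ℕ → List Step → ReadState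
  | _, [] => ⟨0, .empty, []⟩
  | i, s :: w => readStep (cap i) s (readWord cap (i + 1) w)

/-- The plane tree with capacities `A(lam/lam0)` of a ballot path `lam`. (For a ballot path all
`D`'s are paired, so that no tree is left on the stack.) -/
def tree (lam lam0 : List Step) : PlaneTree :=
  (readWord (capacity lam lam0) 0 lam).current

/-! ### Labellings and circles -/

/-- A labelling of Lascoux–Schützenberger type. -/
structure IsLS {T : PlaneTree} (L : Edge T → ℕ) : Prop where
  /-- The labels do not increase from the leaves to the root. -/
  mono : ∀ e e', e.IsParent e' → L e ≤ L e'
  /-- The label of an edge that ends in a leaf is at most the capacity of the leaf. -/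
  le_cap : ∀ e, e.IsLeaf → L e ≤ e.cap

theorem IsLS.bounded (T : PlaneTree) :
    ∃ M : ℕ, ∀ L : Edge T → ℕ, IsLS L → ∀ e, L e ≤ M := by
  induction T with
  | empty => exact ⟨0, fun L _ e => nomatch e⟩
  | graft d a c b r ihb ihr =>
    obtain ⟨Mb, hb⟩ := ihb
    obtain ⟨Mr, hr⟩ := ihr
    refine ⟨c + Mb + Mr, fun L hL e => ?_⟩
    have hb' : ∀ e : Edge b, L (.under e) ≤ Mb := fun e =>
      hb (fun e => L (.under e)) ⟨fun x y h => hL.mono (.under x) (.under y) h,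
        fun x h => hL.le_cap (.under x) h⟩ e
    have hr' : ∀ e : Edge r, L (.beside e) ≤ Mr := fun e =>
      hr (fun e => L (.beside e)) ⟨fun x y h => hL.mono (.beside x) (.beside y) h,
        fun x h => hL.le_cap (.beside x) h⟩ e
    cases e with
    | under e => have := hb' e; omega
    | beside e => have := hr' e; omega
    | head =>
      cases b with
      | empty =>
        have : L .head ≤ c := hL.le_cap .head rfl
        omega
      | graft d' a' c' b' r' =>
        have h1 := hb' .head
        have h2 : L .head ≤ L (.under .head) := hL.mono .head (.under .head) trivial
        omega

theorem finite_isLS (T : PlaneTree) : {L : Edge T → ℕ | IsLS L}.Finite := by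
  obtain ⟨M, hM⟩ := IsLS.bounded T
  refine (Set.Finite.pi' (fun _ : Edge T => Set.finite_Iic M)).subset ?_
  intro L hL e
  exact hM L hL e

/-- The finite set of all labellings of Lascoux–Schützenberger type of `T`. -/
noncomputable def labellings (T : PlaneTree) : Finset (Edge T → ℕ) := (finite_isLS T).toFinset

/-- `f` is circled because of a sequence of edges with arrows
`e(0) ← e(1) ← … ← e(p) ← e` (where `l = [e(1), …, e(p)]`, and `e(0)` may be missing) with
`L (e(i)) ≥ L e` for `1 ≤ i ≤ p` and, if `e(1)` has an arrow to an edge `e(0)`,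
`L (e(0)) < L e`. -/
def CircledByArrows {T : PlaneTree} (L : Edge T → ℕ) (f : Edge T) : Prop :=
  ∃ (l : List (Edge T)) (e : Edge T),
    (l ++ [e]).IsChain (fun x y => y.ArrowFrom x) ∧
    (∀ x ∈ l, L e ≤ L x) ∧
    (∀ e1 ∈ l.head?, ∀ e0, e1.ArrowFrom e0 → L e0 < L e) ∧
    f ∈ l

/-- The edges with a circle: an edge with a dot has none; an edge without an incoming arrow has
one; an edge with an incoming arrow has one if the sequence rule puts it there. -/
def Circled {T : PlaneTree} (L : Edge T → ℕ) (f : Edge T) : Prop :=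
  ¬ f.HasDot ∧ (¬ f.HasArrow ∨ CircledByArrows L f)

open Classical in
/-- The contribution of one labelling. -/
noncomputable def weight {T : PlaneTree} (L : Edge T → ℕ) : ℤ[X] :=
  X ^ (∑ e, L e) * ∏ e with Circled L e, (1 + X ^ e.postRight)

end BallotBI

/-! Both sides are polynomials in `q`, so it suffices to compare them for real `0 < q < 1`, where
every `1 - q ^ (n + 1)` is invertible. There both sides reduce to the same product, built along the
factorization of the path into Dyck words separated by unpaired `U`'s.

Tilings. Cover-inclusiveness makes each tile parallel to the lower path: all its boxes lie at one
level above it, and a tile of level `k + 1` sits over a single tile of level `k`. So a column of a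
tiling is a stack of open tiles, each known by its first column. Only tiles on top that are back at
their starting height may end before the last column. This turns the generating function into the
recursion `transfer` (`aeval_genBI`).

To solve it, stacks with `m` equal tiles on top are superposed with the coefficients of `∏ (1 + q ^
i X)`, `1 ≤ i ≤ k`. A down step replaces `k` by `k + 1`. An up step cuts the product at some `j ≤
k`: the upper factors count old tiles that stay open, the lower ones new tiles. When tiles of equal
height are interchangeable, the two pieces recombine after the matching `D`, and a Dyck word
contributes only a scalar and a shift of `k` (`stackSum_forest`). They are interchangeable if the
path later descends below their height, or if that height is at even distance from the final one,
where the final condition ignores the columns. At odd distance the number of tiles left open has to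
be even for each starting column separately. There the generating functions with an even and with an
odd number at the current column satisfy a joint recursion, solved with evaluations at `±q ^ M`
(`stackSum_odd`). `stackSum_evenWord` alternates the two kinds of levels.

Labellings. The labellings with root labels at least `l` have a generating function of the form `q ^
(l * size) * const * risingProd`, and grafting an edge is a hockey-stick sum. An edge with an arrow
lacks its circle exactly when all edges to its right at the vertex have larger labels, so a row with
arrows is a difference of two such sums; the factor it produces is the one of the odd levels
(`rootSum_glue_arrow`, `rootSum_evenTree`). The two computations meet in `transfer_eq_rootSum`. -/

namespace BallotBI

/-! ### Products -/

/-- The product of `1 - q ^ i` over `k < i ≤ k + n`. -/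
noncomputable def risingProd (q : ℝ) (k n : ℕ) : ℝ := ∏ i ∈ Finset.range n, (1 - q ^ (k + i + 1))

/-- The product of `1 + q ^ (i + M)` over `1 ≤ i ≤ k`. -/
noncomputable def plusProd (q : ℝ) (k M : ℕ) : ℝ := ∏ i ∈ Finset.range k, (1 + q ^ (i + 1 + M))

theorem risingProd_zero (q : ℝ) (k : ℕ) : risingProd q k 0 = 1 := by simp [risingProd]

theorem risingProd_succ (q : ℝ) (k n : ℕ) :
    risingProd q k (n + 1) = risingProd q k n * (1 - q ^ (k + n + 1)) := by
  simp [risingProd, Finset.prod_range_succ]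

theorem risingProd_add (q : ℝ) (k m n : ℕ) :
    risingProd q k (m + n) = risingProd q k m * risingProd q (k + m) n := by
  simp only [risingProd, Finset.prod_range_add, add_assoc]

theorem risingProd_succ' (q : ℝ) (k n : ℕ) :
    risingProd q k (n + 1) = (1 - q ^ (k + 1)) * risingProd q (k + 1) n := by
  rw [add_comm, risingProd_add]; simp [risingProd]

theorem plusProd_zero (q : ℝ) (M : ℕ) : plusProd q 0 M = 1 := by simp [plusProd]

theorem plusProd_succ (q : ℝ) (k M : ℕ) :
    plusProd q (k + 1) M = plusProd q k M * (1 + q ^ (k + 1 + M)) := by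
  simp [plusProd, Finset.prod_range_succ]

theorem plusProd_add (q : ℝ) (m n M : ℕ) :
    plusProd q (m + n) M = plusProd q m M * plusProd q n (m + M) := by
  simp only [plusProd, Finset.prod_range_add]
  congr 1
  refine Finset.prod_congr rfl fun i _ => ?_
  congr 2; ring

theorem plusProd_succ' (q : ℝ) (k M : ℕ) :
    plusProd q (k + 1) M = (1 + q ^ (M + 1)) * plusProd q k (M + 1) := by
  rw [add_comm k 1, plusProd_add, add_comm 1 M]; simp [plusProd, add_comm]

theorem one_sub_pow_ne_zero {q : ℝ} (h0 : 0 < q) (h1 : q < 1) (n : ℕ) : 1 - q ^ (n + 1) ≠ 0 := by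
  have := pow_lt_one₀ h0.le h1 (Nat.succ_ne_zero n)
  simp only [Nat.succ_eq_add_one] at this
  linarith

/-- The `q`-hockey-stick identity: up to a constant `risingProd q j n` is the Gaussian binomial of
`j + n` over `n`. It sums over the cut `j` made by an up step. -/
theorem sum_pow_mul_risingProd (q : ℝ) (k n : ℕ) :
    (∑ j ∈ Finset.range (k + 1), q ^ j * risingProd q j n) * (1 - q ^ (n + 1)) =
      risingProd q k (n + 1) := by
  induction k with
  | zero => simp [risingProd_succ]
  | succ k ih =>
    rw [Finset.sum_range_succ, add_mul, ih, risingProd_succ', risingProd_succ]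
    ring

/-- The hockey-stick identity read from the other end; here `v` is the label of an edge and `l + d`
its capacity. The induction splits off `v = l`. -/
theorem sum_pow_mul_risingProd_sub (q : ℝ) (l d n : ℕ) :
    (∑ v ∈ Finset.Icc l (l + d), q ^ (v * (n + 1)) * risingProd q (l + d - v) n) *
      (1 - q ^ (n + 1)) = q ^ (l * (n + 1)) * risingProd q d (n + 1) := by
  induction d generalizing l with
  | zero => simp [risingProd_succ]; ring
  | succ d ih =>
    rw [← Finset.add_sum_Ioc_eq_sum_Icc (by omega), ← Finset.Icc_succ_left_eq_Ioc]
    have := ih (l + 1)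
    simp only [Nat.succ_eq_succ, Nat.succ_eq_add_one]
    rw [show l + (d + 1) = l + 1 + d by ring, add_mul, this, show l + 1 + d - l = d + 1 by omega,
      risingProd_succ', risingProd_succ]
    ring

/-- A q-Vandermonde type summation. -/
theorem sum_risingProd_mul_plusProd (q : ℝ) (k M : ℕ) :
    ∑ j ∈ Finset.range (k + 1), q ^ j * risingProd q j M *
      (∏ i ∈ Finset.Ico j k, (1 - q ^ (i + 1 + M))) * plusProd q j M =
      risingProd q k M * plusProd q k (M + 1) := by
  induction k with
  | zero => simp [plusProd_zero]
  | succ k ih =>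
    have h : ∀ j ∈ Finset.range (k + 1), q ^ j * risingProd q j M *
        (∏ i ∈ Finset.Ico j (k + 1), (1 - q ^ (i + 1 + M))) * plusProd q j M =
        (q ^ j * risingProd q j M * (∏ i ∈ Finset.Ico j k, (1 - q ^ (i + 1 + M))) *
          plusProd q j M) * (1 - q ^ (k + 1 + M)) := by
      intro j hj
      rw [Finset.prod_Ico_succ_top (by simp at hj; omega)]; ring
    rw [Finset.sum_range_succ, Finset.sum_congr rfl h, ← Finset.sum_mul, ih]
    have e1 : risingProd q k M * (1 - q ^ (k + 1 + M)) =
        (1 - q ^ (k + 1)) * risingProd q (k + 1) M := by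
      rw [← risingProd_succ', risingProd_succ]; ring_nf
    rw [mul_right_comm, e1, plusProd_succ' q k M, plusProd_succ]
    simp; ring

/-! ### Linear functionals on polynomials -/

/-- The linear functional on polynomials with value `g m` at `X ^ m`. -/
noncomputable def moment (g : ℕ → ℝ) : ℝ[X] →ₗ[ℝ] ℝ :=
  Polynomial.lsum fun m => g m • LinearMap.id

theorem moment_monomial (g : ℕ → ℝ) (m : ℕ) (c : ℝ) : moment g (monomial m c) = c * g m := by
  simp [moment, sum_monomial_index, mul_comm]

theorem moment_eq_sum (g : ℕ → ℝ) (p : ℝ[X]) : moment g p = p.sum fun m c => c * g m := by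
  simp [moment, mul_comm]

theorem moment_add_left (g h : ℕ → ℝ) (p : ℝ[X]) :
    moment (fun m => g m + h m) p = moment g p + moment h p := by
  simp only [moment_eq_sum, Polynomial.sum, mul_add, Finset.sum_add_distrib]

theorem moment_mul_left (c : ℝ) (g : ℕ → ℝ) (p : ℝ[X]) :
    moment (fun m => c * g m) p = c * moment g p := by
  simp only [moment_eq_sum, Polynomial.sum, Finset.mul_sum]
  exact Finset.sum_congr rfl fun _ _ => by ring

theorem moment_congr {g h : ℕ → ℝ} (H : ∀ m, g m = h m) (p : ℝ[X]) : moment g p = moment h p := by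
  rw [funext H]

/-- Multiplication by a linear factor is moved to the sequence `g`. This lets inductions over the
factors of `linProd` absorb one factor at a time. -/
theorem moment_mul_add_C_mul_X (g : ℕ → ℝ) (p : ℝ[X]) (c : ℝ) :
    moment g (p * (1 + C c * X)) = moment (fun m => g m + c * g (m + 1)) p := by
  induction p using Polynomial.induction_on' with
  | add p r hp hr => rw [add_mul, map_add, hp, hr, map_add]
  | monomial n a =>
    rw [mul_add, mul_one, map_add, show monomial n a * (C c * X) = monomial (n + 1) (a * c) by
      rw [← mul_assoc, monomial_mul_C, monomial_mul_X]]
    simp only [moment_monomial]; ring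

theorem moment_pow (c : ℝ) (p : ℝ[X]) : moment (fun m => c ^ m) p = p.eval c := by
  rw [moment_eq_sum, Polynomial.eval_eq_sum]

/-- With `moment_odd`, this is how the parity condition on the tiles left open becomes an evaluation
at `±c`. -/
theorem moment_even (c : ℝ) (p : ℝ[X]) :
    moment (fun m => if Even m then c ^ m else 0) p = (p.eval c + p.eval (-c)) / 2 := by
  rw [← moment_pow, ← moment_pow, ← moment_add_left, div_eq_inv_mul, ← moment_mul_left]
  refine moment_congr (fun m => ?_) p
  split_ifs with h
  · rw [h.neg_pow]; ring
  · rw [(Nat.not_even_iff_odd.1 h).neg_pow]; ring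

theorem moment_odd (c : ℝ) (p : ℝ[X]) :
    moment (fun m => if Odd m then c ^ m else 0) p = (p.eval c - p.eval (-c)) / 2 := by
  rw [← moment_pow, ← moment_pow, sub_eq_add_neg, neg_eq_neg_one_mul, ← moment_mul_left,
    ← moment_add_left, div_eq_inv_mul, ← moment_mul_left]
  refine moment_congr (fun m => ?_) p
  split_ifs with h
  · rw [h.neg_pow]; ring
  · rw [(Nat.not_odd_iff_even.1 h).neg_pow]; ring

theorem moment_zero_pow (p : ℝ[X]) :
    moment (fun m => if m = 0 then 1 else 0) p = p.eval 0 := by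
  rw [← moment_pow]
  exact moment_congr (fun m => by rcases m with _ | m <;> simp) p

/-- Merging two independent variables. -/
theorem moment_moment_add (h : ℕ → ℝ) (p r : ℝ[X]) :
    moment (fun m => moment (fun l => h (l + m)) r) p = moment h (p * r) := by
  induction p using Polynomial.induction_on' with
  | add p p' hp hp' => rw [map_add, hp, hp', add_mul, map_add]
  | monomial n a =>
    rw [moment_monomial]
    induction r using Polynomial.induction_on' with
    | add r r' hr hr' => rw [map_add, mul_add, hr, hr', mul_add, map_add]
    | monomial n' a' =>
      rw [moment_monomial, monomial_mul_monomial, moment_monomial, add_comm n]; ring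

/-- The product of `1 + q ^ i X` over `j < i ≤ k`. -/
noncomputable def linProd (q : ℝ) (j k : ℕ) : ℝ[X] :=
  ∏ i ∈ Finset.Ico j k, (1 + C (q ^ (i + 1)) * X)

theorem linProd_self (q : ℝ) (k : ℕ) : linProd q k k = 1 := by simp [linProd]

theorem linProd_succ (q : ℝ) {j k : ℕ} (h : j ≤ k) :
    linProd q j (k + 1) = linProd q j k * (1 + C (q ^ (k + 1)) * X) := by
  rw [linProd, Finset.prod_Ico_succ_top h, linProd]

theorem linProd_mul (q : ℝ) {i j k : ℕ} (h : i ≤ j) (h' : j ≤ k) :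
    linProd q i j * linProd q j k = linProd q i k := Finset.prod_Ico_consecutive _ h h'

theorem eval_linProd (q c : ℝ) (j k : ℕ) :
    (linProd q j k).eval c = ∏ i ∈ Finset.Ico j k, (1 + q ^ (i + 1) * c) := by
  simp [linProd, eval_prod]

/-- The substitution of `q ^ n X` for `X` shifts the window of factors by `n`. Tiles that stay open
below `n` down steps acquire exactly this weight. -/
theorem moment_pow_mul_linProd (q : ℝ) (g : ℕ → ℝ) (n : ℕ) {j k : ℕ} (h : j ≤ k) :
    moment (fun m => q ^ (n * m) * g m) (linProd q j k) =
      moment g (linProd q (j + n) (k + n)) := by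
  induction k, h using Nat.le_induction generalizing g with
  | base => simp only [linProd_self, ← C_1, ← monomial_zero_left, moment_monomial]; simp
  | succ k hk ih =>
    rw [linProd_succ q hk, moment_mul_add_C_mul_X, show k + 1 + n = k + n + 1 by ring,
      linProd_succ q (by omega), moment_mul_add_C_mul_X, ← ih]
    refine moment_congr (fun m => ?_) _
    ring

/-- The weight `q ^ m` shifts the window to `2, …, k + 1`, and the optional additional tile supplies
the missing factor `1 + q X`. -/
theorem moment_down (q : ℝ) (g : ℕ → ℝ) (k : ℕ) :
    moment (fun m => q ^ m * g m + q ^ (m + 1) * g (m + 1)) (linProd q 0 k) =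
      moment g (linProd q 0 (k + 1)) := by
  have h := moment_pow_mul_linProd q (fun m => g m + q * g (m + 1)) 1 (Nat.zero_le k)
  rw [← linProd_mul q (Nat.zero_le 1) (by omega : 1 ≤ k + 1), mul_comm,
    show linProd q 0 1 = 1 + C (q ^ 1) * X by simp [linProd], moment_mul_add_C_mul_X, pow_one,
    show (1 : ℕ) = 0 + 1 by rfl, ← h]
  exact moment_congr (fun m => by ring) _

/-- The argument `r` of `g r j` counts the old tiles that stay open, `j` the new ones. The product
splits into two independent windows, the upper one for `r` and the lower one for `j`. -/
theorem moment_up (q : ℝ) (g : ℕ → ℕ → ℝ) (k : ℕ) :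
    moment (fun m => ∑ j ∈ Finset.range (m + 1), q ^ j * g (m - j) j +
        ∑ j ∈ Finset.range m, q ^ j * g (m - 1 - j) j) (linProd q 0 k) =
      ∑ j ∈ Finset.range (k + 1),
        q ^ j * moment (fun r => moment (g r) (linProd q 0 j)) (linProd q j k) := by
  induction k generalizing g with
  | zero => simp [linProd_self, ← C_1, -map_one, ← monomial_zero_left, moment_monomial]
  | succ k ih =>
    -- The new factor acts on the old tiles, which accounts for the cuts `j ≤ k`; the cut at `k +
    -- 1`, with no old tile in its window, is provided by `hd`.
    have e := ih (fun r j => g r j + q ^ (k + 1) * g (r + 1) j)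
    have hd := moment_down q (fun m => g 0 m) k
    rw [linProd_succ q (Nat.zero_le k), moment_mul_add_C_mul_X, Finset.sum_range_succ, linProd_self,
      ← C_1, ← monomial_zero_left, moment_monomial, one_mul, ← hd, ← moment_mul_left]
    have h2 : ∀ j ∈ Finset.range (k + 1),
        q ^ j * moment (fun r => moment (g r) (linProd q 0 j)) (linProd q j (k + 1)) =
        q ^ j * moment (fun r => moment (fun j => g r j + q ^ (k + 1) * g (r + 1) j)
          (linProd q 0 j)) (linProd q j k) := by
      intro j hj
      rw [linProd_succ q (by simp at hj; omega), moment_mul_add_C_mul_X]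
      congr 1
      refine moment_congr (fun m => ?_) _
      rw [moment_add_left, moment_mul_left]
    rw [Finset.sum_congr rfl h2, ← e, ← moment_add_left]
    refine moment_congr (fun m => ?_) _
    rw [Finset.sum_range_succ _ (m + 1), Finset.sum_range_succ _ m]
    simp only [mul_add, Finset.sum_add_distrib]
    have h3 : ∀ j ∈ Finset.range (m + 1), q ^ j * (q ^ (k + 1) * g (m - j + 1) j) =
        q ^ (k + 1) * (q ^ j * g (m + 1 - j) j) := by
      intro j hj
      rw [show m - j + 1 = m + 1 - j by simp at hj; omega]; ring
    have h4 : ∀ j ∈ Finset.range m, q ^ j * (q ^ (k + 1) * g (m - 1 - j + 1) j) =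
        q ^ (k + 1) * (q ^ j * g (m + 1 - 1 - j) j) := by
      intro j hj
      rw [show m - 1 - j + 1 = m + 1 - 1 - j by simp at hj; omega]; ring
    rw [Finset.sum_congr rfl h3, Finset.sum_congr rfl h4, ← Finset.mul_sum, ← Finset.mul_sum,
      Finset.sum_range_succ (fun j => q ^ j * g (m + 1 - j) j) m]
    simp only [Nat.add_sub_cancel, Nat.sub_self, Finset.sum_range_succ (fun j => q ^ j * g (m - j) j) m,
      show m + 1 - m = 1 by omega]
    ring

/-! ### The transfer recursion -/

/-- The number of leading elements of the stack `s` that lie at the height of column `x`. -/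
def topCount (hl : ℕ → ℤ) (x : ℕ) (s : List ℕ) : ℕ :=
  ((s.map hl).takeWhile (fun h => h = hl x)).length

open Classical in
/-- The contribution of the tiles that are open at the last column `x`; the columns in `O` must
have an odd number of ballot tiles starting there. -/
noncomputable def finalWeight (q : ℝ) (hl : ℕ → ℤ) (O : Finset ℕ) (x : ℕ) (s : List ℕ) : ℝ :=
  if (∀ a ∈ s, ¬ (Even (hl x - hl a) ∧ 0 < hl x - hl a)) ∧
      ∀ a, Odd (hl x - hl a) → (Even (s.count a) ↔ a ∉ O) then
    q ^ (s.map fun a => ((hl x - hl a - 1) / 2).toNat).sum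
  else 0

/-- The generating function of all continuations of a stack `s` of open tiles, recorded by their
first columns (the highest tile first), at column `x` of a path along the remaining steps. -/
noncomputable def transfer (q : ℝ) (hl : ℕ → ℤ) (O : Finset ℕ) : List Step → ℕ → List ℕ → ℝ
  | [], x, s => finalWeight q hl O x s
  | .U :: w, x, s =>
    -- Going up, `j` tiles start, and the number that end is `j` or `j + 1` according to whether the
    -- upper path goes up or down. Only starting tiles contribute to art.
    ∑ j ∈ Finset.range (topCount hl x s + 1),
        q ^ j * transfer q hl O w (x + 1) (List.replicate j (x + 1) ++ s.drop j) +
      ∑ j ∈ Finset.range (topCount hl x s),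
        q ^ j * transfer q hl O w (x + 1) (List.replicate j (x + 1) ++ s.drop (j + 1))
  | .D :: w, x, s =>
    -- Going down, every tile at the current height has to end. The upper path goes down or up, so
    -- the column keeps its length or gains a box; each box of the new column contributes one.
    q ^ s.length * transfer q hl O w (x + 1)
        (List.replicate (topCount hl x s) (x + 1) ++ s.drop (topCount hl x s)) +
      q ^ (s.length + 1) * transfer q hl O w (x + 1)
        (List.replicate (topCount hl x s + 1) (x + 1) ++ s.drop (topCount hl x s))

/-- The function `hl` records the heights of a path that continues with `w` after column `x`. -/
def Fits (hl : ℕ → ℤ) : ℕ → List Step → Prop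
  | _, [] => True
  | x, .U :: w => hl (x + 1) = hl x + 1 ∧ Fits hl (x + 1) w
  | x, .D :: w => hl (x + 1) = hl x - 1 ∧ Fits hl (x + 1) w

section

variable {q : ℝ} {hl : ℕ → ℤ} {O : Finset ℕ}

theorem topCount_le_length (x : ℕ) (s : List ℕ) : topCount hl x s ≤ s.length := by
  simpa [topCount] using (List.takeWhile_sublist (fun h => decide (h = hl x)) (l := s.map hl)).length_le

/-- Tiles of strictly smaller height can not end here, so they are invisible to the recursion until
the path returns to them. -/
theorem topCount_append_le {x : ℕ} (t : List ℕ) {s : List ℕ} (hs : ∀ b ∈ s, hl b < hl x) :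
    topCount hl x (t ++ s) = topCount hl x t := by
  have h0 : (s.map hl).takeWhile (fun h => decide (h = hl x)) = [] := by
    cases s with
    | nil => rfl
    | cons b s =>
      have := hs b (by simp)
      simp [this.ne]
  unfold topCount
  rw [List.map_append, List.takeWhile_append]
  split_ifs with h
  · rw [h0, List.append_nil]
    rw [List.length_map] at h
    rw [h, List.length_map]
  · rfl

theorem topCount_of_forall_eq {x : ℕ} {t : List ℕ} (ht : ∀ a ∈ t, hl a = hl x) :
    topCount hl x t = t.length := by
  unfold topCount
  rw [List.takeWhile_eq_self_iff.2 (by simpa using ht), List.length_map]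

theorem topCount_replicate_append {x a m : ℕ} {s : List ℕ} (ha : hl a = hl x)
    (hs : ∀ b ∈ s, hl b < hl x) : topCount hl x (List.replicate m a ++ s) = m := by
  rw [topCount_append_le _ hs, topCount_of_forall_eq (by simp +contextual [ha]), List.length_replicate]

theorem drop_replicate_append {m j a : ℕ} (h : j ≤ m) (s : List ℕ) :
    (List.replicate m a ++ s).drop j = List.replicate (m - j) a ++ s := by
  rw [List.drop_append_of_le_length (by simpa using h), List.drop_replicate]

theorem transfer_up {x a m : ℕ} {s : List ℕ} (ha : hl a = hl x) (hs : ∀ b ∈ s, hl b < hl x)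
    (w : List Step) :
    transfer q hl O (.U :: w) x (List.replicate m a ++ s) =
      ∑ j ∈ Finset.range (m + 1), q ^ j * transfer q hl O w (x + 1)
          (List.replicate j (x + 1) ++ (List.replicate (m - j) a ++ s)) +
        ∑ j ∈ Finset.range m, q ^ j * transfer q hl O w (x + 1)
          (List.replicate j (x + 1) ++ (List.replicate (m - 1 - j) a ++ s)) := by
  rw [transfer, topCount_replicate_append ha hs]
  congr 1
  · refine Finset.sum_congr rfl fun j hj => ?_
    rw [drop_replicate_append (by simp at hj; omega)]
  · refine Finset.sum_congr rfl fun j hj => ?_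
    rw [drop_replicate_append (by simp at hj; omega), Nat.sub_sub, add_comm 1 j]

theorem transfer_down {x : ℕ} {t s : List ℕ} (ht : ∀ a ∈ t, hl a = hl x)
    (hs : ∀ b ∈ s, hl b < hl x) (w : List Step) :
    transfer q hl O (.D :: w) x (t ++ s) =
      q ^ (t.length + s.length) *
        transfer q hl O w (x + 1) (List.replicate t.length (x + 1) ++ s) +
      q ^ (t.length + s.length + 1) *
        transfer q hl O w (x + 1) (List.replicate (t.length + 1) (x + 1) ++ s) := by
  rw [transfer, topCount_append_le _ hs, topCount_of_forall_eq ht, List.length_append,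
    List.drop_left]

/-- The value of the superposition of stacks with coefficients those of `linProd q 0 k`. -/
noncomputable def stackSum (q : ℝ) (hl : ℕ → ℤ) (O : Finset ℕ) (w : List Step) (x a : ℕ)
    (s : List ℕ) (k : ℕ) : ℝ :=
  moment (fun m => transfer q hl O w x (List.replicate m a ++ s)) (linProd q 0 k)

theorem stackSum_zero (w : List Step) (x a : ℕ) (s : List ℕ) :
    stackSum q hl O w x a s 0 = transfer q hl O w x s := by
  rw [stackSum, linProd_self, ← C_1, ← monomial_zero_left, moment_monomial]; simp

theorem stackSum_up {x a : ℕ} {s : List ℕ} (ha : hl a = hl x) (hs : ∀ b ∈ s, hl b < hl x)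
    (w : List Step) (k : ℕ) :
    stackSum q hl O (.U :: w) x a s k = ∑ j ∈ Finset.range (k + 1), q ^ j *
      moment (fun r => stackSum q hl O w (x + 1) (x + 1) (List.replicate r a ++ s) j)
        (linProd q j k) := by
  rw [stackSum, moment_congr fun m => transfer_up ha hs w]
  exact moment_up q (fun r j => transfer q hl O w (x + 1)
    (List.replicate j (x + 1) ++ (List.replicate r a ++ s))) k

theorem stackSum_down {x a : ℕ} {s : List ℕ} (ha : hl a = hl x) (hs : ∀ b ∈ s, hl b < hl x)
    (w : List Step) (k : ℕ) :
    stackSum q hl O (.D :: w) x a s k =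
      q ^ s.length * stackSum q hl O w (x + 1) (x + 1) s (k + 1) := by
  rw [stackSum, stackSum, ← moment_down, ← moment_mul_left]
  refine moment_congr (fun m => ?_) _
  rw [transfer_down (by simp +contextual [ha]) hs, List.length_replicate]
  ring

end

/-! ### Dyck words -/

/-- Dyck words: `node z z'` is the word `U z D z'`. -/
inductive Forest
  | nil
  | node (inner rest : Forest)

namespace Forest

/-- The word of a forest. -/
def word : Forest → List Step
  | nil => []
  | node z z' => .U :: (z.word ++ .D :: z'.word)

/-- The number of pairs. -/
def size : Forest → ℕ
  | nil => 0
  | node z z' => z.size + 1 + z'.size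

/-- The product of `1 / (1 - q ^ c)` over the lengths `c` of all pairs. -/
noncomputable def chordProd (q : ℝ) : Forest → ℝ
  | nil => 1
  | node z z' => z.chordProd q / (1 - q ^ (z.size + 1)) * z'.chordProd q

theorem length_word : ∀ z : Forest, z.word.length = 2 * z.size
  | nil => rfl
  | node z z' => by simp [word, size, length_word z, length_word z']; ring

end Forest

theorem Fits.forest {hl : ℕ → ℤ} : ∀ {z : Forest} {w : List Step} {x : ℕ},
    Fits hl x (z.word ++ w) → hl (x + 2 * z.size) = hl x ∧ Fits hl (x + 2 * z.size) w
  | .nil, _, _, h => ⟨by simp [Forest.size], h⟩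
  | .node z z', w, x, h => by
    simp only [Forest.word, List.cons_append, List.append_assoc, Fits] at h
    obtain ⟨h1, h2⟩ := h
    obtain ⟨h3, h4, h5⟩ := Fits.forest h2
    obtain ⟨h6, h7⟩ := Fits.forest h5
    rw [show x + 2 * (Forest.node z z').size = x + 1 + 2 * z.size + 1 + 2 * z'.size by
      simp [Forest.size]; ring]
    exact ⟨by omega, h7⟩

/-- The path goes below height `c` after column `x`, and is at height at least `c` until then. -/
def Descends (hl : ℕ → ℤ) (c : ℤ) : ℕ → List Step → Prop
  | _, [] => False
  | x, s :: w => c ≤ hl x ∧ (s = .D ∧ hl x = c ∨ Descends hl c (x + 1) w)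

theorem Descends.le {hl : ℕ → ℤ} {c : ℤ} {x : ℕ} {w : List Step} (h : Descends hl c x w) :
    c ≤ hl x := by
  cases w with
  | nil => exact h.elim
  | cons => exact h.1

theorem Descends.forest {hl : ℕ → ℤ} {c : ℤ} : ∀ {z : Forest} {w : List Step} {x : ℕ},
    Fits hl x (z.word ++ w) → Descends hl c (x + 2 * z.size) w → Descends hl c x (z.word ++ w)
  | .nil, _, _, _, h => h
  | .node z z', w, x, hf, h => by
    have hle := h.le
    rw [hf.forest.1] at hle
    simp only [Forest.word, List.cons_append, List.append_assoc, Fits] at hf ⊢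
    refine ⟨hle, .inr ?_⟩
    obtain ⟨h3, h4, h5⟩ := hf.2.forest
    refine Descends.forest hf.2 ⟨by omega, .inr ?_⟩
    refine Descends.forest h5 ?_
    rwa [show x + 1 + 2 * z.size + 1 + 2 * z'.size = x + 2 * (Forest.node z z').size by
      simp [Forest.size]; ring]

/-! ### Replacing, merging and splitting off tiles in a stack -/

section

variable {q : ℝ} {hl : ℕ → ℤ} {O : Finset ℕ}

theorem topCount_congr {x : ℕ} {t t' : List ℕ} (h : t.map hl = t'.map hl) :
    topCount hl x t = topCount hl x t' := by rw [topCount, h, topCount]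

theorem lt_of_mem_drop_topCount {x : ℕ} : ∀ {t : List ℕ}, t.Pairwise (fun a b => hl b ≤ hl a) →
    (∀ a ∈ t, hl a ≤ hl x) → ∀ a ∈ t.drop (topCount hl x t), hl a < hl x
  | [], _, _, a, ha => by simp at ha
  | b :: t, hp, hle, a, ha => by
    by_cases hb : hl b = hl x
    · have : topCount hl x (b :: t) = topCount hl x t + 1 := by simp [topCount, hb]
      rw [this, List.drop_succ_cons] at ha
      exact lt_of_mem_drop_topCount (List.pairwise_cons.1 hp).2 (fun a ha => hle a (by simp [ha])) a ha
    · have : topCount hl x (b :: t) = 0 := by simp [topCount, hb]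
      rw [this, List.drop_zero] at ha
      have h1 : hl b < hl x := lt_of_le_of_ne (hle b (by simp)) hb
      rcases List.mem_cons.1 ha with rfl | ha
      · exact h1
      · exact ((List.pairwise_cons.1 hp).1 a ha).trans_lt h1

/-- The columns of the tiles that must end may be replaced by others of the same height. -/
theorem transfer_congr_of_descends {c : ℤ} {s : List ℕ} (hs : ∀ b ∈ s, hl b < c) :
    ∀ (w : List Step) (x : ℕ) (t t' : List ℕ), Fits hl x w → Descends hl c x w →
      t.map hl = t'.map hl → t.Pairwise (fun a b => hl b ≤ hl a) →
      (∀ a ∈ t, c ≤ hl a ∧ hl a ≤ hl x) →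
      transfer q hl O w x (t ++ s) = transfer q hl O w x (t' ++ s)
  | [], _, _, _, _, h, _, _, _ => h.elim
  | .U :: w, x, t, t', hf, h, hm, hp, hle => by
    have hsx : ∀ b ∈ s, hl b < hl x := fun b hb => (hs b hb).trans_le h.1
    have hlen : t.length = t'.length := by simpa using congrArg List.length hm
    have key : ∀ i j, j ≤ t.length →
        transfer q hl O w (x + 1) (List.replicate i (x + 1) ++ (t ++ s).drop j) =
        transfer q hl O w (x + 1) (List.replicate i (x + 1) ++ (t' ++ s).drop j) := by
      intro i j hj
      rw [List.drop_append_of_le_length hj, List.drop_append_of_le_length (hlen ▸ hj),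
        ← List.append_assoc, ← List.append_assoc]
      have hd : ∀ a ∈ t.drop j, c ≤ hl a ∧ hl a ≤ hl x := fun a ha => hle a (List.mem_of_mem_drop ha)
      refine transfer_congr_of_descends hs w (x + 1) _ _ hf.2 (h.2.resolve_left (by simp)) ?_ ?_ ?_
      · rw [List.map_append, List.map_append, List.map_drop, hm, List.map_drop]
      · refine List.pairwise_append.2 ⟨by simp [List.pairwise_replicate], hp.drop, ?_⟩
        intro a ha b hb
        obtain rfl := List.eq_of_mem_replicate ha
        have := (hd b hb).2; have := hf.1; omega
      · intro a ha
        rcases List.mem_append.1 ha with ha | ha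
        · obtain rfl := List.eq_of_mem_replicate ha
          have := h.1; have := hf.1; omega
        · have := hd a ha; have := hf.1; omega
    have e : topCount hl x t' = topCount hl x t := topCount_congr hm.symm
    have hl' := topCount_le_length (hl := hl) x t
    rw [transfer, transfer, topCount_append_le _ hsx, topCount_append_le _ hsx, e]
    congr 1
    · refine Finset.sum_congr rfl fun j hj => ?_
      rw [key _ _ (by simp at hj; omega)]
    · refine Finset.sum_congr rfl fun j hj => ?_
      rw [key _ _ (by simp at hj; omega)]
  | .D :: w, x, t, t', hf, h, hm, hp, hle => by
    have hsx : ∀ b ∈ s, hl b < hl x := fun b hb => (hs b hb).trans_le h.1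
    have hlen : t.length = t'.length := by simpa using congrArg List.length hm
    have e : topCount hl x t' = topCount hl x t := topCount_congr hm.symm
    have hl' := topCount_le_length (hl := hl) x t
    have key : ∀ i, transfer q hl O w (x + 1)
          (List.replicate i (x + 1) ++ (t ++ s).drop (topCount hl x t)) =
        transfer q hl O w (x + 1)
          (List.replicate i (x + 1) ++ (t' ++ s).drop (topCount hl x t)) := by
      intro i
      rw [List.drop_append_of_le_length hl', List.drop_append_of_le_length (hlen ▸ hl')]
      -- At height `c` all tiles of `t` end at this down step and both stacks become the same; above
      -- `c` the induction continues.
      by_cases hc : hl x = c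
      · have : topCount hl x t = t.length :=
          topCount_of_forall_eq fun a ha => by have := hle a ha; omega
        rw [this, List.drop_length, hlen, List.drop_length]
      rw [← List.append_assoc, ← List.append_assoc]
      have hd : ∀ a ∈ t.drop (topCount hl x t), c ≤ hl a ∧ hl a ≤ hl (x + 1) := fun a ha => by
        have h1 := lt_of_mem_drop_topCount hp (fun a ha => (hle a ha).2) a ha
        have h2 := (hle a (List.mem_of_mem_drop ha)).1
        have h3 := hf.1
        omega
      have hd' : Descends hl c (x + 1) w := h.2.resolve_left fun h => hc h.2
      refine transfer_congr_of_descends hs w (x + 1) _ _ hf.2 hd' ?_ ?_ ?_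
      · rw [List.map_append, List.map_append, List.map_drop, hm, List.map_drop]
      · refine List.pairwise_append.2 ⟨by simp [List.pairwise_replicate], hp.drop, ?_⟩
        intro a ha b hb
        obtain rfl := List.eq_of_mem_replicate ha
        exact (hd b hb).2
      · intro a ha
        rcases List.mem_append.1 ha with ha | ha
        · obtain rfl := List.eq_of_mem_replicate ha
          exact ⟨hd'.le, le_rfl⟩
        · exact hd a ha
    rw [transfer, transfer, topCount_append_le _ hsx, topCount_append_le _ hsx, e, key, key]
    simp [hlen]

theorem map_eq_map_of_forall₂ {R : ℕ → ℕ → Prop} (hR : ∀ a b, R a b → hl a = hl b) {t t' : List ℕ}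
    (h : List.Forall₂ R t t') : t.map hl = t'.map hl := by
  induction h with
  | nil => rfl
  | cons h _ ih => rw [List.map_cons, List.map_cons, ih, hR _ _ h]

/-- Stacks that differ only by the columns of tiles at an even distance from height `e`. -/
def EvenEquiv (hl : ℕ → ℤ) (e : ℤ) : List ℕ → List ℕ → Prop :=
  List.Forall₂ fun a b => a = b ∨ hl a = hl b ∧ Even (e - hl a)

theorem EvenEquiv.map_eq {e : ℤ} {t t' : List ℕ} (h : EvenEquiv hl e t t') :
    t.map hl = t'.map hl :=
  map_eq_map_of_forall₂ (by rintro a b (rfl | h); exacts [rfl, h.1]) h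

theorem EvenEquiv.refl (e : ℤ) (t : List ℕ) : EvenEquiv hl e t t :=
  List.forall₂_same.2 fun _ _ => .inl rfl

theorem EvenEquiv.append {e : ℤ} {t t' s s' : List ℕ} (h : EvenEquiv hl e t t')
    (h' : EvenEquiv hl e s s') : EvenEquiv hl e (t ++ s) (t' ++ s') :=
  List.rel_append h h'

theorem EvenEquiv.count_eq {e : ℤ} {t t' : List ℕ} (h : EvenEquiv hl e t t') {c : ℕ}
    (hc : Odd (e - hl c)) : t.count c = t'.count c := by
  induction h with
  | nil => rfl
  | @cons a b t t' h _ ih =>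
    rcases h with rfl | ⟨h1, h2⟩
    · rw [List.count_cons, List.count_cons, ih]
    · have ha : a ≠ c := by rintro rfl; exact Int.not_even_iff_odd.2 hc h2
      have hb : b ≠ c := by rintro rfl; rw [h1] at h2; exact Int.not_even_iff_odd.2 hc h2
      rw [List.count_cons_of_ne ha, List.count_cons_of_ne hb, ih]

theorem EvenEquiv.finalWeight_eq {x : ℕ} {t t' : List ℕ} (h : EvenEquiv hl (hl x) t t') :
    finalWeight q hl O x t = finalWeight q hl O x t' := by
  have hm := h.map_eq
  have h1 : ∀ t : List ℕ, (∀ a ∈ t, ¬ (Even (hl x - hl a) ∧ 0 < hl x - hl a)) ↔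
      ∀ y ∈ t.map hl, ¬ (Even (hl x - y) ∧ 0 < hl x - y) := fun t => by simp
  have h2 : ∀ t : List ℕ, t.map (fun a => ((hl x - hl a - 1) / 2).toNat) =
      (t.map hl).map fun y => ((hl x - y - 1) / 2).toNat := fun t => by simp
  have h3 : (∀ a, Odd (hl x - hl a) → (Even (t.count a) ↔ a ∉ O)) ↔
      ∀ a, Odd (hl x - hl a) → (Even (t'.count a) ↔ a ∉ O) :=
    forall_congr' fun a => imp_congr_right fun ha => by rw [h.count_eq ha]
  have h4 : (∀ a ∈ t, ¬ (Even (hl x - hl a) ∧ 0 < hl x - hl a)) ↔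
      ∀ a ∈ t', ¬ (Even (hl x - hl a) ∧ 0 < hl x - hl a) := by rw [h1, h1, hm]
  rw [finalWeight, finalWeight, h2 t, h2 t', hm]
  classical exact if_congr (and_congr h4 h3) rfl rfl

/-- The columns of the tiles at an even distance from the final height may be replaced by others of
the same height. -/
theorem transfer_congr_of_even {e : ℤ} :
    ∀ (w : List Step) (x : ℕ) (t t' : List ℕ), hl (x + w.length) = e → EvenEquiv hl e t t' →
      transfer q hl O w x t = transfer q hl O w x t'
  | [], x, t, t', he, h => by
    rw [List.length_nil, add_zero] at he
    subst he
    exact h.finalWeight_eq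
  | .U :: w, x, t, t', he, h => by
    have key : ∀ i j, transfer q hl O w (x + 1) (List.replicate i (x + 1) ++ t.drop j) =
        transfer q hl O w (x + 1) (List.replicate i (x + 1) ++ t'.drop j) := fun i j =>
      transfer_congr_of_even w (x + 1) _ _ (by rw [← he, List.length_cons]; congr 1; ring)
        ((EvenEquiv.refl _ _).append (List.forall₂_drop _ h))
    simp only [transfer, topCount_congr h.map_eq, key]
  | .D :: w, x, t, t', he, h => by
    have key : ∀ i j, transfer q hl O w (x + 1) (List.replicate i (x + 1) ++ t.drop j) =
        transfer q hl O w (x + 1) (List.replicate i (x + 1) ++ t'.drop j) := fun i j =>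
      transfer_congr_of_even w (x + 1) _ _ (by rw [← he, List.length_cons]; congr 1; ring)
        ((EvenEquiv.refl _ _).append (List.forall₂_drop _ h))
    simp only [transfer, topCount_congr h.map_eq, key, List.Forall₂.length_eq h]

/-- Merging columns of the same height. -/
theorem transfer_add_transfer {O₁ O₂ O₃ : Finset ℕ} {ρ : ℕ → ℕ} {e : ℕ} (hρ : ∀ a, hl (ρ a) = hl a)
    (hfin : ∀ t, finalWeight q hl O₁ e t + finalWeight q hl O₂ e t =
      finalWeight q hl O₃ e (t.map ρ)) :
    ∀ (w : List Step) (x : ℕ) (t : List ℕ), x + w.length = e → (∀ y, x < y → ρ y = y) →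
      transfer q hl O₁ w x t + transfer q hl O₂ w x t = transfer q hl O₃ w x (t.map ρ)
  | [], x, t, he, _ => by
    rw [List.length_nil, add_zero] at he
    subst he
    exact hfin t
  | .U :: w, x, t, he, hx => by
    have e : topCount hl x (t.map ρ) = topCount hl x t := topCount_congr (by simp [hρ])
    have key : ∀ i j, transfer q hl O₁ w (x + 1) (List.replicate i (x + 1) ++ t.drop j) +
        transfer q hl O₂ w (x + 1) (List.replicate i (x + 1) ++ t.drop j) =
        transfer q hl O₃ w (x + 1) (List.replicate i (x + 1) ++ (t.map ρ).drop j) := fun i j => by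
      rw [transfer_add_transfer hρ hfin w (x + 1) _ (by rw [← he, List.length_cons]; ring)
        (fun y hy => hx y (by omega))]
      simp [hx (x + 1), List.map_drop]
    simp only [transfer, e, ← key, mul_add, Finset.sum_add_distrib]
    ring
  | .D :: w, x, t, he, hx => by
    have e : topCount hl x (t.map ρ) = topCount hl x t := topCount_congr (by simp [hρ])
    have key : ∀ i j, transfer q hl O₁ w (x + 1) (List.replicate i (x + 1) ++ t.drop j) +
        transfer q hl O₂ w (x + 1) (List.replicate i (x + 1) ++ t.drop j) =
        transfer q hl O₃ w (x + 1) (List.replicate i (x + 1) ++ (t.map ρ).drop j) := fun i j => by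
      rw [transfer_add_transfer hρ hfin w (x + 1) _ (by rw [← he, List.length_cons]; ring)
        (fun y hy => hx y (by omega))]
      simp [hx (x + 1), List.map_drop]
    simp only [transfer, e, ← key, List.length_map]
    ring

/-- The number of down steps. -/
def downs (w : List Step) : ℕ := w.count .D

/-- Tiles that can not end before the last column split off as a factor. -/
theorem transfer_append_replicate {O₁ O₂ : Finset ℕ} {a r e : ℕ} {κ : ℝ}
    (hfin : ∀ t, a ∉ t →
      finalWeight q hl O₁ e (t ++ List.replicate r a) = κ * finalWeight q hl O₂ e t) :
    ∀ (w : List Step) (x : ℕ) (t : List ℕ), x + w.length = e → a ≤ x → a ∉ t →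
      (∀ y, x ≤ y → y < e → hl a < hl y) →
      transfer q hl O₁ w x (t ++ List.replicate r a) =
        κ * q ^ (r * downs w) * transfer q hl O₂ w x t
  | [], x, t, he, _, ht, _ => by
    rw [List.length_nil, add_zero] at he
    subst he
    simp [transfer, hfin t ht, downs]
  | .U :: w, x, t, he, hax, ht, hlt => by
    rw [List.length_cons] at he
    have htop : topCount hl x (t ++ List.replicate r a) = topCount hl x t :=
      topCount_append_le _ fun b hb => by
        rw [List.eq_of_mem_replicate hb]; exact hlt x le_rfl (by omega)
    have hle := topCount_le_length (hl := hl) x t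
    have key : ∀ i j, j ≤ t.length → transfer q hl O₁ w (x + 1) (List.replicate i (x + 1) ++
        (t ++ List.replicate r a).drop j) = κ * q ^ (r * downs w) *
          transfer q hl O₂ w (x + 1) (List.replicate i (x + 1) ++ t.drop j) := fun i j hj => by
      rw [List.drop_append_of_le_length hj, ← List.append_assoc]
      refine transfer_append_replicate hfin w (x + 1) _ (by omega) (by omega) ?_
        fun y hy => hlt y (by omega)
      simp only [List.mem_append, List.mem_replicate, not_or]
      exact ⟨by omega, fun h => ht (List.mem_of_mem_drop h)⟩
    have hd : downs (.U :: w) = downs w := by simp [downs]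
    rw [transfer, transfer, htop, hd, mul_add, Finset.mul_sum, Finset.mul_sum]
    congr 1
    · refine Finset.sum_congr rfl fun j hj => ?_
      rw [key _ _ (by simp at hj; omega)]; ring
    · refine Finset.sum_congr rfl fun j hj => ?_
      rw [key _ _ (by simp at hj; omega)]; ring
  | .D :: w, x, t, he, hax, ht, hlt => by
    rw [List.length_cons] at he
    have htop : topCount hl x (t ++ List.replicate r a) = topCount hl x t :=
      topCount_append_le _ fun b hb => by
        rw [List.eq_of_mem_replicate hb]; exact hlt x le_rfl (by omega)
    have hle := topCount_le_length (hl := hl) x t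
    have key : ∀ i, transfer q hl O₁ w (x + 1) (List.replicate i (x + 1) ++
        (t ++ List.replicate r a).drop (topCount hl x t)) = κ * q ^ (r * downs w) *
          transfer q hl O₂ w (x + 1) (List.replicate i (x + 1) ++ t.drop (topCount hl x t)) :=
        fun i => by
      rw [List.drop_append_of_le_length hle, ← List.append_assoc]
      refine transfer_append_replicate hfin w (x + 1) _ (by omega) (by omega) ?_
        fun y hy => hlt y (by omega)
      simp only [List.mem_append, List.mem_replicate, not_or]
      exact ⟨by omega, fun h => ht (List.mem_of_mem_drop h)⟩
    have hd : downs (.D :: w) = downs w + 1 := by simp [downs]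
    rw [transfer, transfer, htop, hd, key, key]
    simp only [List.length_append, List.length_replicate]
    ring

/-- If an odd number of tiles has to start in a column, then some tile has to start there. -/
theorem transfer_eq_zero_of_notMem {b e : ℕ} (hb : b ∈ O) (hodd : Odd (hl e - hl b)) :
    ∀ (w : List Step) (x : ℕ) (t : List ℕ), x + w.length = e → b ≤ x → b ∉ t →
      transfer q hl O w x t = 0
  | [], x, t, he, _, ht => by
    rw [List.length_nil, add_zero] at he
    subst he
    rw [transfer, finalWeight, if_neg]
    rintro ⟨-, h⟩
    have := h b hodd
    rw [List.count_eq_zero_of_not_mem ht] at this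
    simp [hb] at this
  | s :: w, x, t, he, hx, ht => by
    rw [List.length_cons] at he
    have key : ∀ i j, transfer q hl O w (x + 1) (List.replicate i (x + 1) ++ t.drop j) = 0 :=
      fun i j => by
      refine transfer_eq_zero_of_notMem hb hodd w (x + 1) _ (by omega) (by omega) ?_
      simp only [List.mem_append, List.mem_replicate, not_or]
      exact ⟨by omega, fun h => ht (List.mem_of_mem_drop h)⟩
    cases s <;> simp [transfer, key]

/-- If an odd number of tiles has to start in a column, then the tiles below them can not end. -/
theorem transfer_append_replicate_of_mem {O₁ O₂ : Finset ℕ} {a b r e : ℕ} {κ : ℝ}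
    (hb₁ : b ∈ O₁) (hb₂ : b ∈ O₂) (hodd : Odd (hl e - hl b)) (hab : a ≠ b)
    (hfin : ∀ t, a ∉ t →
      finalWeight q hl O₁ e (t ++ List.replicate r a) = κ * finalWeight q hl O₂ e t) :
    ∀ (w : List Step) (x : ℕ) (t : List ℕ), x + w.length = e → a ≤ x → b ≤ x → a ∉ t →
      transfer q hl O₁ w x (t ++ List.replicate r a) =
        κ * q ^ (r * downs w) * transfer q hl O₂ w x t
  | [], x, t, he, _, _, ht => by
    rw [List.length_nil, add_zero] at he
    subst he
    simp [transfer, hfin t ht, downs]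
  | s :: w, x, t, he, hax, hbx, ht => by
    rw [List.length_cons] at he
    have hle := topCount_le_length (hl := hl) x t
    have key : ∀ i j, j ≤ t.length → transfer q hl O₁ w (x + 1) (List.replicate i (x + 1) ++
        (t ++ List.replicate r a).drop j) = κ * q ^ (r * downs w) *
          transfer q hl O₂ w (x + 1) (List.replicate i (x + 1) ++ t.drop j) := fun i j hj => by
      rw [List.drop_append_of_le_length hj, ← List.append_assoc]
      refine transfer_append_replicate_of_mem hb₁ hb₂ hodd hab hfin w (x + 1) _ (by omega)
        (by omega) (by omega) ?_
      simp only [List.mem_append, List.mem_replicate, not_or]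
      exact ⟨by omega, fun h => ht (List.mem_of_mem_drop h)⟩
    -- If all of `t` ends, no tile starting at `b` is left and none can appear later, so the odd
    -- number required at `b` is out of reach.
    have key0 : ∀ i j, t.length ≤ j → transfer q hl O₁ w (x + 1) (List.replicate i (x + 1) ++
        (t ++ List.replicate r a).drop j) = 0 := fun i j hj => by
      refine transfer_eq_zero_of_notMem hb₁ hodd w (x + 1) _ (by omega) (by omega) ?_
      rw [List.drop_append, List.drop_eq_nil_of_le hj, List.nil_append, List.drop_replicate]
      simp only [List.mem_append, List.mem_replicate, not_or]
      exact ⟨by omega, fun h => hab h.2.symm⟩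
    have key0' : ∀ i, transfer q hl O₂ w (x + 1) (List.replicate i (x + 1) ++
        t.drop t.length) = 0 := fun i => by
      refine transfer_eq_zero_of_notMem hb₂ hodd w (x + 1) _ (by omega) (by omega) ?_
      rw [List.drop_length]
      simp only [List.mem_append, List.mem_replicate, not_or]
      exact ⟨by omega, by simp⟩
    -- Either the tiles starting at `a` do not change the number of tiles that may end, or all of
    -- `t` may end; the additional terms of the second case vanish by `key0`.
    have htop : topCount hl x (t ++ List.replicate r a) = topCount hl x t ∨
        topCount hl x t = t.length ∧ t.length ≤ topCount hl x (t ++ List.replicate r a) := by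
      unfold topCount
      rw [List.map_append, List.takeWhile_append]
      split_ifs with h
      · right
        rw [List.length_append, h, List.length_map]
        exact ⟨rfl, by omega⟩
      · exact .inl rfl
    cases s with
    | U =>
      have hd : downs (.U :: w) = downs w := by simp [downs]
      rw [transfer, transfer, hd, mul_add, Finset.mul_sum, Finset.mul_sum]
      have hsub : topCount hl x t ≤ topCount hl x (t ++ List.replicate r a) := by omega
      congr 1
      · rw [← Finset.sum_subset (Finset.range_mono (Nat.succ_le_succ hsub))]
        · refine Finset.sum_congr rfl fun j hj => ?_
          rw [key _ _ (by simp at hj; omega)]; ring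
        · intro j hj hj'
          simp only [Finset.mem_range] at hj hj'
          rw [key0 _ _ (by omega), mul_zero]
      · rw [← Finset.sum_subset (Finset.range_mono hsub)]
        · refine Finset.sum_congr rfl fun j hj => ?_
          rw [key _ _ (by simp at hj; omega)]; ring
        · intro j hj hj'
          simp only [Finset.mem_range] at hj hj'
          rw [key0 _ _ (by omega), mul_zero]
    | D =>
      have hd : downs (.D :: w) = downs w + 1 := by simp [downs]
      rw [transfer, transfer, hd]
      rcases htop with h | ⟨h1, h2⟩
      · rw [h, key _ _ hle, key _ _ hle]
        simp only [List.length_append, List.length_replicate]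
        ring
      · rw [key0 _ _ h2, key0 _ _ h2, h1, key0', key0']
        simp

end

/-! ### Passing a Dyck word -/

section

variable {q : ℝ} {hl : ℕ → ℤ} {O : Finset ℕ}

/-- Tiles of height `c` that are open after a Dyck word followed by `w'` may be merged. -/
def Mergeable (q : ℝ) (hl : ℕ → ℤ) (O : Finset ℕ) (c : ℤ) (e : ℕ) (w' : List Step) : Prop :=
  ∀ (z : Forest) (x : ℕ), Fits hl x (z.word ++ w') → hl x = c → x + (z.word ++ w').length = e →
    ∀ (l r a b : ℕ) (s : List ℕ), hl a = c → hl b = c → (∀ i ∈ s, hl i < c) →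
      transfer q hl O (z.word ++ w') x (List.replicate l b ++ (List.replicate r a ++ s)) =
        transfer q hl O (z.word ++ w') x (List.replicate (l + r) a ++ s)

/-- The next step after the Dyck word goes below height `c`, so the tiles in question have to end by
then and their columns never reach the final condition. -/
theorem mergeable_down (c : ℤ) (e : ℕ) (w' : List Step) : Mergeable q hl O c e (.D :: w') := by
  intro z x hf hx _ l r a b s ha hb hs
  rw [← List.append_assoc]
  refine transfer_congr_of_descends hs _ _ _ _ hf (Descends.forest hf ?_) ?_ ?_ ?_
  · have := hf.forest.1
    exact ⟨by omega, .inl ⟨rfl, by omega⟩⟩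
  · simp [ha, hb]
  · refine List.pairwise_iff_forall_sublist.2 fun {i j} h => ?_
    have h1 := h.subset
    have hi : i ∈ List.replicate l b ++ List.replicate r a := h1 (by simp)
    have hj : j ∈ List.replicate l b ++ List.replicate r a := h1 (by simp)
    simp only [List.mem_append, List.mem_replicate] at hi hj
    rcases hi with ⟨-, rfl⟩ | ⟨-, rfl⟩ <;> rcases hj with ⟨-, rfl⟩ | ⟨-, rfl⟩ <;> omega
  · intro i hi
    simp only [List.mem_append, List.mem_replicate] at hi
    rcases hi with ⟨-, rfl⟩ | ⟨-, rfl⟩ <;> omega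

/-- The parity condition at the end concerns odd height differences only; for even ones the final
weight depends on heights alone. -/
theorem mergeable_of_even {c : ℤ} {e : ℕ} (h : Even (hl e - c)) (w' : List Step) :
    Mergeable q hl O c e w' := by
  intro z x hf hx he l r a b s ha hb hs
  rw [← List.append_assoc]
  refine transfer_congr_of_even (e := hl e) _ _ _ _ (by rw [he]) (.append ?_ (.refl _ _))
  rw [List.replicate_add]
  refine .append ?_ (.refl _ _)
  refine List.forall₂_iff_get.2 ⟨by simp, fun i h1 h2 => .inr ?_⟩
  simp [ha, hb, h]

/-- The `U` cuts the superposition at `j`, the enclosed word `w` acts by its scalar `hw`, and the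
`D` adds one more factor. During this the `r` old tiles lie strictly below and pay `q` at each of
the `w.size + 1` down steps. Nothing is merged yet, so this serves even and odd levels alike. -/
theorem stackSum_node {w : Forest} {w' : List Step} {e : ℕ}
    (hw : ∀ (x a : ℕ) (s : List ℕ) (k : ℕ), Fits hl x (w.word ++ .D :: w') → hl a = hl x →
      (∀ b ∈ s, hl b < hl x) → x + (w.word ++ .D :: w').length = e →
      stackSum q hl O (w.word ++ .D :: w') x a s k =
        q ^ (w.size * s.length) * (w.chordProd q * risingProd q k w.size) *
          stackSum q hl O (.D :: w') (x + 2 * w.size) a s (k + w.size))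
    {x a : ℕ} {s : List ℕ} (hf : Fits hl x (.U :: (w.word ++ .D :: w'))) (ha : hl a = hl x)
    (hs : ∀ b ∈ s, hl b < hl x) (he : x + (.U :: (w.word ++ .D :: w') : List Step).length = e)
    (k : ℕ) :
    stackSum q hl O (.U :: (w.word ++ .D :: w')) x a s k =
      q ^ ((w.size + 1) * s.length) * ∑ j ∈ Finset.range (k + 1),
        q ^ j * (w.chordProd q * risingProd q j w.size) *
          moment (fun r => q ^ ((w.size + 1) * r) * stackSum q hl O w' (x + 2 * (w.size + 1))
            (x + 2 * (w.size + 1)) (List.replicate r a ++ s) (j + (w.size + 1)))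
            (linProd q j k) := by
  rw [stackSum_up ha hs, Finset.mul_sum]
  refine Finset.sum_congr rfl fun j hj => ?_
  trans q ^ j * moment (fun r => (q ^ ((w.size + 1) * s.length) *
      (w.chordProd q * risingProd q j w.size)) * (q ^ ((w.size + 1) * r) *
        stackSum q hl O w' (x + 2 * (w.size + 1)) (x + 2 * (w.size + 1)) (List.replicate r a ++ s)
          (j + (w.size + 1)))) (linProd q j k)
  swap
  · rw [moment_mul_left]; ring
  congr 1
  refine moment_congr (fun r => ?_) _
  have hs' : ∀ b ∈ List.replicate r a ++ s, hl b < hl (x + 1) := by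
    intro b hb
    have := hf.1
    rcases List.mem_append.1 hb with hb | hb
    · rw [List.eq_of_mem_replicate hb]; omega
    · have := hs b hb; omega
  obtain ⟨h1, h2⟩ := hf.2.forest
  rw [hw (x + 1) (x + 1) _ j hf.2 rfl hs' (by rw [← he, List.length_cons]; ring),
    stackSum_down h1.symm (by rw [h1]; exact hs'),
    show x + 1 + 2 * w.size + 1 = x + 2 * (w.size + 1) by ring,
    show j + w.size + 1 = j + (w.size + 1) by ring, List.length_append, List.length_replicate]
  ring

/-- The weight `q ^ (n * r)` moves the window of the old tiles to `j + n, …, k + n`, next to the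
window of the new ones. Once the tiles are merged only their total number matters, and the two
products join into one. -/
theorem moment_stackSum_merge {w' : List Step} {z : Forest} {c : ℤ} {e : ℕ}
    (hm : Mergeable q hl O c e w') {x a : ℕ} {s : List ℕ} (hf : Fits hl x (z.word ++ w'))
    (hx : hl x = c) (he : x + (z.word ++ w').length = e) (ha : hl a = c) (hs : ∀ i ∈ s, hl i < c)
    (n : ℕ) {j k : ℕ} (hjk : j ≤ k) :
    moment (fun r => q ^ (n * r) *
        stackSum q hl O (z.word ++ w') x x (List.replicate r a ++ s) (j + n)) (linProd q j k) =
      stackSum q hl O (z.word ++ w') x a s (k + n) := by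
  rw [moment_pow_mul_linProd q _ n hjk]
  simp only [stackSum]
  rw [moment_congr (fun r => moment_congr (fun l => hm z x hf hx he l r a x s ha hx hs) _),
    moment_moment_add (fun m => transfer q hl O (z.word ++ w') x (List.replicate m a ++ s)),
    mul_comm, linProd_mul q (Nat.zero_le _) (by omega)]

theorem stackSum_forest (h0 : 0 < q) (h1 : q < 1) (z : Forest) :
    ∀ (w' : List Step) (e x a : ℕ) (s : List ℕ) (k : ℕ), Mergeable q hl O (hl x) e w' →
      Fits hl x (z.word ++ w') → hl a = hl x → (∀ b ∈ s, hl b < hl x) →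
      x + (z.word ++ w').length = e →
      stackSum q hl O (z.word ++ w') x a s k =
        q ^ (z.size * s.length) * (z.chordProd q * risingProd q k z.size) *
          stackSum q hl O w' (x + 2 * z.size) a s (k + z.size) := by
  induction z with
  | nil => intro w' e x a s k _ _ _ _ _; simp [Forest.word, Forest.size, Forest.chordProd, risingProd]
  | node w z' ihw ihz =>
    intro w' e x a s k hm hf ha hs he
    have hword : (Forest.node w z').word ++ w' = .U :: (w.word ++ .D :: (z'.word ++ w')) := by
      simp [Forest.word]
    rw [hword] at hf he ⊢
    rw [stackSum_node (fun x a s k hf ha hs he =>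
      ihw (.D :: (z'.word ++ w')) e x a s k (mergeable_down _ _ _) hf ha hs he) hf ha hs he]
    obtain ⟨h2, h3, h4⟩ := hf.2.forest
    have hx' : hl (x + 2 * (w.size + 1)) = hl x := by
      have := hf.1
      rw [show x + 2 * (w.size + 1) = x + 1 + 2 * w.size + 1 by ring]; omega
    rw [show x + 1 + 2 * w.size + 1 = x + 2 * (w.size + 1) by ring] at h4
    have he' : x + 2 * (w.size + 1) + (z'.word ++ w').length = e := by
      rw [← he]; simp [Forest.length_word]; ring
    -- After merging, the remaining stack sum no longer depends on the cut `j`, so the sum over `j`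
    -- is a hockey stick and yields the factor of the outer pair.
    have key : ∀ j ∈ Finset.range (k + 1), q ^ j * (w.chordProd q * risingProd q j w.size) *
          moment (fun r => q ^ ((w.size + 1) * r) * stackSum q hl O (z'.word ++ w')
            (x + 2 * (w.size + 1)) (x + 2 * (w.size + 1)) (List.replicate r a ++ s)
            (j + (w.size + 1))) (linProd q j k) = q ^ j * risingProd q j w.size *
          (w.chordProd q * stackSum q hl O (z'.word ++ w') (x + 2 * (w.size + 1)) a s
            (k + (w.size + 1))) := by
      intro j hj
      rw [moment_stackSum_merge hm h4 hx' he' ha hs _ (by simp at hj; omega)]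
      ring
    rw [Finset.sum_congr rfl key, ← Finset.sum_mul,
      ihz w' e _ a s _ (by rwa [hx']) h4 (by rw [hx', ha]) (by rwa [hx']) he',
      ← mul_right_cancel₀ (one_sub_pow_ne_zero h0 h1 w.size)
        ((sum_pow_mul_risingProd q k w.size).trans
          (div_mul_cancel₀ _ (one_sub_pow_ne_zero h0 h1 w.size)).symm).symm]
    simp only [Forest.size, Forest.chordProd]
    rw [risingProd_add q k (w.size + 1), show x + 2 * (w.size + 1) + 2 * z'.size = x + 2 * (w.size + 1 + z'.size) by ring,
      show k + (w.size + 1) + z'.size = k + (w.size + 1 + z'.size) by ring]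
    ring

end

/-! ### Final weights -/

section

variable {q : ℝ} {hl : ℕ → ℤ} {O : Finset ℕ}

/-- The tiles from column `a` enter the final condition only through the parity of `r`, which `P`
encodes, and each of them contributes `p` to art. -/
theorem finalWeight_append_replicate {e a r : ℕ} {t : List ℕ} {O' : Finset ℕ} {P : Prop} [Decidable P]
    (p : ℕ) (ha : hl e - hl a = 2 * p + 1) (ht : a ∉ t) (hO : ∀ b, b ≠ a → (b ∈ O' ↔ b ∈ O))
    (haO : a ∉ O) (hP : (Even r ↔ a ∉ O') ↔ P) :
    finalWeight q hl O' e (t ++ List.replicate r a) =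
      (if P then q ^ (p * r) else 0) * finalWeight q hl O e t := by
  have h1 : (∀ b ∈ t ++ List.replicate r a, ¬ (Even (hl e - hl b) ∧ 0 < hl e - hl b)) ↔
      ∀ b ∈ t, ¬ (Even (hl e - hl b) ∧ 0 < hl e - hl b) := by
    refine ⟨fun h b hb => h b (by simp [hb]), fun h b hb => ?_⟩
    rcases List.mem_append.1 hb with hb | hb
    · exact h b hb
    · rw [List.eq_of_mem_replicate hb, ha]
      rintro ⟨h, -⟩
      rw [Int.even_iff] at h; omega
  have h2 : (∀ b, Odd (hl e - hl b) → (Even ((t ++ List.replicate r a).count b) ↔ b ∉ O')) ↔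
      P ∧ ∀ b, Odd (hl e - hl b) → (Even (t.count b) ↔ b ∉ O) := by
    have hca : (t ++ List.replicate r a).count a = r := by
      rw [List.count_append, List.count_eq_zero_of_not_mem ht]; simp
    have hcb : ∀ b, b ≠ a → (t ++ List.replicate r a).count b = t.count b := fun b hb => by
      rw [List.count_append, List.count_replicate]; simp [Ne.symm hb]
    constructor
    · intro h
      refine ⟨hP.1 (hca ▸ h a ⟨p, ha⟩), fun b hb => ?_⟩
      by_cases hba : b = a
      · subst hba; simp [List.count_eq_zero_of_not_mem ht, haO]
      · rw [← hcb b hba, h b hb, hO b hba]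
    · rintro ⟨h, h'⟩ b hb
      by_cases hba : b = a
      · subst hba; rw [hca]; exact hP.2 h
      · rw [hcb b hba, h' b hb, hO b hba]
  have h3 : ((t ++ List.replicate r a).map fun a => ((hl e - hl a - 1) / 2).toNat).sum =
      p * r + (t.map fun a => ((hl e - hl a - 1) / 2).toNat).sum := by
    have : ((hl e - hl a - 1) / 2).toNat = p := by omega
    simp [this]; ring
  unfold finalWeight
  rw [h3]
  by_cases hP' : P
  · rw [if_pos hP', pow_add, mul_ite, mul_zero]
    classical exact if_congr (by rw [h1, h2]; tauto) rfl rfl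
  · rw [if_neg hP', zero_mul, if_neg]
    rw [h2]; tauto

/-- Ballot tiles of positive even height are forbidden, so no such tile may survive. -/
theorem finalWeight_append_replicate_of_even {e a r : ℕ} {t : List ℕ} (h : Even (hl e - hl a))
    (hpos : 0 < hl e - hl a) :
    finalWeight q hl O e (t ++ List.replicate r a) =
      (if r = 0 then 1 else 0) * finalWeight q hl O e t := by
  rcases r with _ | r
  · simp
  · rw [finalWeight, if_neg]
    · simp
    · exact fun h' => h'.1 a (by simp) ⟨h, hpos⟩

theorem count_map_merge {a b : ℕ} (hab : a ≠ b) (t : List ℕ) (c : ℕ) :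
    (t.map fun y => if y = a then b else y).count c =
      if c = a then 0 else if c = b then t.count a + t.count b else t.count c := by
  induction t with
  | nil => simp
  | cons y t ih =>
    rw [List.map_cons, List.count_cons, ih]
    simp only [List.count_cons, beq_iff_eq]
    split_ifs <;> omega

theorem ite_add_ite_of_iff {A E E' X X' Q₁ Q₂ Q₃ : Prop} [Decidable Q₁] [Decidable Q₂]
    [Decidable Q₃] (v : ℝ) (h₁ : Q₁ ↔ A ∧ (E ↔ X) ∧ (E' ↔ X'))
    (h₂ : Q₂ ↔ A ∧ (E ↔ ¬ X) ∧ (E' ↔ ¬ X')) (h₃ : Q₃ ↔ A ∧ ((E ↔ E') ↔ (X ↔ X'))) :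
    (if Q₁ then v else 0) + (if Q₂ then v else 0) = if Q₃ then v else 0 := by
  classical
  rw [if_congr h₁ rfl rfl, if_congr h₂ rfl rfl, if_congr h₃ rfl rfl]
  by_cases A <;> by_cases E <;> by_cases E' <;> by_cases X <;> by_cases X' <;> simp [*]

/-- A total parity splits into two pairs of parities: an even total is even plus even or odd plus
odd, and an odd total is odd plus even or even plus odd. The sets `O₁` and `O₂` are complementary on
`{a, b}` and list the two cases. -/
theorem finalWeight_merge {O₁ O₂ O₃ : Finset ℕ} {e a b : ℕ} (hab : a ≠ b) (h : hl a = hl b)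
    (hodd : Odd (hl e - hl b))
    (hO₁ : ∀ c, c ≠ a → c ≠ b → c ∉ O₁) (hO₂ : ∀ c, c ≠ a → c ≠ b → c ∉ O₂)
    (hO₃ : ∀ c, c ≠ b → c ∉ O₃) (h12 : (a ∈ O₁ ↔ a ∉ O₂) ∧ (b ∈ O₁ ↔ b ∉ O₂))
    (h13 : b ∈ O₃ ↔ ¬ (a ∈ O₁ ↔ b ∈ O₁)) (t : List ℕ) :
    finalWeight q hl O₁ e t + finalWeight q hl O₂ e t =
      finalWeight q hl O₃ e (t.map fun y => if y = a then b else y) := by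
  have hρ : ∀ y, hl (if y = a then b else y) = hl y := fun y => by split_ifs with hy <;> simp [hy, h]
  have h1 : (∀ y ∈ t.map fun y => if y = a then b else y,
      ¬ (Even (hl e - hl y) ∧ 0 < hl e - hl y)) ↔
      ∀ y ∈ t, ¬ (Even (hl e - hl y) ∧ 0 < hl e - hl y) := by
    simp only [List.forall_mem_map, hρ]
  have h2 : ((t.map fun y => if y = a then b else y).map
      fun y => ((hl e - hl y - 1) / 2).toNat) = t.map fun y => ((hl e - hl y - 1) / 2).toNat := by
    simp [hρ]
  set R := ∀ c, c ≠ a → c ≠ b → Odd (hl e - hl c) → Even (t.count c) with hR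
  have split : ∀ (O : Finset ℕ) (u : List ℕ), (∀ c, c ≠ a → c ≠ b → c ∉ O) →
      (∀ c, c ≠ a → c ≠ b → u.count c = t.count c) →
      ((∀ c, Odd (hl e - hl c) → (Even (u.count c) ↔ c ∉ O)) ↔
        R ∧ (Even (u.count a) ↔ a ∉ O) ∧ (Even (u.count b) ↔ b ∉ O)) := by
    intro O u hO hu
    constructor
    · exact fun H => ⟨fun c h1 h2 h3 => by rw [← hu c h1 h2]; exact (H c h3).2 (hO c h1 h2),
        H a (h ▸ hodd), H b hodd⟩
    · rintro ⟨H1, H2, H3⟩ c hc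
      by_cases ca : c = a
      · rwa [ca]
      by_cases cb : c = b
      · rwa [cb]
      rw [hu c ca cb]
      exact iff_of_true (H1 c ca cb hc) (hO c ca cb)
  have k1 := split O₁ t hO₁ (fun _ _ _ => rfl)
  have k2 := split O₂ t hO₂ (fun _ _ _ => rfl)
  have k3 := split O₃ (t.map fun y => if y = a then b else y) (fun c _ hc => hO₃ c hc)
    (fun c ca cb => by rw [count_map_merge hab, if_neg ca, if_neg cb])
  have ha3 := hO₃ a hab
  rw [count_map_merge hab, count_map_merge hab, if_pos rfl, if_neg hab.symm, if_pos rfl,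
    Nat.even_add] at k3
  unfold finalWeight
  rw [h2]
  classical
  refine ite_add_ite_of_iff (A := (∀ y ∈ t, ¬ (Even (hl e - hl y) ∧ 0 < hl e - hl y)) ∧ R)
    (E := Even (t.count a)) (E' := Even (t.count b)) (X := a ∉ O₁) (X' := b ∉ O₁) _ ?_ ?_ ?_
  · rw [k1, and_assoc]
  · rw [k2, and_assoc, h12.1, h12.2, not_not, not_not]
  · rw [h1, k3, and_assoc, h13, not_not, not_iff_not]
    simp [ha3]

end

/-! ### Summations -/

section

variable {q : ℝ}

theorem plusProd_mul_pred (q : ℝ) (k M : ℕ) :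
    (1 + q ^ (M + 1)) * plusProd q k (M + 1) = plusProd q k M * (1 + q ^ (k + 1 + M)) := by
  rw [← plusProd_succ', plusProd_succ]

/-- At `q ^ N` the value of `linProd q j k` completes `plusProd q j N` to `plusProd q k N`, and a
hockey stick remains; at `-q ^ N` the sum is `sum_risingProd_mul_plusProd`. Half the sum and half
the difference select the even and the odd numbers of tiles. -/
theorem sum_risingProd_eval_add (h0 : 0 < q) (h1 : q < 1) (k N : ℕ) :
    ∑ j ∈ Finset.range (k + 1), q ^ j * risingProd q j N * plusProd q j N *
      (((linProd q j k).eval (q ^ N) + (linProd q j k).eval (-q ^ N)) / 2) =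
      risingProd q k N * plusProd q k N * (1 - q ^ (2 * (N + 1) + k)) /
        ((1 - q ^ (N + 1)) * (1 + q ^ (N + 1))) ∧
    ∑ j ∈ Finset.range (k + 1), q ^ j * risingProd q j N * plusProd q j N *
      (((linProd q j k).eval (q ^ N) - (linProd q j k).eval (-q ^ N)) / 2) =
      risingProd q k N * plusProd q k N * q ^ (N + 1) * (1 - q ^ k) /
        ((1 - q ^ (N + 1)) * (1 + q ^ (N + 1))) := by
  have hA : 1 - q ^ (N + 1) ≠ 0 := one_sub_pow_ne_zero h0 h1 N
  have hA' : 1 + q ^ (N + 1) ≠ 0 := by positivity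
  have s1 : ∑ j ∈ Finset.range (k + 1), q ^ j * risingProd q j N * plusProd q j N *
      (linProd q j k).eval (q ^ N) =
      risingProd q k N * plusProd q k N * (1 - q ^ (N + 1 + k)) / (1 - q ^ (N + 1)) := by
    rw [eq_div_iff hA]
    have h := sum_pow_mul_risingProd q k N
    rw [risingProd_succ] at h
    have e : ∀ j ∈ Finset.range (k + 1), q ^ j * risingProd q j N * plusProd q j N *
        (linProd q j k).eval (q ^ N) = q ^ j * risingProd q j N * plusProd q k N := by
      intro j hj
      rw [eval_linProd, mul_assoc (q ^ j * _), plusProd, plusProd,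
        ← Finset.prod_range_mul_prod_Ico _ (by simp at hj; omega : j ≤ k)]
      simp only [pow_add]
    rw [Finset.sum_congr rfl e, ← Finset.sum_mul, mul_right_comm, h]
    ring
  have s2 : ∑ j ∈ Finset.range (k + 1), q ^ j * risingProd q j N * plusProd q j N *
      (linProd q j k).eval (-q ^ N) =
      risingProd q k N * plusProd q k N * (1 + q ^ (N + 1 + k)) / (1 + q ^ (N + 1)) := by
    rw [eq_div_iff hA']
    have h := sum_risingProd_mul_plusProd q k N
    have e : ∀ j ∈ Finset.range (k + 1), q ^ j * risingProd q j N * plusProd q j N *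
        (linProd q j k).eval (-q ^ N) = q ^ j * risingProd q j N *
        (∏ i ∈ Finset.Ico j k, (1 - q ^ (i + 1 + N))) * plusProd q j N := by
      intro j hj
      rw [eval_linProd]
      simp only [pow_add, mul_neg, ← sub_eq_add_neg]
      ring
    rw [Finset.sum_congr rfl e, h, mul_assoc, mul_comm (plusProd q k (N + 1)), plusProd_mul_pred]
    ring
  simp only [mul_div_assoc', ← Finset.sum_div, mul_add, mul_sub, Finset.sum_add_distrib,
    Finset.sum_sub_distrib]
  rw [s1, s2]
  constructor <;> · field_simp; ring

/-- This sums over the cut at an unpaired `U` that leads from an even level to an odd one, where no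
old tile may stay open. The last factor of the summand comes from `stackSum_odd`. -/
theorem sum_risingProd_mul_plusProd_mul (q : ℝ) (k N : ℕ) :
    ∑ j ∈ Finset.range (k + 1), q ^ j * (risingProd q j N * plusProd q j N *
      (1 - q ^ (2 * (N + 1) + j))) =
      risingProd q k (N + 1) * plusProd q k N * (1 + q ^ (k + 1 + N)) := by
  induction k with
  | zero => simp [risingProd_succ, plusProd_zero]; ring
  | succ k ih =>
    rw [Finset.sum_range_succ, ih, risingProd_succ', risingProd_succ, plusProd_succ]
    ring

end

/-! ### Levels at an odd distance from the final height -/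

/-- The constant factor of the generating function at the words `z U w` with `w` at an even
distance from the final height. -/
noncomputable def oddConst (q C : ℝ) (M : ℕ) : Forest → ℝ
  | .nil => C / (1 - q ^ (M + 1))
  | .node z z' => oddConst q C M z' * (z.chordProd q * plusProd q z.size (M + z'.size + 1) *
      (1 - q ^ (2 * (M + z'.size + 1) + (z.size + 1))) /
        ((1 - q ^ (z.size + 1)) * (1 - q ^ (M + z'.size + z.size + 1 + 1))))

section

variable {q : ℝ} {hl : ℕ → ℤ} {O : Finset ℕ}

theorem ite_pow_mul {P : Prop} [Decidable P] (p r d : ℕ) :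
    (if P then q ^ (p * r) else 0) * q ^ (r * d) = if P then (q ^ (d + p)) ^ r else 0 := by
  split_ifs
  · rw [← pow_add, ← pow_mul]; congr 1; ring
  · simp

theorem stackSum_replicate {O₁ O₂ : Finset ℕ} {w : List Step} {x a b r : ℕ} {K : ℝ}
    (H : ∀ m, transfer q hl O₁ w x (List.replicate m b ++ List.replicate r a) =
      K * transfer q hl O₂ w x (List.replicate m b)) (j : ℕ) :
    stackSum q hl O₁ w x b (List.replicate r a) j = K * stackSum q hl O₂ w x b [] j := by
  rw [stackSum, moment_congr H, moment_mul_left, stackSum]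
  simp

/-- The path never comes back after this `U`, so the `r` old tiles stay open to the end. Each pays
`downs w` on the way and `p` in the last column, `M` in total, and `r` has a prescribed parity. -/
theorem stackSum_odd_nil (h0 : 0 < q) (h1 : q < 1) {w : List Step} {x₁ e p M : ℕ} {C : ℝ}
    (he : x₁ + w.length = e) (hp : hl e = hl x₁ + 2 * p) (hM : M = downs w + p)
    (hlow : ∀ y, x₁ ≤ y → y < e → hl x₁ ≤ hl y)
    (hw : ∀ k, stackSum q hl ∅ w x₁ x₁ [] k = C * risingProd q k M * plusProd q k M)
    {x a k : ℕ} (hx : x + 1 = x₁) (hhx : hl x₁ = hl x + 1) (hax : a ≤ x) (ha : hl a = hl x) :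
    stackSum q hl ∅ (.U :: w) x a [] k = oddConst q C M .nil * (risingProd q k M *
      plusProd q k M * (1 - q ^ (2 * (M + 1) + k))) / (1 + q ^ (M + 1)) ∧
    stackSum q hl {a} (.U :: w) x a [] k = oddConst q C M .nil * (risingProd q k M *
      plusProd q k M * q ^ (M + 1) * (1 - q ^ k)) / (1 + q ^ (M + 1)) := by
  obtain ⟨s1, s2⟩ := sum_risingProd_eval_add h0 h1 k M
  have hea : hl e - hl a = 2 * p + 1 := by omega
  -- Both parities are treated at once: `P` is the parity that `O` prescribes for the tiles starting
  -- at `a`.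
  have step : ∀ (O : Finset ℕ) (P : ℕ → Prop) [DecidablePred P],
      (∀ b, b ≠ a → (b ∈ O ↔ b ∈ (∅ : Finset ℕ))) → (∀ r, (Even r ↔ a ∉ O) ↔ P r) →
      stackSum q hl O (.U :: w) x a [] k = C * ∑ j ∈ Finset.range (k + 1), q ^ j *
        risingProd q j M * plusProd q j M *
        moment (fun r => if P r then (q ^ M) ^ r else 0) (linProd q j k) := by
    intro O P _ hO hP
    rw [stackSum_up ha (by simp), hx, Finset.mul_sum]
    refine Finset.sum_congr rfl fun j _ => ?_
    rw [moment_congr (h := fun r => (C * risingProd q j M * plusProd q j M) *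
      if P r then (q ^ M) ^ r else 0), moment_mul_left]
    · ring
    intro r
    rw [List.append_nil, stackSum_replicate (O₂ := ∅)
      (K := (if P r then q ^ (p * r) else 0) * q ^ (r * downs w)), ite_pow_mul, ← hM, hw, mul_comm]
    intro m
    refine transfer_append_replicate (fun t ht => finalWeight_append_replicate p hea ht hO
      (by simp) (hP r)) w x₁ _ he (by omega) ?_ fun y hy hy' => ?_
    · simp only [List.mem_replicate]; omega
    · have := hlow y hy hy'; omega
  rw [step ∅ Even (by simp) (by simp), step {a} Odd (by simp) (by simp)]
  simp only [moment_even, moment_odd]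
  rw [s1, s2, oddConst]
  constructor <;> · field_simp

theorem downs_append (w w' : List Step) : downs (w ++ w') = downs w + downs w' := by simp [downs]

theorem downs_forest : ∀ z : Forest, downs z.word = z.size
  | .nil => rfl
  | .node z z' => by
    have h1 := downs_forest z
    have h2 := downs_forest z'
    simp only [downs] at h1 h2
    simp [Forest.word, Forest.size, downs, h1, h2]; ring

/-- The rational identities behind the induction step of `stackSum_odd`, with `A = q ^ (N + 1)`, `B
= q ^ n` and `K = q ^ k`. -/
theorem oddConst_algebra {A B : ℝ} (hA0 : 1 + A ≠ 0) (hB0 : 1 - B ≠ 0) (hAB0 : 1 + A * B ≠ 0)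
    (hAB1 : 1 - A * B ≠ 0) (c C R R' P E K : ℝ) :
    c * (R / (1 - B) * (C * (R' * ((1 + A) * (P * E)) * (1 - A ^ 2 * B * K)) / (1 + A)) -
        C * A * P * (R * R' * E * (A * B) * (1 - K) / ((1 - A * B) * (1 + A * B)))) =
      C * (c * P * (1 - A ^ 2 * B) / ((1 - B) * (1 - A * B))) *
        (R * R' * E * (1 - A ^ 2 * B ^ 2 * K)) / (1 + A * B) ∧
    c * (R / (1 - B) * (C * (R' * ((1 + A) * (P * E)) * A * (1 - K * B)) / (1 + A)) -
        C * A * P * (R * R' * E * (1 - A ^ 2 * B ^ 2 * K) / ((1 - A * B) * (1 + A * B)))) =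
      C * (c * P * (1 - A ^ 2 * B) / ((1 - B) * (1 - A * B))) *
        (R * R' * E * (A * B) * (1 - K)) / (1 + A * B) := by
  have f1 : (1 - A ^ 2 * B * K) / (1 - B) - A * (A * B) * (1 - K) / ((1 - A * B) * (1 + A * B)) =
      (1 - A ^ 2 * B) * (1 - A ^ 2 * B ^ 2 * K) / ((1 - B) * ((1 - A * B) * (1 + A * B))) := by
    rw [div_sub_div _ _ hB0 (mul_ne_zero hAB1 hAB0)]
    congr 1; ring
  have f2 : A * (1 - K * B) / (1 - B) -
      A * (1 - A ^ 2 * B ^ 2 * K) / ((1 - A * B) * (1 + A * B)) =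
      (1 - A ^ 2 * B) * (A * B * (1 - K)) / ((1 - B) * ((1 - A * B) * (1 + A * B))) := by
    rw [div_sub_div _ _ hB0 (mul_ne_zero hAB1 hAB0)]
    congr 1; ring
  have f3 : (1 + A) / (1 + A) = 1 := div_self hA0
  -- With opaque denominators what is left is linear in `f1`, `f2` and `f3`.
  generalize 1 - A * B = V at f1 f2 ⊢
  generalize 1 + A * B = W at f1 f2 ⊢
  generalize 1 - B = Z at f1 f2 ⊢
  constructor
  · linear_combination (C * c * P * R * R' * E) * f1 +
      (C * c * P * R * R' * E) * (1 - A ^ 2 * B * K) / Z * f3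
  · linear_combination (C * c * P * R * R' * E) * f2 +
      (C * c * P * R * R' * E) * (A * (1 - K * B)) / Z * f3

/-- Tiles of one height from different columns are not interchangeable here. After a pair `U w₀ D`,
at column `x'`, the wanted parities at `a` and `x'` are the merged parity minus the opposite
parities. In the subtracted term an odd number of tiles starts at `x'`, which blocks the tiles from
`a` beneath them, so these split off as a factor. The recursion thus involves both parities, which
are proved together. -/
theorem stackSum_odd (h0 : 0 < q) (h1 : q < 1) {w : List Step} {x₁ e p M : ℕ} {C : ℝ}
    (he : x₁ + w.length = e) (hp : hl e = hl x₁ + 2 * p) (hM : M = downs w + p)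
    (hlow : ∀ y, x₁ ≤ y → y < e → hl x₁ ≤ hl y)
    (hw : ∀ k, stackSum q hl ∅ w x₁ x₁ [] k = C * risingProd q k M * plusProd q k M)
    (z : Forest) : ∀ {x a k : ℕ}, Fits hl x (z.word ++ .U :: w) → x + 2 * z.size + 1 = x₁ →
    a ≤ x → hl a = hl x →
    stackSum q hl ∅ (z.word ++ .U :: w) x a [] k = oddConst q C M z *
      (risingProd q k (M + z.size) * plusProd q k (M + z.size) *
        (1 - q ^ (2 * (M + z.size + 1) + k))) / (1 + q ^ (M + z.size + 1)) ∧
    stackSum q hl {a} (z.word ++ .U :: w) x a [] k = oddConst q C M z *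
      (risingProd q k (M + z.size) * plusProd q k (M + z.size) * q ^ (M + z.size + 1) *
        (1 - q ^ k)) / (1 + q ^ (M + z.size + 1)) := by
  induction z with
  | nil =>
    intro x a k hf hx hax ha
    refine stackSum_odd_nil h0 h1 he hp hM hlow hw hx ?_ hax ha
    rw [← hx]; exact hf.1
  | node w₀ z' _ ih =>
    intro x a k hf hx hax ha
    have hword : (Forest.node w₀ z').word ++ Step.U :: w =
        .U :: (w₀.word ++ .D :: (z'.word ++ .U :: w)) := by simp [Forest.word]
    have hf0 := hf
    rw [hword] at hf ⊢
    obtain ⟨h2, h3, h4⟩ := hf.2.forest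
    set n := w₀.size + 1 with hn
    set x' := x + 2 * n with hx'
    rw [show x + 1 + 2 * w₀.size + 1 = x' by omega] at h3 h4
    have hhx' : hl x' = hl x := by have := hf.1; omega
    have hsz : (Forest.node w₀ z').size = n + z'.size := by simp [Forest.size, hn]
    rw [hsz] at hx ⊢
    have hx₁ : x' + 2 * z'.size + 1 = x₁ := by omega
    have hhx₁ : hl x₁ = hl x' + 1 := by
      rw [← hx₁]; have := h4.forest; have := this.2.1; omega
    set tail := z'.word ++ Step.U :: w with htail
    have hte : x' + tail.length = e := by
      rw [← he, ← hx₁]; simp [htail, Forest.length_word]; ring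
    have hdt : downs tail + p = M + z'.size := by
      rw [htail, downs_append, downs_forest, hM]; simp [downs]; ring
    have hea : hl e - hl a = 2 * p + 1 := by omega
    have hex : hl e - hl x' = 2 * p + 1 := by omega
    have step : ∀ (O₁ O₂ O₃ : Finset ℕ) (P : ℕ → Prop) [DecidablePred P],
        (∀ m, transfer q hl O₁ tail x' m + transfer q hl O₂ tail x' m =
          transfer q hl O₃ tail x' (m.map fun y => if y = a then x' else y)) →
        (∀ b, b ≠ a → (b ∈ O₂ ↔ b ∈ ({x'} : Finset ℕ))) → (∀ r, (Even r ↔ a ∉ O₂) ↔ P r) →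
        stackSum q hl O₁ (.U :: (w₀.word ++ .D :: tail)) x a [] k =
          ∑ j ∈ Finset.range (k + 1), q ^ j * (w₀.chordProd q * risingProd q j w₀.size) *
            (stackSum q hl O₃ tail x' x' [] (k + n) -
              moment (fun r => if P r then (q ^ (M + z'.size + n)) ^ r else 0) (linProd q j k) *
                stackSum q hl {x'} tail x' x' [] (j + n)) := by
      intro O₁ O₂ O₃ P _ hmerge hO hP
      rw [stackSum_node (fun x a s k hf ha hs he =>
        stackSum_forest h0 h1 w₀ (.D :: tail) e x a s k (mergeable_down _ _ _) hf ha hs he)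
        hf ha (by simp) (by rw [← hte, hx']; simp [Forest.length_word, hn]; ring)]
      simp only [List.length_nil, mul_zero, pow_zero, one_mul, List.append_nil, ← hn, ← hx']
      refine Finset.sum_congr rfl fun j hj => ?_
      congr 1
      have hjk : j ≤ k := by simp at hj; omega
      set S := stackSum q hl {x'} tail x' x' [] (j + n) with hS
      -- The merged contribution minus the blocked one. A blocked tile pays `n` under the pair,
      -- `downs tail` afterwards and `p` at the end, which is `M + z'.size + n` in all.
      have hr : ∀ r, q ^ (n * r) * stackSum q hl O₁ tail x' x' (List.replicate r a) (j + n) =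
          q ^ (n * r) * moment (fun m => transfer q hl O₃ tail x' (List.replicate (m + r) x' ++ []))
            (linProd q 0 (j + n)) +
          -S * if P r then (q ^ (M + z'.size + n)) ^ r else 0 := by
        intro r
        have hT : ∀ m, transfer q hl O₁ tail x' (List.replicate m x' ++ List.replicate r a) =
            transfer q hl O₃ tail x' (List.replicate (m + r) x' ++ []) +
            -((if P r then q ^ (p * r) else 0) * q ^ (r * downs tail)) *
              transfer q hl {x'} tail x' (List.replicate m x' ++ []) := by
          intro m
          have h5 := hmerge (List.replicate m x' ++ List.replicate r a)
          rw [transfer_append_replicate_of_mem (O₂ := {x'}) (b := x') (e := e)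
            ((hO x' (by omega)).2 (by simp)) (by simp) ⟨p, hex⟩ (by omega)
            (fun t ht => finalWeight_append_replicate p hea ht hO (by simp; omega) (hP r)) tail x' _
            hte (by omega) le_rfl (by simp only [List.mem_replicate]; omega)] at h5
          rw [List.append_nil, List.append_nil, eq_comm, ← sub_eq_iff_eq_add, eq_comm] at *
          rw [List.map_append, List.map_replicate, List.map_replicate, if_pos rfl,
            if_neg (by omega), List.replicate_append_replicate] at h5
          linarith
        rw [stackSum, moment_congr hT, moment_add_left, moment_mul_left, ← stackSum, ← hS,
          ite_pow_mul, hdt]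
        split_ifs <;> ring
      rw [moment_congr hr, moment_add_left, moment_mul_left, moment_pow_mul_linProd q _ n hjk,
        moment_moment_add (fun m => transfer q hl O₃ tail x' (List.replicate m x' ++ [])), mul_comm,
        linProd_mul q (Nat.zero_le _) (by omega), ← stackSum]
      ring
    have hfin := fun O₁ O₂ O₃ => finalWeight_merge (q := q) (O₁ := O₁) (O₂ := O₂) (O₃ := O₃)
      (show a ≠ x' by omega) (by omega) ⟨p, hex⟩
    have hρ : ∀ y, hl (if y = a then x' else y) = hl y := fun y => by
      split_ifs with hy
      · rw [hy]; omega
      · rfl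
    -- Even total: even at both columns, or odd at both.
    have stepP := step ∅ {a, x'} ∅ Odd
      (fun t => transfer_add_transfer hρ (hfin _ _ _ (by simp) (by simp +contextual) (by simp)
        (by simp) (by simp)) _ _ _ hte (fun y hy => if_neg (by omega)))
      (by simp +contextual) (by simp)
    -- Odd total: odd at `a` and even at `x'`, or the other way round.
    have stepQ := step {a} {x'} {x'} Even
      (fun t => transfer_add_transfer hρ (hfin _ _ _ (by simp +contextual) (by simp +contextual) (by simp)
        (by constructor <;> simp <;> omega) (by simp; omega)) _ _ _ hte
          (fun y hy => if_neg (by omega)))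
      (by simp +contextual) (by intro r; simp [show a ≠ x' by omega])
    set N := M + z'.size with hN
    have ihP := (ih (k := k + n) h4 hx₁ le_rfl rfl).1
    have ihQ := fun j => (ih (k := j + n) h4 hx₁ le_rfl rfl).2
    set A := q ^ (N + 1) with hA
    set B := q ^ n with hB
    set K := q ^ k with hK
    have hA0 : 1 + A ≠ 0 := by positivity
    have hAB0 : 1 + A * B ≠ 0 := by positivity
    have hB0 : 1 - B ≠ 0 := one_sub_pow_ne_zero h0 h1 w₀.size
    have hAB1 : 1 - A * B ≠ 0 := by
      rw [hA, hB, ← pow_add, show N + 1 + n = N + n + 1 by ring]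
      exact one_sub_pow_ne_zero h0 h1 _
    have hplus : ∀ j, plusProd q (j + n) N =
        (1 + A) * (plusProd q w₀.size (N + 1) * plusProd q j (N + n)) := by
      intro j
      rw [hn, show j + (w₀.size + 1) = w₀.size + j + 1 by ring, plusProd_succ', plusProd_add,
        show w₀.size + (N + 1) = N + (w₀.size + 1) by ring]
    have hris : ∀ j, risingProd q j w₀.size * (1 - q ^ (j + n)) * risingProd q (j + n) N =
        risingProd q j (N + n) := by
      intro j
      rw [add_comm N n, risingProd_add q j n N, hn, risingProd_succ, ← add_assoc]
    -- The factor `1 - q ^ (j + n)` of the odd solution closes the gap between two rising products,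
    -- and the factor `1 + A` cancels. The sum over `j` then has the shape of
    -- `sum_risingProd_eval_add` with `N + n` in place of `N`.
    have hQ : ∀ j, risingProd q j w₀.size * stackSum q hl {x'} tail x' x' [] (j + n) =
        oddConst q C M z' * A * plusProd q w₀.size (N + 1) *
          (risingProd q j (N + n) * plusProd q j (N + n)) := by
      intro j
      rw [ihQ, hplus, ← hris]
      field_simp
    have hW : ∑ j ∈ Finset.range (k + 1), q ^ j * risingProd q j w₀.size =
        risingProd q k n / (1 - B) := by
      rw [eq_div_iff hB0, hB, hn]; exact sum_pow_mul_risingProd q k w₀.size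
    have hsum : ∀ (T : ℝ) (μ : ℕ → ℝ), ∑ j ∈ Finset.range (k + 1),
        q ^ j * (w₀.chordProd q * risingProd q j w₀.size) *
          (T - μ j * stackSum q hl {x'} tail x' x' [] (j + n)) =
        w₀.chordProd q * (risingProd q k n / (1 - B) * T -
          oddConst q C M z' * A * plusProd q w₀.size (N + 1) * ∑ j ∈ Finset.range (k + 1),
            q ^ j * risingProd q j (N + n) * plusProd q j (N + n) * μ j) := by
      intro T μ
      rw [← hW, Finset.sum_mul, Finset.mul_sum, ← Finset.sum_sub_distrib, Finset.mul_sum]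
      refine Finset.sum_congr rfl fun j _ => ?_
      linear_combination (-q ^ j * w₀.chordProd q * μ j) * hQ j
    obtain ⟨s1, s2⟩ := sum_risingProd_eval_add h0 h1 k (N + n)
    have e1 : q ^ (2 * (N + n + 1) + k) = A ^ 2 * B ^ 2 * K := by rw [hA, hB, hK]; ring
    have e2 : q ^ (N + n + 1) = A * B := by rw [hA, hB]; ring
    have e3 : q ^ (2 * (N + 1) + (k + n)) = A ^ 2 * B * K := by rw [hA, hB, hK]; ring
    have e4 : q ^ (k + n) = K * B := by rw [hB, hK]; ring
    have e5 : q ^ (2 * (N + 1) + n) = A ^ 2 * B := by rw [hA, hB]; ring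
    have hrk : risingProd q k (N + n) = risingProd q k n * risingProd q (k + n) N := by
      rw [add_comm N n, risingProd_add]
    rw [e1, e2] at s1
    rw [e2, ← hK] at s2
    rw [stepP, stepQ]
    simp only [moment_even, moment_odd]
    rw [hsum, hsum, s1, s2, ihP, ihQ, hplus, hrk, e3, e4, oddConst, ← hN, ← hn, e5,
      show N + w₀.size + 1 + 1 = N + n + 1 by omega, show M + (n + z'.size) = N + n by omega, hrk,
      e1, e2, ← hB]
    exact oddConst_algebra hA0 hB0 hAB0 hAB1 _ _ _ _ _ _ K

end

/-! ### Levels at an even distance from the final height -/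

/-- The word `z₂ U z₁ U z₂' U z₁' U ⋯ z₀` of a list of pairs `(z₂, z₁)` of Dyck words and a last
Dyck word `z₀`. -/
def evenWord (z₀ : Forest) : List (Forest × Forest) → List Step
  | [] => z₀.word
  | z :: l => z.1.word ++ .U :: (z.2.word ++ .U :: evenWord z₀ l)

/-- The number of edges of the tree of `evenWord z₀ l`. -/
def evenSize (z₀ : Forest) : List (Forest × Forest) → ℕ
  | [] => z₀.size
  | z :: l => z.1.size + (evenSize z₀ l + z.2.size + 1)

/-- The constant factor of the generating function at `evenWord z₀ l`. -/
noncomputable def evenConst (q : ℝ) (z₀ : Forest) : List (Forest × Forest) → ℝ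
  | [] => z₀.chordProd q * plusProd q z₀.size 0
  | z :: l => z.1.chordProd q * oddConst q (evenConst q z₀ l) (evenSize z₀ l) z.2 *
      plusProd q z.1.size (evenSize z₀ l + z.2.size + 1)

theorem Fits.le_forest {hl : ℕ → ℤ} : ∀ {z : Forest} {w : List Step} {x : ℕ},
    Fits hl x (z.word ++ w) → ∀ y, x ≤ y → y ≤ x + 2 * z.size → hl x ≤ hl y
  | .nil, _, x, _, y, h1, h2 => by
    obtain rfl : y = x := by simp [Forest.size] at h2; omega
    exact le_rfl
  | .node z z', w, x, hf, y, h1, h2 => by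
    simp only [Forest.word, List.cons_append, List.append_assoc, Fits] at hf
    obtain ⟨h3, h4, h5⟩ := hf.2.forest
    have h6 := hf.1
    simp only [Forest.size] at h2
    rcases Nat.lt_or_ge y (x + 1) with h | h
    · obtain rfl : y = x := by omega
      exact le_rfl
    rcases Nat.lt_or_ge y (x + 1 + 2 * z.size + 1) with h' | h'
    · have := Fits.le_forest hf.2 y h (by omega)
      omega
    · have := Fits.le_forest h5 y h' (by omega)
      omega

theorem Fits.evenWord {hl : ℕ → ℤ} {z₀ : Forest} : ∀ {l : List (Forest × Forest)} {x : ℕ},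
    Fits hl x (evenWord z₀ l) → hl (x + (BallotBI.evenWord z₀ l).length) = hl x + 2 * l.length ∧
      ∀ y, x ≤ y → y ≤ x + (BallotBI.evenWord z₀ l).length → hl x ≤ hl y
  | [], x, h => by
    have h' : Fits hl x (z₀.word ++ []) := by simpa [BallotBI.evenWord] using h
    rw [BallotBI.evenWord, Forest.length_word]
    exact ⟨by simpa using h'.forest.1, h'.le_forest⟩
  | z :: l, x, h => by
    obtain ⟨h1, h2, h3⟩ := h.forest
    obtain ⟨h4, h5, h6⟩ := h3.forest
    obtain ⟨h7, h8⟩ := Fits.evenWord h6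
    have hlen : x + (BallotBI.evenWord z₀ (z :: l)).length =
        x + 2 * z.1.size + 1 + 2 * z.2.size + 1 + (BallotBI.evenWord z₀ l).length := by
      simp [BallotBI.evenWord, Forest.length_word]; ring
    rw [hlen]
    refine ⟨by rw [h7]; push_cast [List.length_cons]; omega, fun y hy hy' => ?_⟩
    rcases Nat.lt_or_ge y (x + 2 * z.1.size + 1) with h9 | h9
    · exact h.le_forest y hy (by omega)
    rcases Nat.lt_or_ge y (x + 2 * z.1.size + 1 + 2 * z.2.size + 1) with h10 | h10
    · have := h3.le_forest y h9 (by omega)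
      omega
    · have := h8 y h10 hy'
      omega

/-- Two unpaired `U`'s share one edge and raise the path by two. Hence the exponent paid by a tile
open along the whole word, its `D`'s plus half the rise, is the number of edges; this identifies `M`
in `stackSum_odd` with a tree size. -/
theorem downs_evenWord (z₀ : Forest) : ∀ l : List (Forest × Forest),
    evenSize z₀ l = downs (evenWord z₀ l) + l.length
  | [] => by simp [evenSize, evenWord, downs_forest]
  | z :: l => by
    have h := downs_evenWord z₀ l
    have e : ∀ w, downs (.U :: w) = downs w := fun w => by simp [downs]
    simp only [evenSize, evenWord, downs_append, e, downs_forest, List.length_cons]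
    omega

section

variable {q : ℝ} {hl : ℕ → ℤ}

theorem finalWeight_replicate {e a m : ℕ} (h : hl a = hl e) :
    finalWeight q hl ∅ e (List.replicate m a) = 1 := by
  rw [finalWeight, if_pos]
  · simp [h]
  · refine ⟨fun b hb => ?_, fun b hb => ?_⟩
    · rw [List.eq_of_mem_replicate hb, h]; simp
    · have : b ≠ a := by rintro rfl; simp [h] at hb
      simp [List.count_replicate, this.symm]

theorem stackSum_nil {e a k : ℕ} (h : hl a = hl e) :
    stackSum q hl ∅ [] e a [] k = plusProd q k 0 := by
  rw [stackSum, moment_congr (h := fun m => 1 ^ m), moment_pow, eval_linProd, plusProd,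
    Finset.range_eq_Ico]
  · simp
  · intro m
    rw [transfer, List.append_nil, finalWeight_replicate h, one_pow]

/-- Each entry of the list is an even level, where merging is allowed, followed by an odd level,
which `stackSum_odd` settles. -/
theorem stackSum_evenWord (h0 : 0 < q) (h1 : q < 1) (z₀ : Forest) :
    ∀ (l : List (Forest × Forest)) (x a k : ℕ), Fits hl x (evenWord z₀ l) → a ≤ x →
      hl a = hl x → stackSum q hl ∅ (evenWord z₀ l) x a [] k =
        evenConst q z₀ l * risingProd q k (evenSize z₀ l) * plusProd q k (evenSize z₀ l)
  | [], x, a, k, hf, _, ha => by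
    have hf' : Fits hl x (z₀.word ++ []) := by simpa [evenWord] using hf
    have h := hf'.forest.1
    rw [evenWord, ← List.append_nil z₀.word,
      stackSum_forest h0 h1 z₀ [] _ x a [] k (mergeable_of_even (by
        simp [Forest.length_word, h]) _) hf' ha (by simp) rfl,
      stackSum_nil (by omega), add_comm k, plusProd_add]
    simp [evenConst, evenSize]; ring
  | z :: l, x, a, k, hf, hax, ha => by
    have hend := hf.evenWord.1
    rw [evenWord] at hf ⊢
    obtain ⟨h2, h3, h4⟩ := hf.forest
    obtain ⟨h5, h6, h7⟩ := h4.forest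
    obtain ⟨h8, h9⟩ := h7.evenWord
    set N := evenSize z₀ l + z.2.size with hN
    set y := x + 2 * z.1.size with hy
    set x₁ := y + 1 + 2 * z.2.size + 1 with hx₁
    set e := x + (evenWord z₀ (z :: l)).length with he
    have he₁ : x₁ + (evenWord z₀ l).length = e := by
      simp [he, hx₁, hy, evenWord, Forest.length_word]; ring
    have hA' : 1 + q ^ (N + 1) ≠ 0 := by positivity
    have hodd : ∀ j, stackSum q hl ∅ (z.2.word ++ .U :: evenWord z₀ l) (y + 1) (y + 1) [] j =
        oddConst q (evenConst q z₀ l) (evenSize z₀ l) z.2 *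
          (risingProd q j N * plusProd q j N * (1 - q ^ (2 * (N + 1) + j))) /
            (1 + q ^ (N + 1)) := fun j =>
      (stackSum_odd h0 h1 he₁ (p := l.length) (by rw [← he₁, h8]) (downs_evenWord z₀ l)
        (fun i hi hi' => h9 i hi (by omega))
        (fun k => stackSum_evenWord h0 h1 z₀ l x₁ x₁ k h7 le_rfl rfl) z.2 h4 rfl le_rfl rfl).1
    have hup : ∀ k, stackSum q hl ∅ (.U :: (z.2.word ++ .U :: evenWord z₀ l)) y a [] k =
        oddConst q (evenConst q z₀ l) (evenSize z₀ l) z.2 * risingProd q k (N + 1) *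
          plusProd q k (N + 1) := by
      intro k
      have hj : ∀ j ∈ Finset.range (k + 1), q ^ j * moment (fun r => stackSum q hl ∅
          (z.2.word ++ .U :: evenWord z₀ l) (y + 1) (y + 1) (List.replicate r a ++ []) j)
          (linProd q j k) = q ^ j * (risingProd q j N * plusProd q j N *
            (1 - q ^ (2 * (N + 1) + j))) *
          (oddConst q (evenConst q z₀ l) (evenSize z₀ l) z.2 / (1 + q ^ (N + 1))) := by
        intro j _
        -- Old tiles left open at this `U` could never end and would have positive even height, so
        -- only `r = 0` survives.
        have hr : ∀ r, stackSum q hl ∅ (z.2.word ++ .U :: evenWord z₀ l) (y + 1) (y + 1)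
            (List.replicate r a ++ []) j = stackSum q hl ∅ (z.2.word ++ .U :: evenWord z₀ l)
              (y + 1) (y + 1) [] j * if r = 0 then 1 else 0 := by
          intro r
          rw [List.append_nil, stackSum_replicate (O₂ := ∅) (K := (if r = 0 then 1 else 0) *
            q ^ (r * downs (z.2.word ++ .U :: evenWord z₀ l)))]
          · split_ifs with h
            · simp [h]
            · simp
          intro m
          refine transfer_append_replicate (e := e) (fun t _ =>
            finalWeight_append_replicate_of_even ⟨l.length + 1, ?_⟩ ?_) _ _ _ ?_ ?_ ?_ ?_
          · rw [hend, List.length_cons]; push_cast; omega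
          · rw [hend, List.length_cons]; push_cast; omega
          · rw [← he₁, hx₁]; simp [Forest.length_word]; ring
          · omega
          · simp only [List.mem_replicate]; omega
          · intro i hi hi'
            rcases Nat.lt_or_ge i x₁ with h | h
            · have := h4.le_forest i hi (by omega)
              omega
            · have := h9 i h (by omega)
              omega
        rw [moment_congr hr, moment_mul_left, moment_zero_pow, eval_linProd, hodd]
        simp; ring
      rw [stackSum_up (by omega) (by simp), Finset.sum_congr rfl hj, ← Finset.sum_mul,
        sum_risingProd_mul_plusProd_mul, mul_assoc (risingProd _ _ _), ← plusProd_mul_pred]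
      field_simp
    rw [stackSum_forest h0 h1 z.1 _ e x a [] k (mergeable_of_even ⟨l.length + 1, by
        rw [hend, List.length_cons]; push_cast; ring⟩ _) hf ha (by simp)
        (by rw [he, evenWord]), ← hy, hup, evenConst, evenSize, ← hN, add_comm k, plusProd_add,
        add_comm z.1.size k, risingProd_add q k z.1.size, add_comm z.1.size (N + 1)]
    simp
    ring

end

/-! ### Circles -/

namespace Edge

theorem postRight_le_size : ∀ {T : PlaneTree} (e : Edge T), e.postRight ≤ T.size
  | .graft _ _ _ b r, .head => by simp [postRight, PlaneTree.size]; omega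
  | .graft _ _ _ b r, .under e => by
    have := postRight_le_size e
    simp [postRight, PlaneTree.size]; omega
  | .graft _ _ _ b r, .beside e => by
    have := postRight_le_size e
    simp [postRight, PlaneTree.size]; omega

theorem IsNext.postRight_lt : ∀ {T : PlaneTree} {e e' : Edge T}, e.IsNext e' →
    e'.postRight < e.postRight
  | .graft _ _ _ b r, .head, .beside e', _ => by
    have := postRight_le_size e'
    simp [postRight]; omega
  | .graft _ _ _ b r, .under e, .under e', h => by
    have := IsNext.postRight_lt (e := e) (e' := e') h
    simpa [postRight]
  | .graft _ _ _ b r, .beside e, .beside e', h => by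
    have := IsNext.postRight_lt (e := e) (e' := e') h
    simpa [postRight]
  | .graft _ _ _ b r, .head, .head, h => h.elim
  | .graft _ _ _ b r, .head, .under _, h => h.elim
  | .graft _ _ _ b r, .under _, .head, h => h.elim
  | .graft _ _ _ b r, .under _, .beside _, h => h.elim
  | .graft _ _ _ b r, .beside _, .head, h => h.elim
  | .graft _ _ _ b r, .beside _, .under _, h => h.elim

end Edge

/-- The sequence rule does not depend on where the sequence of edges begins. -/
theorem circledByArrows_iff {T : PlaneTree} {L : Edge T → ℕ} {f : Edge T} :
    CircledByArrows L f ↔ ∃ (l : List (Edge T)) (e : Edge T),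
      (f :: l ++ [e]).IsChain (fun x y => y.ArrowFrom x) ∧ ∀ x ∈ f :: l, L e ≤ L x := by
  constructor
  · rintro ⟨l, e, hc, hl, -, hf⟩
    obtain ⟨l₁, l₂, rfl⟩ := List.append_of_mem hf
    rw [List.append_assoc] at hc
    exact ⟨l₂, e, (List.isChain_append.1 hc).2.1, fun x hx => hl x (List.mem_append_right _ hx)⟩
  · rintro ⟨l, e, hc, hl⟩
    -- The sequence is prolonged to the left while labels stay at least `L e`; it stops since
    -- `postRight` grows along arrows and is bounded by the size. At the stop the condition on
    -- `e(0)` holds.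
    have key : ∀ (n : ℕ) (x : Edge T) (l : List (Edge T)), T.size - x.postRight ≤ n →
        (x :: l ++ [e]).IsChain (fun x y => y.ArrowFrom x) → (∀ y ∈ x :: l, L e ≤ L y) →
        f ∈ x :: l → CircledByArrows L f := by
      intro n
      induction n with
      | zero =>
        intro x l hn hc hl hf
        refine ⟨x :: l, e, hc, hl, ?_, hf⟩
        intro e1 he1 e0 h
        simp only [List.head?_cons, Option.mem_def, Option.some.injEq] at he1
        subst he1
        have := h.2.postRight_lt
        have := e0.postRight_le_size
        omega
      | succ n ih =>
        intro x l hn hc hl hf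
        by_cases h : ∃ e0, x.ArrowFrom e0 ∧ L e ≤ L e0
        · obtain ⟨e0, h1, h2⟩ := h
          refine ih e0 (x :: l) ?_ (List.isChain_cons_cons.2 ⟨h1, hc⟩) ?_ (List.mem_cons_of_mem _ hf)
          · have := h1.2.postRight_lt
            have := e0.postRight_le_size
            omega
          · intro y hy
            rcases List.mem_cons.1 hy with rfl | hy
            · exact h2
            · exact hl y hy
        · push Not at h
          refine ⟨x :: l, e, hc, hl, ?_, hf⟩
          intro e1 he1 e0 h'
          simp only [List.head?_cons, Option.mem_def, Option.some.injEq] at he1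
          subst he1
          exact h e0 h'
    exact key _ f l le_rfl hc hl (by simp)

section

variable {d a : Bool} {c : ℕ} {b r : PlaneTree} {L : Edge (.graft d a c b r) → ℕ}

theorem exists_map_under {l : List (Edge (.graft d a c b r))} {e : Edge b}
    (h : (.under e :: l).IsChain (fun x y => y.ArrowFrom x)) :
    ∃ l' : List (Edge b), l = l'.map .under := by
  induction l generalizing e with
  | nil => exact ⟨[], rfl⟩
  | cons x l ih =>
    obtain ⟨h1, h2⟩ := List.isChain_cons_cons.1 h
    cases x with
    | head => exact h1.2.elim
    | beside x => exact h1.2.elim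
    | under x =>
      obtain ⟨l', rfl⟩ := ih h2
      exact ⟨x :: l', rfl⟩

theorem exists_map_beside {l : List (Edge (.graft d a c b r))} {e : Edge r}
    (h : (.beside e :: l).IsChain (fun x y => y.ArrowFrom x)) :
    ∃ l' : List (Edge r), l = l'.map .beside := by
  induction l generalizing e with
  | nil => exact ⟨[], rfl⟩
  | cons x l ih =>
    obtain ⟨h1, h2⟩ := List.isChain_cons_cons.1 h
    cases x with
    | head => exact h1.2.elim
    | under x => exact h1.2.elim
    | beside x =>
      obtain ⟨l', rfl⟩ := ih h2
      exact ⟨x :: l', rfl⟩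

theorem circledByArrows_under (f : Edge b) :
    CircledByArrows L (.under f) ↔ CircledByArrows (fun e => L (.under e)) f := by
  rw [circledByArrows_iff, circledByArrows_iff]
  constructor
  · rintro ⟨l, e, hc, hl⟩
    obtain ⟨l', hl'⟩ := exists_map_under hc
    obtain ⟨l₁, l₂, rfl, rfl, h⟩ := List.map_eq_append_iff.1 hl'.symm
    obtain ⟨e', rfl, rfl⟩ := List.map_eq_singleton_iff.1 h
    refine ⟨l₁, e', ?_, fun x hx => ?_⟩
    · rw [← List.map_singleton, ← List.map_cons, ← List.map_append, List.isChain_map] at hc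
      exact hc
    · exact hl (.under x) (by simpa using hx)
  · rintro ⟨l, e, hc, hl⟩
    refine ⟨l.map .under, .under e, ?_, ?_⟩
    · rw [← List.map_singleton, ← List.map_cons, ← List.map_append, List.isChain_map]
      exact hc
    · rw [← List.map_cons]
      simp only [List.forall_mem_map]
      exact hl

theorem circledByArrows_beside (f : Edge r) :
    CircledByArrows L (.beside f) ↔ CircledByArrows (fun e => L (.beside e)) f := by
  rw [circledByArrows_iff, circledByArrows_iff]
  constructor
  · rintro ⟨l, e, hc, hl⟩
    obtain ⟨l', hl'⟩ := exists_map_beside hc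
    obtain ⟨l₁, l₂, rfl, rfl, h⟩ := List.map_eq_append_iff.1 hl'.symm
    obtain ⟨e', rfl, rfl⟩ := List.map_eq_singleton_iff.1 h
    refine ⟨l₁, e', ?_, fun x hx => ?_⟩
    · rw [← List.map_singleton, ← List.map_cons, ← List.map_append, List.isChain_map] at hc
      exact hc
    · exact hl (.beside x) (by simpa using hx)
  · rintro ⟨l, e, hc, hl⟩
    refine ⟨l.map .beside, .beside e, ?_, ?_⟩
    · rw [← List.map_singleton, ← List.map_cons, ← List.map_append, List.isChain_map]
      exact hc
    · rw [← List.map_cons]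
      simp only [List.forall_mem_map]
      exact hl

theorem circled_under (f : Edge b) :
    Circled L (.under f) ↔ Circled (fun e => L (.under e)) f :=
  and_congr Iff.rfl (or_congr Iff.rfl (circledByArrows_under f))

theorem circled_beside (f : Edge r) :
    Circled L (.beside f) ↔ Circled (fun e => L (.beside e)) f :=
  and_congr Iff.rfl (or_congr Iff.rfl (circledByArrows_beside f))

end

/-- All edges at the root but the last have an incoming arrow. -/
def ArrowRow : PlaneTree → Prop
  | .empty => False
  | .graft _ a _ _ r => a = false ∧ r = .empty ∨ a = true ∧ ArrowRow r

theorem Edge.IsNext.atRoot : ∀ {T : PlaneTree} {e e' : Edge T}, e.IsNext e' → e.AtRoot → e'.AtRoot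
  | .graft _ _ _ b r, .head, .beside e', h, _ => by
    cases e' with
    | head => trivial
    | under => exact h.elim
    | beside => exact h.elim
  | .graft _ _ _ b r, .beside e, .beside e', h, h' =>
    Edge.IsNext.atRoot (e := e) (e' := e') h h'
  | .graft _ _ _ b r, .under e, _, _, h' => h'.elim
  | .graft _ _ _ b r, .head, .head, h, _ => h.elim
  | .graft _ _ _ b r, .head, .under _, h, _ => h.elim
  | .graft _ _ _ b r, .beside _, .head, h, _ => h.elim
  | .graft _ _ _ b r, .beside _, .under _, h, _ => h.elim

theorem atRoot_of_isChain {T : PlaneTree} {l : List (Edge T)} {x e : Edge T}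
    (hc : (x :: l ++ [e]).IsChain (fun x y => y.ArrowFrom x)) (hx : x.AtRoot) : e.AtRoot := by
  induction l generalizing x with
  | nil =>
    simp only [List.cons_append, List.nil_append, List.isChain_pair] at hc
    exact hc.2.atRoot hx
  | cons y l ih =>
    obtain ⟨h1, h2⟩ := List.isChain_cons_cons.1 hc
    exact ih h2 (h1.2.atRoot hx)

/-- The leftmost root edge with label at most `v` ends the sequence: all edges before it carry
arrows and have labels above `v`. -/
theorem exists_chain_of_arrowRow : ∀ {T : PlaneTree} (_ : ArrowRow T) {L : Edge T → ℕ} {v : ℕ}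
    {e : Edge T}, e.AtRoot → L e ≤ v → ∃ (l : List (Edge T)) (e : Edge T),
      (l ++ [e]).IsChain (fun x y => y.ArrowFrom x) ∧ (∀ x ∈ (l ++ [e]).head?, x.IsFirst) ∧
      (∀ x ∈ l, v < L x) ∧ L e ≤ v
  | .graft d a c b r, h, L, v, e, he, hv => by
    by_cases h0 : L .head ≤ v
    · exact ⟨[], .head, List.isChain_singleton _, by simp [Edge.IsFirst], by simp, h0⟩
    cases e with
    | head => exact absurd hv h0
    | under e => exact he.elim
    | beside e =>
      rcases h with ⟨-, rfl⟩ | ⟨ha, h⟩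
      · exact nomatch e
      obtain ⟨l, e', hc, hf, hl, hle⟩ :=
        exists_chain_of_arrowRow h (L := fun e => L (.beside e)) (e := e) he hv
      refine ⟨.head :: l.map .beside, .beside e', ?_, by simp [Edge.IsFirst], ?_, hle⟩
      · rw [List.cons_append, ← List.map_singleton, ← List.map_append, List.isChain_cons,
          List.isChain_map]
        refine ⟨fun y hy => ?_, hc⟩
        rw [List.head?_map, Option.mem_def, Option.map_eq_some_iff] at hy
        obtain ⟨y, hy, rfl⟩ := hy
        exact ⟨ha, hf y hy⟩
      · intro x hx
        rcases List.mem_cons.1 hx with rfl | hx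
        · omega
        · obtain ⟨x', hx', rfl⟩ := List.mem_map.1 hx
          exact hl x' hx'

/-- In a row of arrows the sequence rule is global: the circle is missing only if all later edges of
the row have strictly larger labels. This form turns uncircled labellings into ones counted by
`labellingsFrom r (v + 1)`. -/
theorem circled_head_of_arrowRow {c : ℕ} {b r : PlaneTree} (h : ArrowRow r)
    {L : Edge (.graft false true c b r) → ℕ} :
    Circled L .head ↔ ¬ ∀ e : Edge r, e.AtRoot → L .head + 1 ≤ L (.beside e) := by
  have : Circled L .head ↔ CircledByArrows L .head := by simp [Circled, Edge.HasDot, Edge.HasArrow]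
  rw [this, circledByArrows_iff]
  push Not
  constructor
  · rintro ⟨l, e, hc, hl⟩
    have hr := atRoot_of_isChain hc trivial
    have hne : e ≠ .head := by
      rintro rfl
      rcases List.eq_nil_or_concat l with rfl | ⟨l, x, rfl⟩
      · simp only [List.cons_append, List.nil_append, List.isChain_pair] at hc
        exact hc.2.elim
      · rw [List.concat_eq_append, List.cons_append, List.append_assoc] at hc
        have h1 := (List.isChain_append.1 (List.isChain_cons.1 hc).2).2.1
        simp only [List.cons_append, List.nil_append, List.isChain_pair] at h1
        have := h1.2
        cases x <;> exact this.elim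
    cases e with
    | head => exact absurd rfl hne
    | under e => exact hr.elim
    | beside e => exact ⟨e, hr, Nat.lt_succ_of_le (hl .head (by simp))⟩
  · rintro ⟨e, he, hle⟩
    obtain ⟨l, e', hc, hf, hl, hle⟩ := exists_chain_of_arrowRow h (L := fun e => L (.beside e))
      (v := L .head) he (Nat.le_of_lt_succ hle)
    refine ⟨l.map .beside, .beside e', ?_, ?_⟩
    · rw [List.cons_append, ← List.map_singleton, ← List.map_append, List.isChain_cons,
        List.isChain_map]
      refine ⟨fun y hy => ?_, hc⟩
      rw [List.head?_map, Option.mem_def, Option.map_eq_some_iff] at hy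
      obtain ⟨y, hy, rfl⟩ := hy
      exact ⟨rfl, hf y hy⟩
    · intro x hx
      rcases List.mem_cons.1 hx with rfl | hx
      · exact hle
      · obtain ⟨x', hx', rfl⟩ := List.mem_map.1 hx
        exact hle.trans (hl x' hx').le

/-! ### Sums over labellings -/

theorem sum_edge_graft {M : Type*} [AddCommMonoid M] {d a : Bool} {c : ℕ} {b r : PlaneTree}
    (f : Edge (.graft d a c b r) → M) :
    ∑ e, f e = f .head + (∑ e, f (.under e) + ∑ e, f (.beside e)) := by
  rw [← (Edge.equiv d a c b r).sum_comp, Fintype.sum_option, Fintype.sum_sum_type]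
  rfl

theorem prod_edge_graft {M : Type*} [CommMonoid M] {d a : Bool} {c : ℕ} {b r : PlaneTree}
    (f : Edge (.graft d a c b r) → M) :
    ∏ e, f e = f .head * ((∏ e, f (.under e)) * ∏ e, f (.beside e)) := by
  rw [← (Edge.equiv d a c b r).prod_comp, Fintype.prod_option, Fintype.prod_sum_type]
  rfl

/-- The labelling of a grafted tree with given label of the new edge and given labellings of the
two parts. -/
def joinLabel {d a : Bool} {c : ℕ} {b r : PlaneTree} (v : ℕ) (L₁ : Edge b → ℕ) (L₂ : Edge r → ℕ) :
    Edge (.graft d a c b r) → ℕ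
  | .head => v
  | .under e => L₁ e
  | .beside e => L₂ e

theorem isLS_graft {d a : Bool} {c : ℕ} {b r : PlaneTree} {L : Edge (.graft d a c b r) → ℕ} :
    IsLS L ↔ IsLS (fun e => L (.under e)) ∧ IsLS (fun e => L (.beside e)) ∧
      (∀ e : Edge b, e.AtRoot → L .head ≤ L (.under e)) ∧ (b = .empty → L .head ≤ c) := by
  constructor
  · intro h
    exact ⟨⟨fun x y h' => h.mono (.under x) (.under y) h', fun x h' => h.le_cap (.under x) h'⟩,
      ⟨fun x y h' => h.mono (.beside x) (.beside y) h', fun x h' => h.le_cap (.beside x) h'⟩,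
      fun e he => h.mono .head (.under e) he, fun hb => h.le_cap .head hb⟩
  · rintro ⟨h1, h2, h3, h4⟩
    constructor
    · rintro (_ | x | x) (_ | y | y) h
      · exact h.elim
      · exact h3 y h
      · exact h.elim
      · exact h.elim
      · exact h1.mono x y h
      · exact h.elim
      · exact h.elim
      · exact h.elim
      · exact h2.mono x y h
    · rintro (_ | x | x) h
      · exact h4 h
      · exact h1.le_cap x h
      · exact h2.le_cap x h

theorem mem_labellings {T : PlaneTree} {L : Edge T → ℕ} : L ∈ labellings T ↔ IsLS L := by
  simp [labellings]

open Classical in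
/-- The labellings of which all labels at the root are at least `l`. -/
noncomputable def labellingsFrom (T : PlaneTree) (l : ℕ) : Finset (Edge T → ℕ) :=
  (labellings T).filter fun L => ∀ e, e.AtRoot → l ≤ L e

theorem mem_labellingsFrom {T : PlaneTree} {L : Edge T → ℕ} {l : ℕ} :
    L ∈ labellingsFrom T l ↔ IsLS L ∧ ∀ e, e.AtRoot → l ≤ L e := by
  simp [labellingsFrom, mem_labellings]

theorem labellingsFrom_zero (T : PlaneTree) : labellingsFrom T 0 = labellings T := by
  ext L; simp [mem_labellingsFrom, mem_labellings]

/-- All labellings have label at most `c` at the first edge. -/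
def FirstLe (c : ℕ) (T : PlaneTree) : Prop := ∀ L : Edge T → ℕ, IsLS L → ∀ e, e.IsFirst → L e ≤ c

/-- Labels do not decrease on the way to the leftmost leaf below, so the number stored on an inner
edge is a true bound although it is not a capacity. -/
theorem FirstLe.head_le {d a : Bool} {c : ℕ} {b r : PlaneTree} {L : Edge (.graft d a c b r) → ℕ}
    (hc : FirstLe c b) (h : IsLS L) : L .head ≤ c := by
  obtain ⟨h1, -, h3, h4⟩ := isLS_graft.1 h
  cases b with
  | empty => exact h4 rfl
  | graft => exact (h3 .head trivial).trans (hc _ h1 .head trivial)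

theorem FirstLe.graft {d a : Bool} {c c' : ℕ} {b r : PlaneTree} (hc : FirstLe c b) (h : c ≤ c') :
    FirstLe c' (.graft d a c b r) := by
  rintro L hL (_ | e | e) he
  · exact (hc.head_le hL).trans h
  · exact he.elim
  · exact he.elim

theorem firstLe_empty (c : ℕ) : FirstLe c .empty := fun _ _ e => nomatch e

theorem sum_labellingsFrom_graft {d a : Bool} {c : ℕ} {b r : PlaneTree} (hc : FirstLe c b) (l : ℕ)
    (F : (Edge (.graft d a c b r) → ℕ) → ℝ) :
    ∑ L ∈ labellingsFrom (.graft d a c b r) l, F L =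
      ∑ v ∈ Finset.Icc l c, ∑ L₁ ∈ labellingsFrom b v, ∑ L₂ ∈ labellingsFrom r l,
        F (joinLabel v L₁ L₂) := by
  simp only [← Finset.sum_product']
  rw [Finset.sum_sigma']
  refine Finset.sum_bij' (fun L _ => ⟨L .head, fun e => L (.under e), fun e => L (.beside e)⟩)
    (fun p _ => joinLabel p.1 p.2.1 p.2.2) ?_ ?_ ?_ ?_ ?_
  · intro L hL
    obtain ⟨h, hl⟩ := mem_labellingsFrom.1 hL
    obtain ⟨h1, h2, h3, h4⟩ := isLS_graft.1 h
    simp only [Finset.mem_sigma, Finset.mem_Icc, Finset.mem_product, mem_labellingsFrom]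
    exact ⟨⟨hl .head trivial, hc.head_le h⟩, ⟨h1, h3⟩, h2, fun e he => hl (.beside e) he⟩
  · rintro ⟨v, L₁, L₂⟩ h
    simp only [Finset.mem_sigma, Finset.mem_Icc, Finset.mem_product, mem_labellingsFrom] at h
    obtain ⟨⟨h1, h2⟩, ⟨h3, h4⟩, h5, h6⟩ := h
    refine mem_labellingsFrom.2 ⟨isLS_graft.2 ⟨h3, h5, h4, fun _ => h2⟩, ?_⟩
    rintro (_ | e | e) he
    · exact h1
    · exact he.elim
    · exact h6 e he
  · intro L _
    funext e
    cases e <;> rfl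
  · intro _ _; rfl
  · intro L _
    congr 1
    funext e
    cases e <;> rfl

open Classical in
/-- The contribution of one labelling if all positions in the post-order are shifted by `s`. -/
noncomputable def shiftedWeight (q : ℝ) (s : ℕ) {T : PlaneTree} (L : Edge T → ℕ) : ℝ :=
  q ^ (∑ e, L e) * ∏ e, if Circled L e then 1 + q ^ (e.postRight + s) else 1

theorem aeval_weight (q : ℝ) {T : PlaneTree} (L : Edge T → ℕ) :
    aeval q (weight L) = shiftedWeight q 0 L := by
  simp [weight, shiftedWeight, map_prod, Finset.prod_filter, apply_ite]

open Classical in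
theorem shiftedWeight_join (q : ℝ) (s : ℕ) {d a : Bool} {c : ℕ} {b r : PlaneTree} (v : ℕ)
    (L₁ : Edge b → ℕ) (L₂ : Edge r → ℕ) :
    shiftedWeight q s (joinLabel v L₁ L₂ : Edge (.graft d a c b r) → ℕ) =
      q ^ v * (if Circled (joinLabel v L₁ L₂ : Edge (.graft d a c b r) → ℕ) .head then
        1 + q ^ (r.size + b.size + 1 + s) else 1) * shiftedWeight q (s + r.size) L₁ *
        shiftedWeight q s L₂ := by
  have e : ∀ e : Edge b, (Edge.under e : Edge (.graft d a c b r)).postRight + s =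
      e.postRight + (s + r.size) := fun e => by simp only [Edge.postRight]; ring
  simp only [shiftedWeight, sum_edge_graft, prod_edge_graft, circled_under, circled_beside, e]
  simp only [joinLabel, Edge.postRight, pow_add]
  ring

/-- The generating function of the labellings with root labels at least `l`, with positions
shifted by `s`. -/
noncomputable def rootSum (q : ℝ) (s : ℕ) (T : PlaneTree) (l : ℕ) : ℝ :=
  ∑ L ∈ labellingsFrom T l, shiftedWeight q s L

theorem rootSum_empty (q : ℝ) (s l : ℕ) : rootSum q s .empty l = 1 := by
  have : labellingsFrom .empty l = {fun e => nomatch e} := by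
    ext L
    simp only [mem_labellingsFrom, Finset.mem_singleton]
    exact ⟨fun _ => funext (fun e => nomatch e), fun _ => ⟨⟨nofun, nofun⟩, nofun⟩⟩
  have h : (Finset.univ : Finset (Edge .empty)) = ∅ := rfl
  simp [rootSum, this, shiftedWeight, h]

theorem rootSum_plain (q : ℝ) (s l : ℕ) {c : ℕ} {b r : PlaneTree} (hc : FirstLe c b) :
    rootSum q s (.graft false false c b r) l =
      (∑ v ∈ Finset.Icc l c, q ^ v * rootSum q (s + r.size) b v) *
        (1 + q ^ (r.size + b.size + 1 + s)) * rootSum q s r l := by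
  have h : ∀ L : Edge (.graft false false c b r) → ℕ, Circled L .head := fun L => by
    simp [Circled, Edge.HasDot, Edge.HasArrow]
  rw [rootSum, sum_labellingsFrom_graft hc, Finset.sum_mul, Finset.sum_mul]
  refine Finset.sum_congr rfl fun v hv => ?_
  simp only [shiftedWeight_join, h, if_true, ← Finset.mul_sum, ← Finset.sum_mul]
  simp only [rootSum]
  ring

theorem rootSum_dotted (q : ℝ) (s l : ℕ) {c : ℕ} {b : PlaneTree} (hc : FirstLe c b) :
    rootSum q s (.graft true false c b .empty) l =
      ∑ v ∈ Finset.Icc l c, q ^ v * rootSum q s b v := by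
  have h : ∀ L : Edge (.graft true false c b .empty) → ℕ, ¬ Circled L .head := fun L => by
    simp [Circled, Edge.HasDot]
  have h' := rootSum_empty q s l
  simp only [rootSum] at h'
  simp only [rootSum, sum_labellingsFrom_graft hc, shiftedWeight_join, h, if_false,
    PlaneTree.size, add_zero, ← Finset.mul_sum, h', mul_one]

-- The head would always contribute `1 + q ^ i`; the labellings in which it has no circle, those
-- with all root labels of `r` above `v`, are corrected by the subtracted term.
open Classical in
theorem rootSum_arrow (q : ℝ) (s l : ℕ) {c : ℕ} {b r : PlaneTree} (hc : FirstLe c b)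
    (hr : ArrowRow r) :
    rootSum q s (.graft false true c b r) l =
      ∑ v ∈ Finset.Icc l c, q ^ v * rootSum q (s + r.size) b v *
        ((1 + q ^ (r.size + b.size + 1 + s)) * rootSum q s r l -
          q ^ (r.size + b.size + 1 + s) * rootSum q s r (v + 1)) := by
  rw [rootSum, sum_labellingsFrom_graft hc]
  refine Finset.sum_congr rfl fun v hv => ?_
  have key : ∀ L₁ : Edge b → ℕ, ∑ L₂ ∈ labellingsFrom r l,
      shiftedWeight q s (joinLabel v L₁ L₂ : Edge (.graft false true c b r) → ℕ) =
      q ^ v * shiftedWeight q (s + r.size) L₁ *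
        ((1 + q ^ (r.size + b.size + 1 + s)) * rootSum q s r l -
          q ^ (r.size + b.size + 1 + s) * rootSum q s r (v + 1)) := by
    intro L₁
    have hsub : labellingsFrom r (v + 1) = (labellingsFrom r l).filter
        fun L => ∀ e : Edge r, e.AtRoot → v + 1 ≤ L e := by
      ext L
      simp only [Finset.mem_filter, mem_labellingsFrom]
      rw [Finset.mem_Icc] at hv
      exact ⟨fun h => ⟨⟨h.1, fun e he => by have := h.2 e he; omega⟩, h.2⟩,
        fun h => ⟨h.1.1, h.2⟩⟩
    rw [rootSum, rootSum, hsub, Finset.sum_filter]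
    simp only [Finset.mul_sum, ← Finset.sum_sub_distrib]
    refine Finset.sum_congr rfl fun L₂ _ => ?_
    rw [shiftedWeight_join, circled_head_of_arrowRow hr]
    simp only [joinLabel]
    split_ifs <;> ring
  simp only [key, ← Finset.sum_mul, ← Finset.mul_sum, rootSum]

/-! ### The trees of forests -/

/-- The tree of a forest, glued at the left of the tree `T`; `k` is the number of `D`'s before the
forest, and `arrow` decides whether the edges at the root have incoming arrows. -/
def glue (arrow : Bool) : ℕ → Forest → PlaneTree → PlaneTree
  | _, .nil, T => T
  | k, .node z z', T =>
    .graft false arrow k (glue false k z .empty) (glue arrow (k + z.size + 1) z' T)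

theorem size_glue {arrow : Bool} {k : ℕ} {z : Forest} {T : PlaneTree} :
    (glue arrow k z T).size = z.size + T.size := by
  induction z generalizing arrow k T with
  | nil => simp [glue, Forest.size]
  | node z z' h h' => simp [glue, Forest.size, PlaneTree.size, h, h']; ring

theorem FirstLe.glue {arrow : Bool} {k : ℕ} {z : Forest} {T : PlaneTree}
    (h : FirstLe (k + z.size) T) : FirstLe k (glue arrow k z T) := by
  induction z generalizing arrow k T with
  | nil => exact h
  | node z z' ih ih' => exact (ih (firstLe_empty _)).graft le_rfl

theorem arrowRow_glue {k c : ℕ} {z : Forest} {B : PlaneTree} :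
    ArrowRow (glue true k z (.graft true false c B .empty)) := by
  induction z generalizing k with
  | nil => exact .inl ⟨rfl, rfl⟩
  | node z z' ih ih' => exact .inr ⟨rfl, ih'⟩

section

variable {q : ℝ}

/-- Without arrows every edge of the forest has a circle, so the circle factors split off as
`plusProd`. Each edge then contributes a hockey-stick sum over its label. -/
theorem rootSum_glue (h0 : 0 < q) (h1 : q < 1) (z : Forest) : ∀ {s k l : ℕ} {T : PlaneTree},
    l ≤ k → rootSum q s (glue false k z T) l = q ^ (l * z.size) * z.chordProd q *
      risingProd q (k - l) z.size * plusProd q z.size (s + T.size) * rootSum q s T l := by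
  induction z with
  | nil => simp [glue, Forest.size, Forest.chordProd, risingProd_zero, plusProd_zero]
  | node w z ihw ihz =>
    intro s k l T hl
    obtain ⟨d, rfl⟩ := Nat.exists_eq_add_of_le hl
    rw [glue, rootSum_plain q s l (firstLe_empty _).glue, ihz (by omega), size_glue, size_glue]
    have hsum := sum_pow_mul_risingProd_sub q l d w.size
    rw [Finset.sum_congr rfl (g := fun v => (w.chordProd q *
      plusProd q w.size (s + (z.size + T.size))) *
        (q ^ (v * (w.size + 1)) * risingProd q (l + d - v) w.size)), ← Finset.mul_sum]
    · have hne := one_sub_pow_ne_zero h0 h1 w.size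
      rw [eq_div_of_mul_eq hne hsum, show l + d + w.size + 1 - l = d + (w.size + 1) by omega,
        show l + d - l = d by omega]
      simp only [Forest.size, Forest.chordProd, PlaneTree.size, add_zero]
      rw [risingProd_add q d (w.size + 1) z.size, add_comm (w.size + 1) z.size, plusProd_add,
        plusProd_succ,
        show z.size + (s + T.size) = s + (z.size + T.size) by ring,
        show w.size + 1 + (s + (z.size + T.size)) = z.size + T.size + w.size + 1 + s by ring]
      field_simp
      ring
    · intro v hv
      rw [ihw (Finset.mem_Icc.1 hv).2, rootSum_empty]
      simp only [PlaneTree.size, add_zero]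
      ring

/-- The dependence on `l` is again a power times a rising product, so both terms of `rootSum_arrow`
are hockey-stick sums. -/
theorem rootSum_glue_arrow (h0 : 0 < q) (h1 : q < 1) {k' M : ℕ} {C : ℝ} {B : PlaneTree}
    (hB : ∀ v ≤ k', rootSum q 0 B v = q ^ (v * M) * C * risingProd q (k' - v) M)
    (hM : B.size = M) (hc : FirstLe k' B) (z : Forest) : ∀ {k l : ℕ}, k + z.size = k' → l ≤ k →
    rootSum q 0 (glue true k z (.graft true false k' B .empty)) l =
      q ^ (l * (M + z.size + 1)) * oddConst q C M z * risingProd q (k - l) (M + z.size + 1) := by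
  induction z with
  | nil =>
    intro k l hk hl
    obtain rfl : k = k' := by simpa [Forest.size] using hk
    obtain ⟨d, rfl⟩ := Nat.exists_eq_add_of_le hl
    rw [glue, rootSum_dotted q 0 l hc]
    rw [Finset.sum_congr rfl (g := fun v => C *
        (q ^ (v * (M + 1)) * risingProd q (l + d - v) M)), ← Finset.mul_sum,
      eq_div_of_mul_eq (one_sub_pow_ne_zero h0 h1 M) (sum_pow_mul_risingProd_sub q l d M)]
    · simp only [oddConst, Forest.size, add_zero, Nat.add_sub_cancel_left]
      ring
    · intro v hv
      rw [hB v (Finset.mem_Icc.1 hv).2]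
      ring
  | node w z _ ihz =>
    intro k l hk hl
    obtain ⟨d, rfl⟩ := Nat.exists_eq_add_of_le hl
    simp only [Forest.size] at hk
    rw [glue, rootSum_arrow q 0 l (firstLe_empty _).glue arrowRow_glue, size_glue, size_glue,
      ihz (by omega) (by omega)]
    simp only [PlaneTree.size, hM, add_zero]
    set N := M + z.size with hN
    have hQ : z.size + (M + 1) + w.size + 1 = w.size + N + 1 + 1 := by rw [hN]; ring
    rw [hQ]
    set Q := q ^ (w.size + N + 1 + 1) with hQ'
    set K := oddConst q C M z with hK
    have s1 := eq_div_of_mul_eq (one_sub_pow_ne_zero h0 h1 w.size)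
      (sum_pow_mul_risingProd_sub q l d w.size)
    have s2 := eq_div_of_mul_eq (one_sub_pow_ne_zero h0 h1 (w.size + N + 1))
      (sum_pow_mul_risingProd_sub q l d (w.size + N + 1))
    rw [Finset.sum_congr rfl (g := fun v => w.chordProd q * plusProd q w.size (N + 1) * K * (
        ((1 + Q) * (q ^ (l * (N + 1)) * risingProd q (d + w.size + 1) (N + 1))) *
          (q ^ (v * (w.size + 1)) * risingProd q (l + d - v) w.size) -
        (Q * q ^ (N + 1)) * (q ^ (v * (w.size + N + 1 + 1)) *
          risingProd q (l + d - v) (w.size + N + 1)))), ← Finset.mul_sum, Finset.sum_sub_distrib,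
      ← Finset.mul_sum, ← Finset.mul_sum, s1, s2]
    · have e1 : risingProd q d (w.size + N + 1 + 1) =
          risingProd q d (w.size + 1) * risingProd q (d + w.size + 1) (N + 1) := by
        rw [show w.size + N + 1 + 1 = (w.size + 1) + (N + 1) by ring, risingProd_add]; rfl
      simp only [oddConst, Forest.size, ← hK, ← hN]
      rw [show M + (w.size + 1 + z.size) + 1 = w.size + N + 1 + 1 by rw [hN]; ring, e1,
        show N + w.size + 1 + 1 = w.size + N + 1 + 1 by ring, ← hQ',
        show l + d - l = d by omega, e1,
        show 2 * (N + 1) + (w.size + 1) = (N + 1) + (w.size + N + 1 + 1) by ring, pow_add q (N + 1),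
        ← hQ', show l * (w.size + N + 1 + 1) = l * (N + 1) + l * (w.size + 1) by ring,
        pow_add q (l * (N + 1))]
      have hne1 := one_sub_pow_ne_zero h0 h1 w.size
      have hne2 : 1 - Q ≠ 0 := one_sub_pow_ne_zero h0 h1 (w.size + N + 1)
      have hQ2 : Q = q ^ (w.size + 1) * q ^ (N + 1) := by rw [hQ', ← pow_add]; ring_nf
      -- The two sums combine by `(1 + a b) / (1 - a) - a b ^ 2 / (1 - a b) = (1 - a b ^ 2) / ((1 -
      -- a) (1 - a b))`, which is the factor in `oddConst`.
      generalize q ^ (w.size + 1) = a at *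
      generalize q ^ (N + 1) = b at *
      rw [hQ2] at hne2 ⊢
      field_simp
      ring
    · intro v hv
      have hv' := (Finset.mem_Icc.1 hv).2
      rw [rootSum_glue h0 h1 w hv', ihz (by omega) (by omega), rootSum_empty,
        show l + d + w.size + 1 - l = d + w.size + 1 by omega,
        show l + d + w.size + 1 - (v + 1) = l + d - v + w.size by omega,
        show w.size + N + 1 = w.size + (N + 1) by ring, risingProd_add q (l + d - v) w.size,
        show 0 + (z.size + (M + 1)) + PlaneTree.empty.size = N + 1 by
          simp [hN, PlaneTree.size]; ring]
      ring

end

/-! ### Reading words -/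

/-- Reading a word of which `k` letters `D` stand to the left. -/
def readOffset : ℕ → List Step → ReadState
  | _, [] => ⟨0, .empty, []⟩
  | k, .U :: w => readStep k .U (readOffset k w)
  | k, .D :: w => readStep 0 .D (readOffset (k + 1) w)

/-- Against the path of only `U`'s, the deficit of `U`'s in a prefix is the number of its `D`'s. -/
theorem capacity_append (w w' : List Step) (s : Step) (N : ℕ) (hN : w.length < N) :
    capacity (w ++ s :: w') (List.replicate N .U) w.length = (w ++ [s]).count .D := by
  have h : (w ++ s :: w').take (w.length + 1) = w ++ [s] := by
    rw [show w ++ s :: w' = (w ++ [s]) ++ w' by simp,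
      show w.length + 1 = (w ++ [s]).length by simp, List.take_left]
  have hlen : ∀ v : List Step, v.count .U + v.count .D = v.length := by
    intro v
    induction v with
    | nil => rfl
    | cons s v ih => cases s <;> simp <;> omega
  have := hlen (w ++ [s])
  simp only [List.length_append, List.length_singleton] at this
  rw [capacity, h, List.take_replicate, List.count_replicate_self, min_eq_left (by omega)]
  omega

theorem readWord_eq_readOffset (w' w : List Step) (N : ℕ) (hN : w.length + w'.length ≤ N) :
    readWord (capacity (w ++ w') (List.replicate N .U)) w.length w' =
      readOffset (w.count .D) w' := by
  induction w' generalizing w with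
  | nil => rfl
  | cons s w' ih =>
    simp only [List.length_cons] at hN
    have := ih (w ++ [s]) (by simp; omega)
    rw [List.append_assoc, List.length_append, List.length_singleton, List.singleton_append] at this
    rw [readWord, this, capacity_append w w' s N (by omega)]
    cases s with
    | U => simp [readOffset]
    | D => simp [readOffset, readStep]

theorem readOffset_forest (z : Forest) (k : ℕ) (w : List Step) :
    readOffset k (z.word ++ w) =
      ⟨(readOffset (k + z.size) w).unpaired,
        glue ((readOffset (k + z.size) w).stack.isEmpty &&
          (readOffset (k + z.size) w).unpaired % 2 == 1) k z (readOffset (k + z.size) w).current,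
        (readOffset (k + z.size) w).stack⟩ := by
  induction z generalizing k w with
  | nil => rfl
  | node z z' ih ih' =>
    have e : k + (Forest.node z z').size = k + z.size + 1 + z'.size := by simp [Forest.size]; ring
    rw [Forest.word, List.cons_append, List.append_assoc, List.cons_append, readOffset, ih,
      readOffset, ih', e]
    simp [readStep, glue]

/-- The tree of `evenWord z₀ l`. -/
def evenTree (z₀ : Forest) : ℕ → List (Forest × Forest) → PlaneTree
  | k, [] => glue false k z₀ .empty
  | k, z :: l => glue false k z.1 (glue true (k + z.1.size) z.2
      (.graft true false (k + z.1.size + z.2.size)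
        (evenTree z₀ (k + z.1.size + z.2.size) l) .empty))

theorem readOffset_evenWord (z₀ : Forest) (l : List (Forest × Forest)) (k : ℕ) :
    readOffset k (evenWord z₀ l) = ⟨2 * l.length, evenTree z₀ k l, []⟩ := by
  induction l generalizing k with
  | nil =>
    have := readOffset_forest z₀ k []
    rw [List.append_nil] at this
    rw [evenWord, this]
    simp [readOffset, evenTree]
  | cons z l ih =>
    rw [evenWord, readOffset_forest, readOffset, readOffset_forest, readOffset, ih]
    simp [readStep, evenTree, Nat.add_mod]
    ring

theorem readOffset_oddWord (z z₀ : Forest) (l : List (Forest × Forest)) (k : ℕ) :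
    readOffset k (z.word ++ .U :: evenWord z₀ l) = ⟨2 * l.length + 1,
      glue true k z (.graft true false (k + z.size) (evenTree z₀ (k + z.size) l) .empty), []⟩ := by
  rw [readOffset_forest, readOffset, readOffset_evenWord]
  simp [readStep, Nat.add_mod]

theorem size_evenTree (z₀ : Forest) (l : List (Forest × Forest)) (k : ℕ) :
    (evenTree z₀ k l).size = evenSize z₀ l := by
  induction l generalizing k with
  | nil => simp [evenTree, size_glue, PlaneTree.size, evenSize]
  | cons z l ih => simp [evenTree, size_glue, PlaneTree.size, evenSize, ih]; ring

theorem firstLe_evenTree (z₀ : Forest) (l : List (Forest × Forest)) (k : ℕ) :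
    FirstLe k (evenTree z₀ k l) := by
  induction l generalizing k with
  | nil => exact (firstLe_empty _).glue
  | cons z l ih => exact (((ih _).graft le_rfl).glue).glue

theorem rootSum_evenTree {q : ℝ} (h0 : 0 < q) (h1 : q < 1) (z₀ : Forest)
    (m : List (Forest × Forest)) {k l : ℕ} (hl : l ≤ k) :
    rootSum q 0 (evenTree z₀ k m) l =
      q ^ (l * evenSize z₀ m) * evenConst q z₀ m * risingProd q (k - l) (evenSize z₀ m) := by
  induction m generalizing k l with
  | nil =>
    rw [evenTree, rootSum_glue h0 h1 z₀ hl, rootSum_empty]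
    simp only [evenConst, evenSize, PlaneTree.size, add_zero]
    ring
  | cons z m ih =>
    rw [evenTree, rootSum_glue h0 h1 z.1 hl, rootSum_glue_arrow h0 h1 (fun v hv => ih hv)
      (size_evenTree _ _ _) (firstLe_evenTree _ _ _) z.2 rfl (by omega), size_glue]
    simp only [evenConst, evenSize, PlaneTree.size, size_evenTree, add_zero, zero_add]
    rw [risingProd_add q (k - l) z.1.size, show k - l + z.1.size = k + z.1.size - l by omega,
      show evenSize z₀ m + z.2.size + 1 = z.2.size + (evenSize z₀ m + 1) by ring]
    ring

/-! ### Runs of stacks -/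

section

variable {hl : ℕ → ℤ}

theorem eq_of_mem_take_topCount {x a : ℕ} {s : List ℕ} (h : a ∈ s.take (topCount hl x s)) :
    hl a = hl x := by
  have h1 : (s.map hl).takeWhile (fun h => decide (h = hl x)) = (s.take (topCount hl x s)).map hl := by
    rw [List.map_take, topCount]
    exact List.prefix_iff_eq_take.1 (List.takeWhile_prefix _)
  have h2 : hl a ∈ (s.map hl).takeWhile (fun h => decide (h = hl x)) := by
    rw [h1]; exact List.mem_map_of_mem h
  simpa using List.mem_takeWhile_imp h2

theorem le_topCount_append {x : ℕ} {s s' : List ℕ} (h : ∀ a ∈ s, hl a = hl x) :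
    s.length ≤ topCount hl x (s ++ s') := by
  rw [topCount, List.map_append, List.takeWhile_append_of_pos (by simpa using h)]
  simp

/-- A stack of columns, the lowest tile first, at which tiles covering column `x` may start. -/
structure IsStack (hl : ℕ → ℤ) (x : ℕ) (t : List ℕ) : Prop where
  pairwise : t.Pairwise (fun a b => hl a ≤ hl b)
  le : ∀ a ∈ t, 1 ≤ a ∧ a ≤ x ∧ hl a ≤ hl x

/-- The stack `t'` at column `x + 1` may follow the stack `t` at column `x` along the step `st`:
the `c` lowest tiles go on and all others end. -/
def Follows (hl : ℕ → ℤ) (st : Step) (x : ℕ) (t t' : List ℕ) : Prop :=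
  ∃ c l, c ≤ t.length ∧ t' = t.take c ++ List.replicate l (x + 1) ∧
    (∀ a ∈ t.drop c, hl a = hl x) ∧ (st = .D → ∀ a ∈ t.take c, hl a < hl x) ∧
    (t'.length = t.length ∨ st = .U ∧ t'.length + 1 = t.length ∨
      st = .D ∧ t'.length = t.length + 1)

/-- The height difference along a step. -/
def Step.sign : Step → ℤ
  | .U => 1
  | .D => -1

theorem Follows.isStack {st : Step} {x : ℕ} {t t' : List ℕ} (h : Follows hl st x t t')
    (ht : IsStack hl x t) (hx : hl (x + 1) = hl x + st.sign) : IsStack hl (x + 1) t' := by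
  obtain ⟨c, l, hc, rfl, h1, h2, -⟩ := h
  have hle : ∀ a ∈ t.take c, hl a ≤ hl (x + 1) := by
    intro a ha
    have := (ht.le a (List.mem_of_mem_take ha)).2.2
    cases st with
    | U => simp [Step.sign] at hx; omega
    | D => have := h2 rfl a ha; simp [Step.sign] at hx; omega
  refine ⟨List.pairwise_append.2 ⟨ht.pairwise.sublist (List.take_sublist _ _), ?_, ?_⟩, ?_⟩
  · exact List.pairwise_replicate.2 (.inr le_rfl)
  · intro a ha b hb
    rw [List.eq_of_mem_replicate hb]
    exact hle a ha
  · intro a ha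
    rcases List.mem_append.1 ha with ha | ha
    · have := ht.le a (List.mem_of_mem_take ha)
      exact ⟨this.1, by omega, hle a ha⟩
    · rw [List.eq_of_mem_replicate ha]
      exact ⟨by omega, le_rfl, le_rfl⟩

/-- The stacks that follow `t`. -/
def nextStacks (hl : ℕ → ℤ) (x : ℕ) (t : List ℕ) : Step → Finset (List ℕ)
  | .U => (Finset.range (topCount hl x t.reverse + 1)).image
        (fun j => t.take (t.length - j) ++ List.replicate j (x + 1)) ∪
      (Finset.range (topCount hl x t.reverse)).image
        (fun j => t.take (t.length - (j + 1)) ++ List.replicate j (x + 1))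
  | .D => {t.take (t.length - topCount hl x t.reverse) ++
        List.replicate (topCount hl x t.reverse) (x + 1),
      t.take (t.length - topCount hl x t.reverse) ++
        List.replicate (topCount hl x t.reverse + 1) (x + 1)}

theorem eq_of_mem_drop {x j : ℕ} {t : List ℕ} (hj : j ≤ topCount hl x t.reverse) {a : ℕ}
    (ha : a ∈ t.drop (t.length - j)) : hl a = hl x := by
  refine eq_of_mem_take_topCount (s := t.reverse) ?_
  rw [← List.mem_reverse, ← List.take_reverse] at ha
  exact (List.take_sublist_take_left hj).subset ha

/-- Heights increase weakly up the stack, so the tiles at the current height are its last `topCount`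
entries. A down step ends all of them, as the surviving tiles have to be strictly lower. -/
theorem mem_nextStacks {st : Step} {x : ℕ} {t t' : List ℕ} (ht : IsStack hl x t) :
    t' ∈ nextStacks hl x t st ↔ Follows hl st x t t' := by
  have hd : topCount hl x t.reverse ≤ t.length := by simpa using topCount_le_length x t.reverse
  have hlt : ∀ a ∈ t.take (t.length - topCount hl x t.reverse), hl a < hl x := by
    intro a ha
    refine lt_of_mem_drop_topCount (t := t.reverse) (List.pairwise_reverse.2 ht.pairwise)
      (fun b hb => (ht.le b (List.mem_reverse.1 hb)).2.2) a ?_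
    rw [List.drop_reverse]
    exact List.mem_reverse.2 ha
  constructor
  · intro h
    cases st with
    | U =>
      simp only [nextStacks, Finset.mem_union, Finset.mem_image, Finset.mem_range] at h
      rcases h with ⟨j, hj, rfl⟩ | ⟨j, hj, rfl⟩
      · exact ⟨t.length - j, j, by omega, rfl, fun a => eq_of_mem_drop (by omega), nofun,
          .inl (by simp; omega)⟩
      · exact ⟨t.length - (j + 1), j, by omega, rfl, fun a => eq_of_mem_drop (by omega), nofun,
          .inr (.inl ⟨rfl, by simp; omega⟩)⟩
    | D =>
      simp only [nextStacks, Finset.mem_insert, Finset.mem_singleton] at h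
      rcases h with rfl | rfl
      · exact ⟨_, _, by omega, rfl, fun a => eq_of_mem_drop le_rfl, fun _ => hlt,
          .inl (by simp; omega)⟩
      · exact ⟨_, _, by omega, rfl, fun a => eq_of_mem_drop le_rfl, fun _ => hlt,
          .inr (.inr ⟨rfl, by simp; omega⟩)⟩
  · rintro ⟨c, l, hc, rfl, h1, h2, h3⟩
    obtain ⟨j, hj⟩ := Nat.exists_eq_add_of_le hc
    have hcj : c = t.length - j := by omega
    have hs : t.reverse = (t.drop c).reverse ++ (t.take c).reverse := by
      rw [← List.reverse_append, List.take_append_drop]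
    have hlen : (t.drop c).reverse.length = j := by simp; omega
    have hjd : j ≤ topCount hl x t.reverse := by
      rw [hs, ← hlen]
      exact le_topCount_append (by simpa using h1)
    simp only [List.length_append, List.length_take, List.length_replicate, min_eq_left hc] at h3
    cases st with
    | U =>
      simp only [nextStacks, Finset.mem_union, Finset.mem_image, Finset.mem_range]
      simp only [true_and, reduceCtorEq, false_and, or_false] at h3
      rcases h3 with h3 | h3
      · obtain rfl : l = j := by omega
        exact .inl ⟨l, by omega, by rw [hcj]⟩
      · obtain rfl : j = l + 1 := by omega
        exact .inr ⟨l, by omega, by rw [hcj]⟩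
    | D =>
      simp only [nextStacks, Finset.mem_insert, Finset.mem_singleton]
      simp only [true_and, reduceCtorEq, false_and, false_or] at h3
      have hjd' : topCount hl x t.reverse = j := by
        rw [hs, topCount_append_le _ (by simpa using h2 rfl),
          topCount_of_forall_eq (by simpa using h1), hlen]
      rw [hjd', ← hcj]
      rcases h3 with h3 | h3
      · obtain rfl : l = j := by omega
        exact .inl rfl
      · obtain rfl : l = j + 1 := by omega
        exact .inr rfl

/-- The contribution of column `x` to the exponent, for the stack `t` at this column, if the step
into the column is `st`. -/
def stepCost (st : Step) (x : ℕ) (t : List ℕ) : ℕ :=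
  (t.map fun a => if st = .D ∨ a = x then 1 else 0).sum

theorem stepCost_down (x : ℕ) (t : List ℕ) : stepCost .D x t = t.length := by simp [stepCost]

theorem stepCost_up {x c l : ℕ} {t : List ℕ} (ht : ∀ a ∈ t, a ≤ x) :
    stepCost .U (x + 1) (t.take c ++ List.replicate l (x + 1)) = l := by
  have : ∀ a ∈ t.take c, (if Step.U = .D ∨ a = x + 1 then 1 else 0) = 0 := by
    intro a ha
    have := ht a (List.mem_of_mem_take ha)
    simp; omega
  rw [stepCost, List.map_append, List.sum_append, List.map_congr_left this]
  simp

theorem transfer_cons {q : ℝ} {O : Finset ℕ} {st : Step} {w : List Step} {x : ℕ} {t : List ℕ}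
    (ht : IsStack hl x t) :
    transfer q hl O (st :: w) x t.reverse =
      ∑ t' ∈ nextStacks hl x t st, q ^ stepCost st (x + 1) t' *
        transfer q hl O w (x + 1) t'.reverse := by
  have hd : topCount hl x t.reverse ≤ t.length := by simpa using topCount_le_length x t.reverse
  have hle : ∀ a ∈ t, a ≤ x := fun a ha => (ht.le a ha).2.1
  have hrev : ∀ j l, (t.take (t.length - j) ++ List.replicate l (x + 1)).reverse =
      List.replicate l (x + 1) ++ t.reverse.drop j := by
    intro j l
    rw [List.reverse_append, List.reverse_replicate, List.drop_reverse]
  cases st with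
  | U =>
    rw [nextStacks, Finset.sum_union, Finset.sum_image, Finset.sum_image]
    · simp only [stepCost_up hle, hrev, transfer]
    -- The cost of a stack recovers the number of new tiles, so different `j` give different stacks.
    · intro i _ j _ hij
      simpa only [stepCost_up hle] using congrArg (stepCost .U (x + 1)) hij
    · intro i _ j _ hij
      simpa only [stepCost_up hle] using congrArg (stepCost .U (x + 1)) hij
    · rw [Finset.disjoint_left]
      intro t' h h'
      simp only [Finset.mem_image, Finset.mem_range] at h h'
      obtain ⟨i, hi, rfl⟩ := h
      obtain ⟨j, hj, h⟩ := h'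
      have := congrArg List.length h
      simp only [List.length_append, List.length_take, List.length_replicate] at this
      omega
  | D =>
    rw [nextStacks, Finset.sum_pair]
    · simp only [stepCost_down, hrev, transfer, List.length_append, List.length_take,
        List.length_replicate, List.length_reverse]
      rw [min_eq_left (by omega), Nat.sub_add_cancel hd, ← add_assoc, Nat.sub_add_cancel hd]
    · intro h
      have := congrArg List.length h
      simp at this

/-- The sequences of stacks along the word `w`, after the stack `t` at column `x`. -/
def runs (hl : ℕ → ℤ) : List Step → ℕ → List ℕ → Finset (List (List ℕ))
  | [], _, _ => {[]}
  | st :: w, x, t => (nextStacks hl x t st).biUnion fun t' =>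
    (runs hl w (x + 1) t').image (t' :: ·)

theorem transfer_eq_sum_runs {q : ℝ} {O : Finset ℕ} {w : List Step} {x : ℕ} {t : List ℕ}
    (hf : Fits hl x w) (ht : IsStack hl x t) :
    transfer q hl O w x t.reverse = ∑ ρ ∈ runs hl w x t,
      q ^ (∑ i ∈ Finset.range w.length, stepCost (w.getD i .U) (x + i + 1) (ρ.getD i [])) *
        finalWeight q hl O (x + w.length) ((t :: ρ).getD w.length []).reverse := by
  induction w generalizing x t with
  | nil => simp [transfer, runs]
  | cons st w ih =>
    have hx : hl (x + 1) = hl x + st.sign ∧ Fits hl (x + 1) w := by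
      cases st <;> simpa [Fits, Step.sign, sub_eq_add_neg] using hf
    rw [transfer_cons ht, runs, Finset.sum_biUnion]
    · refine Finset.sum_congr rfl fun t' ht' => ?_
      rw [ih hx.2 (((mem_nextStacks ht).1 ht').isStack ht hx.1), Finset.mul_sum,
        Finset.sum_image fun _ _ _ _ h => (List.cons.inj h).2]
      refine Finset.sum_congr rfl fun ρ _ => ?_
      rw [List.length_cons, Finset.sum_range_succ', pow_add]
      simp only [List.getD_cons_succ, List.getD_cons_zero, add_zero]
      rw [Finset.sum_congr rfl fun i _ => by rw [show x + 1 + i + 1 = x + (i + 1) + 1 by ring],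
        show x + 1 + w.length = x + (w.length + 1) by ring]
      ring
    · intro t₁ _ t₂ _ h
      rw [Function.onFun, Finset.disjoint_left]
      intro ρ h1 h2
      obtain ⟨ρ₁, -, rfl⟩ := Finset.mem_image.1 h1
      obtain ⟨ρ₂, -, h3⟩ := Finset.mem_image.1 h2
      exact h (List.cons.inj h3).1.symm

theorem mem_runs {w : List Step} {x : ℕ} {t : List ℕ} (hf : Fits hl x w) (ht : IsStack hl x t)
    {ρ : List (List ℕ)} : ρ ∈ runs hl w x t ↔ ρ.length = w.length ∧ ∀ i < w.length,
      Follows hl (w.getD i .U) (x + i) ((t :: ρ).getD i []) (ρ.getD i []) := by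
  induction w generalizing x t ρ with
  | nil => simp [runs]
  | cons st w ih =>
    have hx : hl (x + 1) = hl x + st.sign ∧ Fits hl (x + 1) w := by
      cases st <;> simpa [Fits, Step.sign, sub_eq_add_neg] using hf
    simp only [runs, Finset.mem_biUnion, Finset.mem_image, mem_nextStacks ht]
    constructor
    · rintro ⟨t', h1, ρ, h2, rfl⟩
      rw [ih hx.2 (h1.isStack ht hx.1)] at h2
      refine ⟨by simp [h2.1], fun i hi => ?_⟩
      cases i with
      | zero => simpa using h1
      | succ i =>
        have := h2.2 i (by simpa using hi)
        simpa [show x + 1 + i = x + (i + 1) by ring] using this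
    · rintro ⟨h1, h2⟩
      cases ρ with
      | nil => simp at h1
      | cons t' ρ =>
        have h3 : Follows hl st x t t' := by simpa using h2 0 (by simp)
        refine ⟨t', h3, ρ, (ih hx.2 (h3.isStack ht hx.1)).2 ⟨by simpa using h1, fun i hi => ?_⟩, rfl⟩
        have := h2 (i + 1) (by simpa using hi)
        simpa [show x + 1 + i = x + (i + 1) by ring] using this

end

/-! ### Heights -/

theorem count_add_count (w : List Step) : w.count .U + w.count .D = w.length := by
  induction w with
  | nil => rfl
  | cons s w ih => cases s <;> simp <;> omega

theorem height_eq (w : List Step) {i : ℕ} (hi : i ≤ w.length) :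
    height w i = i - 2 * (w.take i).count .D := by
  have := count_add_count (w.take i)
  rw [List.length_take, min_eq_left hi] at this
  rw [height]; omega

theorem height_of_length_le (w : List Step) {i : ℕ} (hi : w.length ≤ i) :
    height w i = height w w.length := by
  simp [height, List.take_of_length_le hi]

theorem count_take_succ (w : List Step) {i : ℕ} (hi : i < w.length) (s : Step) :
    (w.take (i + 1)).count s = (w.take i).count s + if w.getD i .U = s then 1 else 0 := by
  rw [List.take_succ_eq_append_getElem hi, List.count_append, List.count_singleton,
    List.getD_eq_getElem _ _ hi]
  simp

theorem height_succ (w : List Step) {i : ℕ} (hi : i < w.length) :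
    height w (i + 1) = height w i + (w.getD i .U).sign := by
  rw [height, height, count_take_succ w hi, count_take_succ w hi]
  cases w.getD i .U <;> simp [Step.sign] <;> ring

theorem fits_height_drop (w : List Step) : ∀ {n i : ℕ}, i + n = w.length →
    Fits (height w) i (w.drop i)
  | 0, i, h => by rw [List.drop_of_length_le (by omega)]; trivial
  | n + 1, i, h => by
    have hi : i < w.length := by omega
    have h1 := height_succ w hi
    have h2 := fits_height_drop w (n := n) (i := i + 1) (by omega)
    rw [List.drop_eq_getElem_cons hi]
    rw [List.getD_eq_getElem _ _ hi] at h1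
    cases h : w[i] <;> rw [h] at h1
    · exact ⟨h1, h2⟩
    · exact ⟨h1, h2⟩

theorem fits_height (w : List Step) : Fits (height w) 0 w :=
  fits_height_drop w (n := w.length) (i := 0) (by simp)

/-! ### Tiles parallel to the lower path -/

/-- The centre of the box of level `k` in column `x`. -/
def box (hl : ℕ → ℤ) (k x : ℕ) : ℕ × ℤ := (x, hl x + 1 + 2 * k)

theorem box_injective (hl : ℕ → ℤ) (k : ℕ) : Function.Injective (box hl k) :=
  fun _ _ h => (Prod.ext_iff.1 h).1

/-- The boxes of level `k` in the columns from `a` to `b`. -/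
def seg (hl : ℕ → ℤ) (k a b : ℕ) : Finset (ℕ × ℤ) := (Finset.Icc a b).image (box hl k)

theorem box_mem_seg {hl : ℕ → ℤ} {k k' a b x : ℕ} :
    box hl k' x ∈ seg hl k a b ↔ k' = k ∧ a ≤ x ∧ x ≤ b := by
  simp only [seg, Finset.mem_image, Finset.mem_Icc, box, Prod.mk.injEq]
  constructor
  · rintro ⟨y, h, rfl, h'⟩
    exact ⟨by omega, h⟩
  · rintro ⟨rfl, h⟩
    exact ⟨x, h, rfl, rfl⟩

theorem card_seg (hl : ℕ → ℤ) (k a b : ℕ) : (seg hl k a b).card = b + 1 - a := by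
  rw [seg, Finset.card_image_of_injective _ (box_injective hl k), Nat.card_Icc]

theorem seg_inj {hl : ℕ → ℤ} {k k' a a' b b' : ℕ} (h : a ≤ b) (h' : a' ≤ b')
    (he : seg hl k a b = seg hl k' a' b') : k = k' ∧ a = a' ∧ b = b' := by
  have h1 : box hl k a ∈ seg hl k' a' b' := he ▸ box_mem_seg.2 ⟨rfl, le_rfl, h⟩
  have h2 : box hl k b ∈ seg hl k' a' b' := he ▸ box_mem_seg.2 ⟨rfl, h, le_rfl⟩
  have h3 : box hl k' a' ∈ seg hl k a b := he ▸ box_mem_seg.2 ⟨rfl, le_rfl, h'⟩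
  have h4 : box hl k' b' ∈ seg hl k a b := he ▸ box_mem_seg.2 ⟨rfl, h', le_rfl⟩
  rw [box_mem_seg] at h1 h2 h3 h4
  omega

theorem ribbon_eq_seg {p : ℕ × ℤ} {w : List Step} {hl : ℕ → ℤ} {k : ℕ}
    (h : ∀ i ≤ w.length, p.2 + height w i = hl (p.1 + i) + 1 + 2 * k) :
    ribbon p w = seg hl k p.1 (p.1 + w.length) := by
  ext ⟨x, y⟩
  simp only [ribbon, seg, Finset.mem_image, Finset.mem_range, Finset.mem_Icc, box, Prod.mk.injEq]
  constructor
  · rintro ⟨i, hi, rfl, rfl⟩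
    exact ⟨p.1 + i, by omega, rfl, (h i (by omega)).symm⟩
  · rintro ⟨x, hx, rfl, rfl⟩
    refine ⟨x - p.1, by omega, by omega, ?_⟩
    rw [h _ (by omega), Nat.add_sub_cancel' hx.1]

/-- A segment parallel to `lam` has the shape of the piece of `lam` between the two columns, so
being a ballot tile is a condition on that piece alone. -/
theorem isBallotTile_seg {lam : List Step} {k a b n n' : ℕ} (hab : a ≤ b) (hb : b ≤ lam.length) :
    IsBallotTile n n' (seg (height lam) k a b) ↔
      (∀ x, a ≤ x → x ≤ b → height lam a ≤ height lam x) ∧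
        height lam b - height lam a = n' ∧ b = a + (2 * n + n') := by
  constructor
  · rintro ⟨p, w, hw, hD, hU, he⟩
    have hc := count_add_count w
    have hx : ∀ x, a ≤ x ∧ x ≤ b ↔ p.1 ≤ x ∧ x ≤ p.1 + w.length := by
      intro x
      have h1 : x ∈ (seg (height lam) k a b).image Prod.fst ↔ x ∈ (ribbon p w).image Prod.fst := by
        rw [he]
      simp only [seg, ribbon, Finset.image_image, Finset.mem_image, Finset.mem_Icc,
        Finset.mem_range, Function.comp, box] at h1
      constructor
      · intro h
        obtain ⟨i, hi, rfl⟩ := h1.1 ⟨x, h, rfl⟩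
        omega
      · intro h
        obtain ⟨y, hy, rfl⟩ := h1.2 ⟨x - p.1, by omega, by omega⟩
        exact hy
    have ha : a = p.1 := by
      have h1 := hx a
      have h2 := hx p.1
      omega
    have hb' : b = p.1 + w.length := by
      have h1 := hx b
      have h2 := hx (p.1 + w.length)
      omega
    have hh : ∀ i ≤ w.length, p.2 + height w i = height lam (a + i) + 1 + 2 * k := by
      intro i hi
      have h1 : (p.1 + i, p.2 + height w i) ∈ seg (height lam) k a b := by
        rw [he]
        exact Finset.mem_image_of_mem _ (Finset.mem_range.2 (by omega))
      simp only [seg, Finset.mem_image, box, Prod.mk.injEq] at h1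
      obtain ⟨y, -, rfl, h2⟩ := h1
      rw [← h2, ha]
    have h0 := hh 0 (by omega)
    have hz : height w 0 = 0 := rfl
    have hl := hh w.length le_rfl
    have hwl : height w w.length = w.count .U - w.count .D := by simp [height]
    rw [add_zero] at h0
    rw [show a + w.length = b by omega] at hl
    refine ⟨fun x h1 h2 => ?_, by omega, by omega⟩
    have h3 := hh (x - a) (by omega)
    have h4 := hw (x - a)
    rw [Nat.add_sub_cancel' h1] at h3
    omega
  · rintro ⟨h1, h2, h3⟩
    set w := (lam.drop a).take (b - a) with hw
    have hlen : w.length = b - a := by simp [hw]; omega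
    have hh : ∀ i ≤ w.length, height w i = height lam (a + i) - height lam a := by
      intro i hi
      have : w.take i = (lam.drop a).take i := by rw [hw, List.take_take, min_eq_left (by omega)]
      simp only [height, this, List.take_add, List.count_append]
      push_cast; ring
    have hwl : height w w.length = w.count .U - w.count .D := by simp [height]
    have hc := count_add_count w
    have hend := hh w.length le_rfl
    rw [hlen, Nat.add_sub_cancel' hab, ← hlen] at hend
    refine ⟨box (height lam) k a, w, fun i => ?_, by omega, by omega, ?_⟩
    · rcases le_total i w.length with hi | hi
      · rw [hh i hi]
        have := h1 (a + i) (by omega) (by omega)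
        omega
      · rw [height_of_length_le w hi, hend]
        have := h1 b hab le_rfl
        omega
    · rw [ribbon_eq_seg (hl := height lam) (k := k)]
      · simp only [box]
        rw [hlen, Nat.add_sub_cancel' hab]
      · intro i hi
        rw [hh i hi]
        simp only [box]
        ring

/-! ### Runs -/

/-- The sequence `τ` of stacks is a run along the path `lam`. -/
structure IsRun (lam : List Step) (τ : ℕ → List ℕ) : Prop where
  zero : τ 0 = []
  follows : ∀ x < lam.length, Follows (height lam) (lam.getD x .U) x (τ x) (τ (x + 1))

theorem Follows.exists_getElem? {hl : ℕ → ℤ} {st : Step} {x : ℕ} {t t' : List ℕ}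
    (h : Follows hl st x t t') : ∃ c : ℕ, (∀ k < c, t'[k]? = t[k]?) ∧
      (∀ k a : ℕ, c ≤ k → t'[k]? = some a → a = x + 1) ∧ ∀ k a : ℕ, c ≤ k → t[k]? = some a → hl a = hl x := by
  obtain ⟨c, l, hc, rfl, h1, -, -⟩ := h
  refine ⟨c, fun k hk => ?_, fun k a hk ha => ?_, fun k a hk ha => h1 a ?_⟩
  · rw [List.getElem?_append_left (by simp; omega), List.getElem?_take_of_lt hk]
  · rw [List.getElem?_append_right (by simp; omega)] at ha
    exact List.eq_of_mem_replicate (List.mem_of_getElem? ha)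
  · refine List.mem_of_getElem? (i := k - c) ?_
    rw [List.getElem?_drop, Nat.add_sub_cancel' hk, ha]

namespace IsRun

variable {lam : List Step} {τ : ℕ → List ℕ}

theorem isStack (h : IsRun lam τ) {x : ℕ} (hx : x ≤ lam.length) : IsStack (height lam) x (τ x) := by
  induction x with
  | zero => rw [h.zero]; exact ⟨List.Pairwise.nil, by simp⟩
  | succ x ih => exact (h.follows x hx).isStack (ih (by omega)) (height_succ lam hx)

theorem le (h : IsRun lam τ) {x k a : ℕ} (hx : x ≤ lam.length) (ha : (τ x)[k]? = some a) :
    1 ≤ a ∧ a ≤ x ∧ height lam a ≤ height lam x :=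
  (h.isStack hx).le a (List.mem_of_getElem? ha)

theorem pred (h : IsRun lam τ) {x k a : ℕ} (hx : x < lam.length) (ha : (τ (x + 1))[k]? = some a) (hax : a ≤ x) :
    (τ x)[k]? = some a ∧ ∀ k' < k, (τ (x + 1))[k']? = (τ x)[k']? := by
  obtain ⟨c, h1, h2, -⟩ := (h.follows x hx).exists_getElem?
  have hk : k < c := by
    by_contra hk
    have := h2 k a (by omega) ha
    omega
  exact ⟨by rw [← h1 k hk, ha], fun k' hk' => h1 k' (by omega)⟩

theorem height_eq (h : IsRun lam τ) {x k a : ℕ} (hx : x < lam.length) (ha : (τ x)[k]? = some a)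
    (ha' : (τ (x + 1))[k]? ≠ some a) : height lam a = height lam x := by
  obtain ⟨c, h1, -, h3⟩ := (h.follows x hx).exists_getElem?
  refine h3 k a ?_ ha
  by_contra hk
  exact ha' (by rw [h1 k (by omega), ha])

/-- While a tile is open, nothing beneath it can end or start. This is cover-inclusiveness in terms
of stacks. -/
theorem back (h : IsRun lam τ) {x k a y : ℕ} (hx : x ≤ lam.length) (ha : (τ x)[k]? = some a) (hay : a ≤ y)
    (hyx : y ≤ x) : (τ y)[k]? = some a ∧ ∀ k' < k, (τ y)[k']? = (τ x)[k']? := by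
  induction x with
  | zero => obtain rfl : y = 0 := by omega
            exact ⟨ha, fun _ _ => rfl⟩
  | succ x ih =>
    rcases Nat.lt_or_ge x y with h1 | h1
    · obtain rfl : y = x + 1 := by omega
      exact ⟨ha, fun _ _ => rfl⟩
    · obtain ⟨h2, h3⟩ := h.pred hx ha (by omega)
      obtain ⟨h4, h5⟩ := ih (by omega) h2 h1
      exact ⟨h4, fun k' hk' => by rw [h5 k' hk', h3 k' hk']⟩

end IsRun

/-- The last column of the tile of level `k` that starts at column `a`. -/
def tileEnd (N : ℕ) (τ : ℕ → List ℕ) (k a : ℕ) : ℕ :=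
  Nat.findGreatest (fun y => (τ y)[k]? = some a) N

namespace IsRun

variable {lam : List Step} {τ : ℕ → List ℕ}

theorem getElem?_iff (h : IsRun lam τ) {k a y : ℕ} (ha : a ≤ lam.length) (hk : (τ a)[k]? = some a)
    (hy : y ≤ lam.length) : (τ y)[k]? = some a ↔ a ≤ y ∧ y ≤ tileEnd lam.length τ k a := by
  constructor
  · intro h1
    exact ⟨(h.le hy h1).2.1, Nat.le_findGreatest (P := fun y => (τ y)[k]? = some a) hy h1⟩
  · rintro ⟨h1, h2⟩
    exact (h.back (Nat.findGreatest_le _)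
      (Nat.findGreatest_spec (P := fun y => (τ y)[k]? = some a) ha hk) h1 h2).1

theorem le_tileEnd (h : IsRun lam τ) {k a : ℕ} (ha : a ≤ lam.length) (hk : (τ a)[k]? = some a) :
    a ≤ tileEnd lam.length τ k a := ((h.getElem?_iff ha hk ha).1 hk).2

theorem height_le (h : IsRun lam τ) {k a y : ℕ} (ha : a ≤ lam.length) (hk : (τ a)[k]? = some a) (h1 : a ≤ y)
    (h2 : y ≤ tileEnd lam.length τ k a) : height lam a ≤ height lam y := by
  have hy : y ≤ lam.length := h2.trans (Nat.findGreatest_le _)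
  exact (h.le hy ((h.getElem?_iff ha hk hy).2 ⟨h1, h2⟩)).2.2

theorem height_tileEnd (h : IsRun lam τ) {k a : ℕ} (ha : a ≤ lam.length) (hk : (τ a)[k]? = some a)
    (hlt : tileEnd lam.length τ k a < lam.length) :
    height lam a = height lam (tileEnd lam.length τ k a) := by
  refine h.height_eq hlt ((h.getElem?_iff ha hk hlt.le).2 ⟨h.le_tileEnd ha hk, le_rfl⟩) fun h1 => ?_
  have := ((h.getElem?_iff ha hk hlt).1 h1).2
  omega

end IsRun

/-! ### The tiling of a run -/

theorem sum_map_eq_sum_range {N : ℕ} (g : ℕ → ℕ) : ∀ {t : List ℕ} {K : ℕ},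
    (∀ a ∈ t, 1 ≤ a ∧ a ≤ N) → t.length ≤ K → (t.map g).sum =
      ∑ k ∈ Finset.range K, ∑ a ∈ Finset.Icc 1 N, if t[k]? = some a then g a else 0
  | [], K, _, _ => by simp
  | a :: t, 0, _, h => by simp at h
  | a :: t, K + 1, ha, h => by
    have h1 := ha a (by simp)
    rw [List.map_cons, List.sum_cons, Finset.sum_range_succ',
      sum_map_eq_sum_range g (fun b hb => ha b (by simp [hb])) (by simpa using h), add_comm]
    simp [h1]

theorem count_eq_card (a : ℕ) : ∀ {t : List ℕ} {K : ℕ}, t.length ≤ K →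
    t.count a = ((Finset.range K).filter fun k => t[k]? = some a).card
  | [], K, _ => by simp
  | b :: t, 0, h => by simp at h
  | b :: t, K + 1, h => by
    rw [Finset.card_filter, Finset.sum_range_succ', List.count_cons,
      count_eq_card a (t := t) (K := K) (by simpa using h), Finset.card_filter]
    simp

/-- The pairs `(k, a)` such that a tile of level `k` starts at column `a`. -/
def starts (N : ℕ) (τ : ℕ → List ℕ) : Finset (ℕ × ℕ) :=
  (Finset.range (N + 1) ×ˢ Finset.Icc 1 N).filter fun p => (τ p.2)[p.1]? = some p.2

/-- The tile of level `p.1` that starts at column `p.2`. -/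
def runTile (lam : List Step) (τ : ℕ → List ℕ) (p : ℕ × ℕ) : Finset (ℕ × ℤ) :=
  seg (height lam) p.1 p.2 (tileEnd lam.length τ p.1 p.2)

theorem exists_size (lam : List Step) {a b : ℕ} (hab : a ≤ b) (hb : b ≤ lam.length) :
    ∃ n : ℕ, (b : ℤ) = a + 2 * n + (height lam b - height lam a) ∧
      (lam.take b).count .D = (lam.take a).count .D + n := by
  have h : (lam.take a).count .D ≤ (lam.take b).count .D :=
    (List.take_sublist_take_left hab).count_le _
  have h1 := height_eq lam hb
  have h2 := height_eq lam (hab.trans hb)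
  obtain ⟨n, hn⟩ := Nat.exists_eq_add_of_le h
  refine ⟨n, ?_, hn⟩
  rw [hn] at h1
  push_cast at h1
  omega

/-- The contribution of the box in column `x` of a tile starting at column `a`. -/
def boxCost (lam : List Step) (x a : ℕ) : ℕ :=
  if lam.getD (x - 1) .U = .D ∨ a = x then 1 else 0

/-- The first box counts one whatever the step into it, and each later box counts one if it is
entered by a `D`. The total is `n + 1`, the art of a Dyck tile. -/
theorem sum_boxCost (lam : List Step) {a b : ℕ} (hab : a ≤ b) (hb : b ≤ lam.length) :
    ∑ x ∈ Finset.Icc a b, boxCost lam x a + (lam.take a).count .D = (lam.take b).count .D + 1 := by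
  induction b, hab using Nat.le_induction with
  | base => rw [Finset.Icc_self, Finset.sum_singleton]; simp [boxCost, add_comm]
  | succ b hab ih =>
    rw [Finset.sum_Icc_succ_top (by omega), count_take_succ lam hb]
    have := ih (by omega)
    have h1 : boxCost lam (b + 1) a = if lam.getD b .U = .D then 1 else 0 := by
      simp [boxCost, show a ≠ b + 1 by omega]
    omega

/-- The contribution of the last column to the statistic of a tile starting at column `a`. -/
def endCost (lam : List Step) (a : ℕ) : ℕ :=
  ((height lam lam.length - height lam a - 1) / 2).toNat

/-- The stack at the last column has no ballot tiles of forbidden length. -/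
def NoEven (lam : List Step) (t : List ℕ) : Prop :=
  ∀ a ∈ t, ¬ (Even (height lam lam.length - height lam a) ∧
    0 < height lam lam.length - height lam a)

namespace IsRun

variable {lam : List Step} {τ : ℕ → List ℕ}

theorem length_le (h : IsRun lam τ) {x : ℕ} (hx : x ≤ lam.length) : (τ x).length ≤ x := by
  induction x with
  | zero => simp [h.zero]
  | succ x ih =>
    have := ih (by omega)
    obtain ⟨c, l, -, -, -, -, h1⟩ := h.follows x hx
    omega

theorem mem_starts (h : IsRun lam τ) {k a : ℕ} :
    (k, a) ∈ starts lam.length τ ↔ a ≤ lam.length ∧ (τ a)[k]? = some a := by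
  simp only [starts, Finset.mem_filter, Finset.mem_product, Finset.mem_range, Finset.mem_Icc]
  constructor
  · rintro ⟨⟨-, -, h1⟩, h2⟩
    exact ⟨h1, h2⟩
  · rintro ⟨h1, h2⟩
    have h3 := (List.getElem?_eq_some_iff.1 h2).1
    have h4 := h.length_le h1
    exact ⟨⟨by omega, (h.le h1 h2).1, h1⟩, h2⟩

theorem mem_starts_of_getElem? (h : IsRun lam τ) {k a x : ℕ} (hx : x ≤ lam.length)
    (ha : (τ x)[k]? = some a) : (k, a) ∈ starts lam.length τ := by
  have h1 := (h.le hx ha).2.1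
  exact h.mem_starts.2 ⟨h1.trans hx, (h.back hx ha le_rfl h1).1⟩

theorem isBallotTile_runTile (h : IsRun lam τ) {k a n n' : ℕ} (hp : (k, a) ∈ starts lam.length τ) :
    IsBallotTile n n' (runTile lam τ (k, a)) ↔
      height lam (tileEnd lam.length τ k a) - height lam a = n' ∧
        tileEnd lam.length τ k a = a + (2 * n + n') := by
  obtain ⟨h1, h2⟩ := h.mem_starts.1 hp
  rw [runTile, isBallotTile_seg (h.le_tileEnd h1 h2) (Nat.findGreatest_le _)]
  exact and_iff_right fun x hx hx' => h.height_le h1 h2 hx hx'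

theorem tileEnd_eq_iff (h : IsRun lam τ) {k a : ℕ} (hp : (k, a) ∈ starts lam.length τ) :
    tileEnd lam.length τ k a = lam.length ↔ (τ lam.length)[k]? = some a := by
  obtain ⟨h1, h2⟩ := h.mem_starts.1 hp
  rw [h.getElem?_iff h1 h2 le_rfl]
  have : tileEnd lam.length τ k a ≤ lam.length := Nat.findGreatest_le _
  omega

theorem tileEnd_eq_of_tile (h : IsRun lam τ) {k a n n' : ℕ} (hp : (k, a) ∈ starts lam.length τ)
    (ht : IsBallotTile n n' (runTile lam τ (k, a))) (hn : 0 < n') :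
    tileEnd lam.length τ k a = lam.length := by
  obtain ⟨h1, h2⟩ := h.mem_starts.1 hp
  obtain ⟨h3, -⟩ := (h.isBallotTile_runTile hp).1 ht
  by_contra hne
  have : tileEnd lam.length τ k a ≤ lam.length := Nat.findGreatest_le _
  have := h.height_tileEnd h1 h2 (by omega)
  omega

theorem tileArt_runTile (h : IsRun lam τ) {k a : ℕ} (hp : (k, a) ∈ starts lam.length τ)
    (hne : NoEven lam (τ lam.length)) : tileArt (runTile lam τ (k, a)) =
      ∑ x ∈ Finset.Icc a (tileEnd lam.length τ k a), boxCost lam x a +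
        if (τ lam.length)[k]? = some a then endCost lam a else 0 := by
  obtain ⟨h1, h2⟩ := h.mem_starts.1 hp
  have hle := h.le_tileEnd h1 h2
  have hend : tileEnd lam.length τ k a ≤ lam.length := Nat.findGreatest_le _
  obtain ⟨n, hn, hc⟩ := exists_size lam hle hend
  have hsum := sum_boxCost lam hle hend
  have hcard : (runTile lam τ (k, a)).card = tileEnd lam.length τ k a + 1 - a := card_seg _ _ _ _
  have hhe := h.height_le h1 h2 hle le_rfl
  rw [tileArt, hcard]
  have hN := h.tileEnd_eq_iff hp
  by_cases h0 : height lam (tileEnd lam.length τ k a) = height lam a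
  · have hd : ∃ n, IsBallotTile n 0 (runTile lam τ (k, a)) :=
      ⟨n, (h.isBallotTile_runTile hp).2 ⟨by simp [h0], by omega⟩⟩
    -- A Dyck tile that reaches the last column has no end cost: `(0 - 1) / 2` is negative and
    -- `toNat` makes it `0`.
    have he : (if (τ lam.length)[k]? = some a then endCost lam a else 0) = 0 := by
      split_ifs with h3
      · rw [← hN] at h3
        rw [endCost, ← h3, h0]
        simp
      · rfl
    rw [if_pos hd, he]
    omega
  · have hd : ¬ ∃ n, IsBallotTile n 0 (runTile lam τ (k, a)) := by
      rintro ⟨n, hn⟩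
      have := ((h.isBallotTile_runTile hp).1 hn).1
      push_cast at this
      omega
    have hb : tileEnd lam.length τ k a = lam.length := by
      by_contra hne
      exact h0 (h.height_tileEnd h1 h2 (by omega)).symm
    have hmem := hN.1 hb
    have hodd := hne a (List.mem_of_getElem? hmem)
    rw [if_neg hd, if_pos hmem, endCost]
    rw [hb] at hn hc hsum h0 hhe ⊢
    have hodd' : Odd (height lam lam.length - height lam a) := by
      rw [← Int.not_even_iff_odd]
      exact fun h => hodd ⟨h, by omega⟩
    obtain ⟨r, hr⟩ := hodd'
    rw [hr]
    omega

/-- The total statistic of the tiles of a run. -/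
theorem sum_tileArt (h : IsRun lam τ) (hne : NoEven lam (τ lam.length)) :
    ∑ p ∈ starts lam.length τ, tileArt (runTile lam τ p) =
      ∑ i ∈ Finset.range lam.length, stepCost (lam.getD i .U) (i + 1) (τ (i + 1)) +
        ((τ lam.length).map (endCost lam)).sum := by
  have hbd : ∀ x ≤ lam.length, ∀ a ∈ τ x, 1 ≤ a ∧ a ≤ lam.length := by
    intro x hx a ha
    have := (h.isStack hx).le a ha
    exact ⟨this.1, by omega⟩
  have hlen : ∀ x ≤ lam.length, (τ x).length ≤ lam.length + 1 := by
    intro x hx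
    have := h.length_le hx
    omega
  have h1 : ∑ i ∈ Finset.range lam.length, stepCost (lam.getD i .U) (i + 1) (τ (i + 1)) =
      ∑ x ∈ Finset.Icc 1 lam.length, ∑ k ∈ Finset.range (lam.length + 1),
        ∑ a ∈ Finset.Icc 1 lam.length, if (τ x)[k]? = some a then boxCost lam x a else 0 := by
    have h2 := Finset.sum_Ico_add' (fun x => stepCost (lam.getD (x - 1) .U) x (τ x)) 0 lam.length 1
    simp only [Nat.add_sub_cancel, zero_add] at h2
    rw [Finset.range_eq_Ico, h2, ← Finset.Ico_add_one_right_eq_Icc]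
    refine Finset.sum_congr rfl fun x hx => ?_
    have hx' : x ≤ lam.length := by simp at hx; omega
    exact sum_map_eq_sum_range (boxCost lam x) (hbd x hx') (hlen x hx')
  rw [h1, sum_map_eq_sum_range (endCost lam) (hbd _ le_rfl) (hlen _ le_rfl), Finset.sum_comm,
    ← Finset.sum_add_distrib, starts, Finset.sum_filter, Finset.sum_product]
  refine Finset.sum_congr rfl fun k _ => ?_
  rw [Finset.sum_comm, ← Finset.sum_add_distrib]
  refine Finset.sum_congr rfl fun a ha => ?_
  rw [Finset.mem_Icc] at ha
  by_cases h2 : (τ a)[k]? = some a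
  · rw [if_pos h2, h.tileArt_runTile (h.mem_starts.2 ⟨ha.2, h2⟩) hne, ← Finset.sum_filter]
    congr 1
    refine Finset.sum_congr (Finset.ext fun x => ?_) fun _ _ => rfl
    have hend : tileEnd lam.length τ k a ≤ lam.length := Nat.findGreatest_le _
    simp only [Finset.mem_filter, Finset.mem_Icc]
    constructor
    · intro hx
      exact ⟨by omega, (h.getElem?_iff ha.2 h2 (by omega)).2 hx⟩
    · rintro ⟨hx, hx'⟩
      exact (h.getElem?_iff ha.2 h2 hx.2).1 hx'
  · have h3 : ∀ x ≤ lam.length, (τ x)[k]? ≠ some a := fun x hx hx' =>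
      h2 (h.mem_starts.1 (h.mem_starts_of_getElem? hx hx')).2
    rw [if_neg h2, if_neg (h3 _ le_rfl),
      Finset.sum_eq_zero fun x hx => if_neg (h3 x (Finset.mem_Icc.1 hx).2), add_zero]

theorem runTile_inj (h : IsRun lam τ) {p p' : ℕ × ℕ} (hp : p ∈ starts lam.length τ)
    (hp' : p' ∈ starts lam.length τ) (he : runTile lam τ p = runTile lam τ p') : p = p' := by
  have h1 := h.mem_starts.1 hp
  have h2 := h.mem_starts.1 hp'
  have := seg_inj (h.le_tileEnd h1.1 h1.2) (h.le_tileEnd h2.1 h2.2) he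
  exact Prod.ext this.1 this.2.1

-- Tiles of positive height end in the last column, so their length determines the first column.
-- Counting by length is thus counting occurrences in the last stack.
open Classical in
theorem card_tiles (h : IsRun lam τ) {a n n' : ℕ} (hn : 0 < n')
    (h1 : height lam lam.length - height lam a = n') (h2 : lam.length = a + (2 * n + n')) :
    ((starts lam.length τ).filter fun p => IsBallotTile n n' (runTile lam τ p)).card =
      (τ lam.length).count a := by
  rw [count_eq_card a (K := lam.length + 1) ((h.length_le le_rfl).trans (by omega))]
  refine (Finset.card_bij (fun k _ => (k, a)) ?_ ?_ ?_).symm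
  · intro k hk
    rw [Finset.mem_filter] at hk
    have hp := h.mem_starts_of_getElem? le_rfl hk.2
    have he := (h.tileEnd_eq_iff hp).2 hk.2
    rw [Finset.mem_filter, h.isBallotTile_runTile hp, he]
    exact ⟨hp, h1, h2⟩
  · intro k _ k' _ he
    exact (Prod.ext_iff.1 he).1
  · rintro ⟨k, b⟩ hk
    rw [Finset.mem_filter] at hk
    have he := h.tileEnd_eq_of_tile hk.1 hk.2 hn
    have h3 := (h.isBallotTile_runTile hk.1).1 hk.2
    have hmem := (h.tileEnd_eq_iff hk.1).1 he
    rw [he] at h3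
    obtain rfl : b = a := by omega
    refine ⟨k, ?_, rfl⟩
    rw [Finset.mem_filter, Finset.mem_range]
    have := (List.getElem?_eq_some_iff.1 hmem).1
    have := h.length_le le_rfl
    exact ⟨by omega, hmem⟩

open Classical in
theorem even_card_iff (h : IsRun lam τ) :
    (∀ n n', Odd n' → Even ((starts lam.length τ).filter
      fun p => IsBallotTile n n' (runTile lam τ p)).card) ↔
      ∀ a, Odd (height lam lam.length - height lam a) → Even ((τ lam.length).count a) := by
  constructor
  · intro he a ha
    by_cases hmem : a ∈ τ lam.length
    · have hle := (h.isStack le_rfl).le a hmem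
      obtain ⟨n, hn, -⟩ := exists_size lam hle.2.1 le_rfl
      obtain ⟨n', hn'⟩ := Int.eq_ofNat_of_zero_le (sub_nonneg.2 hle.2.2)
      have hodd : Odd n' := by rw [hn'] at ha; exact_mod_cast ha
      rw [← h.card_tiles hodd.pos hn' (n := n) (by omega)]
      exact he n n' hodd
    · rw [List.count_eq_zero_of_not_mem hmem]
      exact Even.zero
  · intro he n n' hodd
    rcases Finset.eq_empty_or_nonempty ((starts lam.length τ).filter
      fun p => IsBallotTile n n' (runTile lam τ p)) with h0 | ⟨⟨k, a⟩, hp⟩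
    · rw [h0]; exact Even.zero
    · rw [Finset.mem_filter] at hp
      have hb := h.tileEnd_eq_of_tile hp.1 hp.2 hodd.pos
      have h3 := (h.isBallotTile_runTile hp.1).1 hp.2
      rw [hb] at h3
      rw [h.card_tiles hodd.pos h3.1 h3.2]
      refine he a ?_
      rw [h3.1]
      exact_mod_cast hodd

theorem noEven_iff (h : IsRun lam τ) :
    (∀ n n', Even n' → 0 < n' → ∀ p ∈ starts lam.length τ, ¬ IsBallotTile n n' (runTile lam τ p)) ↔
      NoEven lam (τ lam.length) := by
  constructor
  · rintro he a hmem ⟨h1, h2⟩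
    have hle := (h.isStack le_rfl).le a hmem
    obtain ⟨n, hn, -⟩ := exists_size lam hle.2.1 le_rfl
    obtain ⟨n', hn'⟩ := Int.eq_ofNat_of_zero_le h2.le
    obtain ⟨k, hk⟩ := List.mem_iff_getElem?.1 hmem
    have hp := h.mem_starts_of_getElem? le_rfl hk
    rw [hn'] at h1 h2
    refine he n n' (by exact_mod_cast h1) (by exact_mod_cast h2) _ hp ?_
    rw [h.isBallotTile_runTile hp, (h.tileEnd_eq_iff hp).2 hk]
    exact ⟨hn', by omega⟩
  · rintro he n n' h1 h2 ⟨k, a⟩ hp ht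
    have hb := h.tileEnd_eq_of_tile hp ht h2
    have h3 := ((h.isBallotTile_runTile hp).1 ht).1
    rw [hb] at h3
    refine he a (List.mem_of_getElem? ((h.tileEnd_eq_iff hp).1 hb)) ?_
    rw [h3]
    exact ⟨by exact_mod_cast h1, by exact_mod_cast h2⟩

open Classical in
theorem finalWeight_eq (q : ℝ) (s : List ℕ) :
    finalWeight q (height lam) ∅ lam.length s.reverse =
      if NoEven lam s ∧ ∀ a, Odd (height lam lam.length - height lam a) → Even (s.count a) then
        q ^ (s.map (endCost lam)).sum else 0 := by
  rw [finalWeight]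
  refine if_congr ?_ ?_ rfl
  · simp only [NoEven, List.mem_reverse, List.count_reverse, Finset.notMem_empty,
      not_false_eq_true, iff_true]
  · rw [List.map_reverse, List.sum_reverse]
    rfl

end IsRun

/-! ### Tilings and runs -/

/-- The stacks `τ` record the tiles of the tiling `B` below the path `mu`. -/
structure Records (lam mu : List Step) (B : Finpartition (skewShape lam mu)) (τ : ℕ → List ℕ) :
    Prop where
  height : ∀ x ≤ lam.length, height mu x = height lam x + 2 * (τ x).length
  parts : B.parts = (starts lam.length τ).image (runTile lam τ)

namespace Records

variable {lam mu : List Step} {B : Finpartition (skewShape lam mu)} {τ : ℕ → List ℕ}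

theorem art_eq (hr : Records lam mu B τ) (h : IsRun lam τ) (hne : NoEven lam (τ lam.length)) :
    art B = ∑ i ∈ Finset.range lam.length, stepCost (lam.getD i .U) (i + 1) (τ (i + 1)) +
      ((τ lam.length).map (endCost lam)).sum := by
  rw [art, hr.parts, Finset.sum_image fun p hp p' hp' => h.runTile_inj hp hp', h.sum_tileArt hne]

-- Tiles of a run are ballot tiles, anchored and cover-inclusive automatically; only the two parity
-- conditions remain, and these concern the last stack.
open Classical in
theorem isTypeBI_iff (hr : Records lam mu B τ) (h : IsRun lam τ) :
    IsTypeBI B ↔ NoEven lam (τ lam.length) ∧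
      ∀ a, Odd (BallotBI.height lam lam.length - BallotBI.height lam a) →
        Even ((τ lam.length).count a) := by
  have hcard : ∀ n n', (B.parts.filter (IsBallotTile n n')).card =
      ((starts lam.length τ).filter fun p => IsBallotTile n n' (runTile lam τ p)).card := by
    intro n n'
    rw [hr.parts, Finset.filter_image, Finset.card_image_of_injOn]
    intro p hp p' hp' he
    exact h.runTile_inj (Finset.mem_filter.1 hp).1 (Finset.mem_filter.1 hp').1 he
  have hmem : ∀ {P : Finset (ℕ × ℤ) → Prop}, (∀ t ∈ B.parts, P t) ↔
      ∀ p ∈ starts lam.length τ, P (runTile lam τ p) := by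
    intro P
    rw [hr.parts, Finset.forall_mem_image]
  rw [← h.even_card_iff, ← h.noEven_iff]
  constructor
  · intro hB
    refine ⟨fun n n' h1 h2 => hmem.1 (hB.none_of_even n n' h1 h2), fun n n' hn => ?_⟩
    rw [← hcard]
    convert hB.even_of_odd n n' hn
  · rintro ⟨h1, h2⟩
    refine ⟨hmem.2 ?_, hmem.2 ?_, hmem.2 ?_, fun n n' hn => ?_, fun n n' hn hn' =>
      hmem.2 (h1 n n' hn hn')⟩
    · rintro ⟨k, a⟩ hp
      obtain ⟨h3, h4⟩ := h.mem_starts.1 hp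
      have hle := h.le_tileEnd h3 h4
      have hend : tileEnd lam.length τ k a ≤ lam.length := Nat.findGreatest_le _
      obtain ⟨n, hn, -⟩ := exists_size lam hle hend
      obtain ⟨n', hn'⟩ := Int.eq_ofNat_of_zero_le (sub_nonneg.2 (h.height_le h3 h4 hle le_rfl))
      exact ⟨n, n', (h.isBallotTile_runTile hp).2 ⟨hn', by omega⟩⟩
    · rintro ⟨k, a⟩ hp n n' ht hn
      obtain ⟨h3, h4⟩ := h.mem_starts.1 hp
      have he := h.tileEnd_eq_of_tile hp ht hn
      exact ⟨box (BallotBI.height lam) k lam.length,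
        box_mem_seg.2 ⟨rfl, h3, he.ge⟩, rfl⟩
    · rintro ⟨k, a⟩ hp
      obtain ⟨h3, h4⟩ := h.mem_starts.1 hp
      cases k with
      | zero =>
        left
        intro b hb
        obtain ⟨x, -, rfl⟩ := Finset.mem_image.1 hb
        simp only [box]
        push_cast
        omega
      | succ k =>
        right
        have h5 := (List.getElem?_eq_some_iff.1 h4).1
        set N := lam.length with hN
        have hend : tileEnd N τ (k + 1) a ≤ N := Nat.findGreatest_le _
        have h6 := (h.getElem?_iff h3 h4 hend).2 ⟨h.le_tileEnd h3 h4, le_rfl⟩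
        obtain ⟨a', ha'⟩ : ∃ a', (τ a)[k]? = some a' :=
          ⟨_, List.getElem?_eq_getElem (by omega)⟩
        have hp' := h.mem_starts_of_getElem? h3 ha'
        refine ⟨runTile lam τ (k, a'), by rw [hr.parts]; exact Finset.mem_image_of_mem _ hp', ?_⟩
        intro b hb
        simp only [Finset.mem_image, runTile, seg, Finset.mem_Icc, exists_exists_and_eq_and] at hb
        obtain ⟨x, hx, rfl⟩ := hb
        have hxN : x ≤ N := hx.2.trans hend
        have h7 : (τ x)[k + 1]? = some a := (h.getElem?_iff h3 h4 hxN).2 hx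
        -- The entry of level `k` is constant over all columns of the upper tile, so one tile of
        -- level `k` covers its translate.
        have h8 := (h.back hxN h7 le_rfl hx.1).2 k (by omega)
        have h9 := h.mem_starts.1 hp'
        have h10 := (h.getElem?_iff h9.1 h9.2 hxN).1 (by rw [← h8, ha'])
        have : ((box (BallotBI.height lam) (k + 1) x).1, (box (BallotBI.height lam) (k + 1) x).2 - 2) =
            box (BallotBI.height lam) k x := by
          simp only [box]; push_cast; congr 1; ring
        rw [this]
        exact box_mem_seg.2 ⟨rfl, h10⟩
    · rw [hcard]
      exact h2 n n' hn

end Records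

theorem neg_le_height (w : List Step) {i : ℕ} (hi : i ≤ w.length) :
    -(w.length : ℤ) ≤ height w i ∧ height w i ≤ w.length := by
  have h1 := height_eq w hi
  have h2 := List.count_le_length (l := w.take i) (a := Step.D)
  rw [List.length_take] at h2
  omega

/-- The boxes of the shifted skew shape, in terms of the numbers of boxes in the columns. -/
theorem mem_skewShape {lam mu : List Step} (hlen : mu.length = lam.length) {H : ℕ → ℕ}
    (hH : ∀ x ≤ lam.length, height mu x = height lam x + 2 * H x) {b : ℕ × ℤ} :
    b ∈ skewShape lam mu ↔
      ∃ x k, 1 ≤ x ∧ x ≤ lam.length ∧ k < H x ∧ b = box (height lam) k x := by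
  obtain ⟨x, y⟩ := b
  simp only [skewShape, Finset.mem_filter, Finset.mem_product, Finset.mem_Icc, box, Prod.mk.injEq]
  constructor
  · rintro ⟨⟨⟨h1, h2⟩, h3⟩, h4, h5, m, hm⟩
    have h6 := hH x h2
    exact ⟨x, m.toNat, h1, h2, by omega, rfl, by omega⟩
  · rintro ⟨x, k, h1, h2, h3, rfl, rfl⟩
    have h4 := hH x h2
    have h5 := neg_le_height lam h2
    have h6 := neg_le_height mu (hlen ▸ h2)
    exact ⟨⟨⟨h1, h2⟩, by omega, by omega⟩, by omega, by omega, k, by ring⟩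

theorem exists_word_of_height (g : ℕ → ℤ) (h0 : g 0 = 0) : ∀ {N : ℕ},
    (∀ i < N, g (i + 1) = g i + 1 ∨ g (i + 1) = g i - 1) →
      ∃ w : List Step, w.length = N ∧ ∀ i ≤ N, height w i = g i
  | 0, _ => ⟨[], rfl, fun i hi => by obtain rfl : i = 0 := by omega
                                     rw [h0]; rfl⟩
  | N + 1, h => by
    obtain ⟨w, hw, hg⟩ := exists_word_of_height g h0 (N := N) fun i hi => h i (by omega)
    have key : ∀ s : Step, g (N + 1) = g N + s.sign →
        ∃ w : List Step, w.length = N + 1 ∧ ∀ i ≤ N + 1, height w i = g i := by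
      intro s hs
      have hold : ∀ i ≤ N, height (w ++ [s]) i = g i := by
        intro i hi
        rw [← hg i hi, height, height, List.take_append_of_le_length (by omega)]
      refine ⟨w ++ [s], by simp [hw], fun i hi => ?_⟩
      rcases Nat.lt_or_ge N i with h1 | h1
      · obtain rfl : i = N + 1 := by omega
        rw [height_succ _ (by simp [hw]), hold N le_rfl, hs]
        simp [← hw]
      · exact hold i h1
    rcases h N (by omega) with h1 | h1
    · exact key .U h1
    · exact key .D h1

theorem eq_of_height_eq {w w' : List Step} (hlen : w.length = w'.length)
    (h : ∀ i ≤ w.length, height w i = height w' i) : w = w' := by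
  refine List.ext_getElem hlen fun i h1 h2 => ?_
  have h3 := height_succ w h1
  have h4 := height_succ w' h2
  rw [h _ h1, h _ (by omega), h4, List.getD_eq_getElem _ _ h1, List.getD_eq_getElem _ _ h2] at h3
  cases h5 : w[i] <;> cases h6 : w'[i] <;> simp [h5, h6, Step.sign] at h3 ⊢

theorem IsRun.box_mem_runTile {lam : List Step} {τ : ℕ → List ℕ} (h : IsRun lam τ) {k k' a x : ℕ}
    (hp : (k', a) ∈ starts lam.length τ) (hx : x ≤ lam.length) :
    box (height lam) k x ∈ runTile lam τ (k', a) ↔ k = k' ∧ (τ x)[k]? = some a := by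
  obtain ⟨h1, h2⟩ := h.mem_starts.1 hp
  rw [runTile, box_mem_seg, and_congr_right_iff]
  rintro rfl
  exact (h.getElem?_iff h1 h2 hx).symm

theorem isAbove_of_height {lam mu : List Step} (hlen : mu.length = lam.length)
    (h : ∀ x ≤ lam.length, height lam x ≤ height mu x) : IsAbove mu lam := by
  refine ⟨hlen, fun i => ?_⟩
  rcases le_total i lam.length with hi | hi
  · exact h i hi
  · rw [height_of_length_le lam hi, height_of_length_le mu (hlen ▸ hi), hlen]
    exact h _ le_rfl

/-- Every run comes from a tiling. -/
theorem IsRun.exists_records {lam : List Step} {τ : ℕ → List ℕ} (h : IsRun lam τ) :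
    ∃ (mu : List Step) (B : Finpartition (skewShape lam mu)), IsAbove mu lam ∧
      Records lam mu B τ := by
  obtain ⟨mu, hlen, hmu⟩ := exists_word_of_height
    (fun x => height lam x + 2 * (τ x).length) (by simp [h.zero, height]) (N := lam.length) (by
      intro i hi
      have h1 := height_succ lam hi
      obtain ⟨-, -, -, -, -, -, h2⟩ := h.follows i hi
      rcases h2 with h2 | ⟨h3, h2⟩ | ⟨h3, h2⟩
      · rw [h1, h2]
        cases lam.getD i .U <;> simp [Step.sign] <;> omega
      · rw [h3] at h1
        simp only [Step.sign] at h1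
        right; omega
      · rw [h3] at h1
        simp only [Step.sign] at h1
        left; omega)
  have hmem := fun b => mem_skewShape hlen hmu (b := b)
  refine ⟨mu, Finpartition.ofExistsUnique ((starts lam.length τ).image (runTile lam τ)) ?_ ?_ ?_,
    isAbove_of_height hlen fun x hx => ?_, hmu, rfl⟩
  · rw [Finset.forall_mem_image]
    rintro ⟨k, a⟩ hp b hb
    obtain ⟨h1, h2⟩ := h.mem_starts.1 hp
    obtain ⟨x, hx, rfl⟩ := Finset.mem_image.1 hb
    rw [Finset.mem_Icc] at hx
    have hxN : x ≤ lam.length := hx.2.trans (Nat.findGreatest_le _)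
    have h3 := ((h.box_mem_runTile hp hxN).1 hb).2
    have h4 := h.le hxN h3
    exact (hmem _).2 ⟨x, k, by omega, hxN, (List.getElem?_eq_some_iff.1 h3).1, rfl⟩
  · intro b hb
    obtain ⟨x, k, h1, h2, h3, rfl⟩ := (hmem b).1 hb
    have h4 : (τ x)[k]? = some (τ x)[k] := List.getElem?_eq_getElem h3
    have hp := h.mem_starts_of_getElem? h2 h4
    refine ⟨runTile lam τ (k, (τ x)[k]), ⟨Finset.mem_image_of_mem _ hp,
      (h.box_mem_runTile hp h2).2 ⟨rfl, h4⟩⟩, ?_⟩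
    rintro t ⟨ht, hb'⟩
    obtain ⟨⟨k', a⟩, hp', rfl⟩ := Finset.mem_image.1 ht
    obtain ⟨rfl, h5⟩ := (h.box_mem_runTile hp' h2).1 hb'
    rw [h4, Option.some.injEq] at h5
    rw [h5]
  · rw [Finset.mem_image]
    rintro ⟨⟨k, a⟩, hp, he⟩
    obtain ⟨h1, h2⟩ := h.mem_starts.1 hp
    have := (h.box_mem_runTile hp h1).2 ⟨rfl, h2⟩
    rw [he] at this
    simp at this
  · have := hmu x hx
    omega

/-- The entry of level `k` at column `x` is the first column of the tile that contains this box,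
hence determined by the tiling. -/
theorem Records.unique_run {lam mu : List Step} {B : Finpartition (skewShape lam mu)}
    {τ τ' : ℕ → List ℕ} (hr : Records lam mu B τ) (hr' : Records lam mu B τ') (h : IsRun lam τ)
    (h' : IsRun lam τ') {x : ℕ} (hx : x ≤ lam.length) : τ x = τ' x := by
  have hlen : (τ x).length = (τ' x).length := by
    have h1 := hr.height x hx
    have h2 := hr'.height x hx
    omega
  refine List.ext_getElem hlen fun k h1 h2 => ?_
  have h3 : (τ x)[k]? = some (τ x)[k] := List.getElem?_eq_getElem h1
  have h4 : (τ' x)[k]? = some (τ' x)[k] := List.getElem?_eq_getElem h2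
  have hp := h.mem_starts_of_getElem? hx h3
  have hp' := h'.mem_starts_of_getElem? hx h4
  have he : runTile lam τ (k, (τ x)[k]) = runTile lam τ' (k, (τ' x)[k]) :=
    B.eq_of_mem_parts (by rw [hr.parts]; exact Finset.mem_image_of_mem _ hp)
      (by rw [hr'.parts]; exact Finset.mem_image_of_mem _ hp')
      ((h.box_mem_runTile hp hx).2 ⟨rfl, h3⟩) ((h'.box_mem_runTile hp' hx).2 ⟨rfl, h4⟩)
  have h5 := h.mem_starts.1 hp
  have h6 := h'.mem_starts.1 hp'
  exact (seg_inj (h.le_tileEnd h5.1 h5.2) (h'.le_tileEnd h6.1 h6.2) he).2.1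

section

variable {lam mu : List Step} {B : Finpartition (skewShape lam mu)} {H : ℕ → ℕ}

theorem box_inj {hl : ℕ → ℤ} {k k' x x' : ℕ} (h : box hl k x = box hl k' x') :
    x = x' ∧ k = k' := by
  simp only [box, Prod.mk.injEq] at h
  obtain ⟨rfl, h⟩ := h
  exact ⟨rfl, by omega⟩

/-- All boxes of a tile have the same level. -/
theorem IsTypeBI.level (hB : IsTypeBI B)
    (hH : ∀ b, b ∈ skewShape lam mu ↔
      ∃ x k, 1 ≤ x ∧ x ≤ lam.length ∧ k < H x ∧ b = box (height lam) k x) :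
    ∀ (k x : ℕ), ∀ t ∈ B.parts, box (height lam) k x ∈ t → ∀ b ∈ t, ∃ x', b = box (height lam) k x' := by
  intro k
  induction k with
  | zero =>
    intro x t ht hx b hb
    rcases hB.coverInclusive t ht with h1 | ⟨t', ht', h1⟩
    · obtain ⟨x', k', -, -, -, rfl⟩ := (hH b).1 (B.le ht hb)
      have := h1 _ hb
      simp only [box] at this
      obtain rfl : k' = 0 := by omega
      exact ⟨x', rfl⟩
    · exfalso
      have h2 := h1 (Finset.mem_image_of_mem _ hx)
      obtain ⟨x', k', -, -, -, h3⟩ := (hH _).1 (B.le ht' h2)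
      simp only [box, Prod.mk.injEq] at h3
      obtain ⟨rfl, h3⟩ := h3
      omega
  | succ k ih =>
    intro x t ht hx b hb
    rcases hB.coverInclusive t ht with h1 | ⟨t', ht', h1⟩
    · exfalso
      have := h1 _ hx
      simp only [box] at this
      omega
    -- The tile beneath contains the translate, and by induction all its boxes have level `k`.
    · have h2 := h1 (Finset.mem_image_of_mem _ hx)
      have h3 : box (height lam) k x ∈ t' := by
        convert h2 using 1
        simp only [box]; push_cast; congr 1; ring
      obtain ⟨x', k', -, -, -, rfl⟩ := (hH b).1 (B.le ht hb)
      obtain ⟨x'', h4⟩ := ih x t' ht' h3 _ (h1 (Finset.mem_image_of_mem _ hb))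
      simp only [box, Prod.mk.injEq] at h4
      obtain ⟨rfl, h4⟩ := h4
      obtain rfl : k' = k + 1 := by omega
      exact ⟨x', rfl⟩

/-- Every tile is a segment of boxes of one level. -/
theorem IsTypeBI.exists_seg (hB : IsTypeBI B)
    (hH : ∀ b, b ∈ skewShape lam mu ↔
      ∃ x k, 1 ≤ x ∧ x ≤ lam.length ∧ k < H x ∧ b = box (height lam) k x)
    {t : Finset (ℕ × ℤ)} (ht : t ∈ B.parts) {k x : ℕ} (hx : box (height lam) k x ∈ t) :
    ∃ a b, t = seg (height lam) k a b ∧ 1 ≤ a ∧ a ≤ x ∧ x ≤ b ∧ b ≤ lam.length ∧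
      (∀ y, a ≤ y → y ≤ b → height lam a ≤ height lam y) ∧
      (b = lam.length ∨ height lam a = height lam b) := by
  obtain ⟨n, n', htile⟩ := hB.tile t ht
  obtain ⟨p, w, hw, hD, hU, he⟩ := id htile
  have hlev := hB.level hH k x t ht hx
  have hseg : t = seg (height lam) k p.1 (p.1 + w.length) := by
    rw [he]
    refine ribbon_eq_seg fun i hi => ?_
    obtain ⟨x', hx'⟩ := hlev (p.1 + i, p.2 + height w i) (by
      rw [he]; exact Finset.mem_image_of_mem _ (Finset.mem_range.2 (by omega)))
    simp only [box, Prod.mk.injEq] at hx'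
    rw [hx'.2, hx'.1]
  have hin : ∀ y, p.1 ≤ y → y ≤ p.1 + w.length → 1 ≤ y ∧ y ≤ lam.length := by
    intro y h1 h2
    have h3 : box (height lam) k y ∈ t := by rw [hseg]; exact box_mem_seg.2 ⟨rfl, h1, h2⟩
    obtain ⟨x', k', h4, h5, -, h6⟩ := (hH _).1 (B.le ht h3)
    obtain ⟨rfl, -⟩ := box_inj h6
    exact ⟨h4, h5⟩
  have hend := hin (p.1 + w.length) (by omega) le_rfl
  have hstart := hin p.1 le_rfl (by omega)
  obtain ⟨-, hx1, hx2⟩ := box_mem_seg.1 (hseg ▸ hx)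
  obtain ⟨h1, h2, h3⟩ := (isBallotTile_seg (k := k) (n := n) (n' := n')
    (show p.1 ≤ p.1 + w.length by omega) hend.2).1 (hseg ▸ htile)
  refine ⟨p.1, p.1 + w.length, hseg, hstart.1, hx1, hx2, hend.2, h1, ?_⟩
  rcases Nat.eq_zero_or_pos n' with h0 | h0
  · right
    rw [h0] at h2
    push_cast at h2
    omega
  · left
    obtain ⟨b, hb, hbN⟩ := hB.anchored t ht n n' htile h0
    rw [hseg] at hb
    obtain ⟨y, hy, rfl⟩ := Finset.mem_image.1 hb
    rw [Finset.mem_Icc] at hy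
    simp only [box] at hbN
    omega

/-- Every tiling is recorded by a run. -/
theorem IsTypeBI.exists_run (hB : IsTypeBI B) (hab : IsAbove mu lam) :
    ∃ τ, IsRun lam τ ∧ (∀ x, lam.length < x → τ x = []) ∧ Records lam mu B τ := by
  obtain ⟨H, hH0, hHN, hHmu⟩ : ∃ H : ℕ → ℕ, H 0 = 0 ∧ (∀ x, lam.length < x → H x = 0) ∧
      ∀ x ≤ lam.length, height mu x = height lam x + 2 * H x := by
    refine ⟨fun x => if x ≤ lam.length then ((height mu x - height lam x) / 2).toNat else 0,
      by simp [height], fun x hx => if_neg (by omega), fun x hx => ?_⟩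
    have h1 := height_eq lam hx
    have h2 := height_eq mu (hab.1.symm ▸ hx)
    have h3 := hab.2 x
    simp only [hx, if_true]
    omega
  have hH := fun b => mem_skewShape hab.1 hHmu (b := b)
  have hdom : ∀ x k, k < H x → 1 ≤ x ∧ x ≤ lam.length := by
    intro x k hk
    refine ⟨?_, ?_⟩
    · rcases Nat.eq_zero_or_pos x with rfl | h
      · omega
      · exact h
    · by_contra h
      have := hHN x (by omega)
      omega
  have hex : ∀ x k, ∃ a b, k < H x → seg (height lam) k a b ∈ B.parts ∧ 1 ≤ a ∧ a ≤ x ∧ x ≤ b ∧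
      b ≤ lam.length ∧ (∀ y, a ≤ y → y ≤ b → height lam a ≤ height lam y) ∧
      (b = lam.length ∨ height lam a = height lam b) := by
    intro x k
    by_cases hk : k < H x
    · obtain ⟨h1, h2⟩ := hdom x k hk
      obtain ⟨t, ht, hx⟩ := B.exists_mem ((hH _).2 ⟨x, k, h1, h2, hk, rfl⟩)
      obtain ⟨a, b, rfl, h⟩ := hB.exists_seg hH ht hx
      exact ⟨a, b, fun _ => ⟨ht, h⟩⟩
    · exact ⟨0, 0, fun h => absurd h hk⟩
  choose A E hAE using hex
  -- `A x k` and `E x k` are the first and last columns of the tile through level `k` at column `x`,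
  -- so they are constant along that tile.
  have hsame : ∀ x k y, k < H x → A x k ≤ y → y ≤ E x k →
      k < H y ∧ A y k = A x k ∧ E y k = E x k := by
    intro x k y hk h1 h2
    obtain ⟨hp, -, h3, h4, -⟩ := hAE x k hk
    have hmem : box (height lam) k y ∈ seg (height lam) k (A x k) (E x k) :=
      box_mem_seg.2 ⟨rfl, h1, h2⟩
    obtain ⟨x', k', -, -, hk', he⟩ := (hH _).1 (B.le hp hmem)
    obtain ⟨rfl, rfl⟩ := box_inj he
    obtain ⟨hp', -, h5, h6, -⟩ := hAE y k hk'
    have := seg_inj (by omega) (by omega) (B.eq_of_mem_parts hp' hp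
      (box_mem_seg.2 ⟨rfl, h5, h6⟩) hmem)
    exact ⟨hk', this.2.1, this.2.2⟩
  -- Cover-inclusiveness nests the column ranges of consecutive levels.
  have hnest : ∀ x k, k + 1 < H x → A x k ≤ A x (k + 1) ∧ E x (k + 1) ≤ E x k := by
    intro x k hk
    obtain ⟨hp, -, h3, h4, -⟩ := hAE x (k + 1) hk
    obtain ⟨hp', -, h5, h6, -⟩ := hAE x k (by omega)
    have hshift : ∀ y, ((box (height lam) (k + 1) y).1, (box (height lam) (k + 1) y).2 - 2) =
        box (height lam) k y := by
      intro y
      simp only [box]; push_cast; congr 1; ring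
    rcases hB.coverInclusive _ hp with h7 | ⟨t', ht', h7⟩
    · exfalso
      have := h7 (box (height lam) (k + 1) x) (box_mem_seg.2 ⟨rfl, h3, h4⟩)
      simp only [box] at this
      omega
    · have h8 : ∀ y, A x (k + 1) ≤ y → y ≤ E x (k + 1) → box (height lam) k y ∈ t' := by
        intro y h9 h10
        rw [← hshift]
        exact h7 (Finset.mem_image_of_mem _ (box_mem_seg.2 ⟨rfl, h9, h10⟩))
      have h9 := B.eq_of_mem_parts ht' hp' (h8 x h3 h4) (box_mem_seg.2 ⟨rfl, h5, h6⟩)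
      rw [h9] at h8
      have h10 := box_mem_seg.1 (h8 (A x (k + 1)) le_rfl (by omega))
      have h11 := box_mem_seg.1 (h8 (E x (k + 1)) (by omega) le_rfl)
      omega
  have hanti : ∀ x k j, k + j < H x → E x (k + j) ≤ E x k := by
    intro x k j
    induction j with
    | zero => intro _; exact le_rfl
    | succ j ih =>
      intro h
      exact (hnest x (k + j) h).2.trans (ih (by omega))
  set τ : ℕ → List ℕ := fun x => (List.range (H x)).map (A x) with hτ
  have hτlen : ∀ x, (τ x).length = H x := by simp [hτ]
  have hτget : ∀ x k a, (τ x)[k]? = some a ↔ k < H x ∧ A x k = a := by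
    intro x k a
    rw [List.getElem?_eq_some_iff]
    simp [hτ]
  have hrun : IsRun lam τ := by
    refine ⟨by simp [hτ, hH0], fun x hx => ?_⟩
    -- The least such level is the number `c` of tiles that go on; by nesting, all tiles from that
    -- level upwards end at `x`.
    have hexc : ∃ k, ¬ (k < H x ∧ x + 1 ≤ E x k) := ⟨H x, by simp⟩
    classical
    set c := Nat.find hexc with hc
    have hc1 : ∀ k < c, k < H x ∧ x + 1 ≤ E x k := fun k hk => not_not.1 (Nat.find_min hexc hk)
    have hcH : c ≤ H x := Nat.find_min' hexc (by simp)
    have hc2 : ∀ k, c ≤ k → k < H x → E x k = x := by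
      intro k h1 h2
      obtain ⟨j, rfl⟩ := Nat.exists_eq_add_of_le h1
      have h3 := hanti x c j h2
      have h4 := Nat.find_spec hexc
      rw [← hc] at h4
      obtain ⟨-, -, -, h5, -⟩ := hAE x _ h2
      have h6 : ¬ (x + 1 ≤ E x c) := fun h => h4 ⟨by omega, h⟩
      omega
    have hstep : ∀ k < c, k < H (x + 1) ∧ A (x + 1) k = A x k := by
      intro k hk
      obtain ⟨h1, h2⟩ := hc1 k hk
      obtain ⟨-, -, h3, -⟩ := hAE x k h1
      obtain ⟨h4, h5, -⟩ := hsame x k (x + 1) h1 (by omega) h2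
      exact ⟨h4, h5⟩
    have hnew : ∀ k, c ≤ k → k < H (x + 1) → A (x + 1) k = x + 1 := by
      intro k h1 h2
      obtain ⟨-, -, h3, h4, -⟩ := hAE (x + 1) k h2
      by_contra hne
      obtain ⟨h5, h6, h7⟩ := hsame (x + 1) k x h2 (by omega) (by omega)
      have := hc2 k h1 h5
      omega
    have hcH' : c ≤ H (x + 1) := by
      rcases Nat.eq_zero_or_pos c with h | h
      · omega
      · have := (hstep (c - 1) (by omega)).1
        omega
    refine ⟨c, H (x + 1) - c, by rw [hτlen]; exact hcH, ?_, ?_, ?_, ?_⟩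
    · refine List.ext_getElem (by simp [hτlen]; omega) fun k h1 h2 => ?_
      rw [hτlen] at h1
      rw [List.getElem_append]
      have h3 : ((τ x).take c).length = c := by rw [List.length_take, hτlen]; omega
      split
      · next h =>
        rw [h3] at h
        simp only [hτ, List.getElem_take, List.getElem_map, List.getElem_range]
        exact (hstep k h).2
      · next h =>
        rw [h3] at h
        rw [List.getElem_replicate]
        simp only [hτ, List.getElem_map, List.getElem_range]
        exact hnew k (by omega) h1
    · intro a ha
      obtain ⟨i, hi⟩ := List.mem_iff_getElem?.1 ha
      rw [List.getElem?_drop] at hi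
      obtain ⟨h1, rfl⟩ := (hτget _ _ _).1 hi
      have h2 := hc2 _ (by omega) h1
      obtain ⟨-, -, -, -, -, -, h3⟩ := hAE x _ h1
      rw [h2] at h3
      exact h3.resolve_left (by omega)
    · intro hD a ha
      obtain ⟨i, hi⟩ := List.mem_iff_getElem?.1 ha
      rw [List.getElem?_take] at hi
      split_ifs at hi with hic
      obtain ⟨h1, rfl⟩ := (hτget _ _ _).1 hi
      obtain ⟨h2, h3⟩ := hc1 i hic
      obtain ⟨-, -, h4, -, -, h5, -⟩ := hAE x i h1
      have h6 := h5 (x + 1) (by omega) h3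
      have h7 := height_succ lam hx
      rw [hD] at h7
      simp only [Step.sign] at h7
      omega
    · rw [hτlen, hτlen]
      have h1 := hHmu x hx.le
      have h2 := hHmu (x + 1) hx
      have h3 := height_succ lam hx
      have h4 := height_succ mu (hab.1.symm ▸ hx)
      cases h5 : lam.getD x .U <;> cases h6 : mu.getD x .U <;>
        simp only [h5, h6, Step.sign] at h3 h4 <;>
        simp only [true_and, reduceCtorEq, false_and, or_false, false_or] <;> omega
  have htile : ∀ x k, k < H x →
      runTile lam τ (k, A x k) = seg (height lam) k (A x k) (E x k) ∧
        (k, A x k) ∈ starts lam.length τ := by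
    intro x k hk
    obtain ⟨hp, h1, h2, h3, h4, -⟩ := hAE x k hk
    have hst := hrun.mem_starts_of_getElem? (h3.trans h4) ((hτget x k _).2 ⟨hk, rfl⟩)
    obtain ⟨h5, h6⟩ := hrun.mem_starts.1 hst
    refine ⟨?_, hst⟩
    have hend : tileEnd lam.length τ k (A x k) ≤ lam.length := Nat.findGreatest_le _
    have h7 := (hrun.getElem?_iff h5 h6 hend).2 ⟨hrun.le_tileEnd h5 h6, le_rfl⟩
    obtain ⟨h8, h9⟩ := (hτget _ _ _).1 h7
    obtain ⟨-, -, h10, h11, -⟩ := hAE _ k h8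
    have h12 := (hsame _ k (A x k) h8 (by omega) (by omega)).2.2
    have h13 := (hsame x k (A x k) hk le_rfl (by omega)).2.2
    obtain ⟨h14, h15, -⟩ := hsame x k (E x k) hk (by omega) le_rfl
    have h16 := ((hrun.getElem?_iff h5 h6 h4).1 ((hτget _ _ _).2 ⟨h14, h15⟩)).2
    rw [runTile, show tileEnd lam.length τ k (A x k) = E x k by omega]
  refine ⟨τ, hrun, fun x hx => by simp [hτ, hHN x hx], fun x hx => by rw [hτlen, hHmu x hx], ?_⟩
  ext t
  rw [Finset.mem_image]
  constructor
  · intro ht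
    obtain ⟨b, hb⟩ := B.nonempty_of_mem_parts ht
    obtain ⟨x, k, -, -, hk, rfl⟩ := (hH b).1 (B.le ht hb)
    obtain ⟨hp, -, h1, h2, -⟩ := hAE x k hk
    refine ⟨(k, A x k), (htile x k hk).2, ?_⟩
    rw [(htile x k hk).1]
    exact B.eq_of_mem_parts hp ht (box_mem_seg.2 ⟨rfl, h1, h2⟩) hb
  · rintro ⟨⟨k, a⟩, hp, rfl⟩
    obtain ⟨h1, h2⟩ := hrun.mem_starts.1 hp
    obtain ⟨h3, h4⟩ := (hτget _ _ _).1 h2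
    have h5 := (htile a k h3).1
    rw [h4] at h5
    rw [h5, ← h4]
    have := (hAE a k h3).1
    rwa [h4] at this ⊢

end

/-! ### The generating function of the tilings -/

/-- A bijection given as a relation: the type of a tiling depends on its upper path, and a relation
avoids transport between these types. -/
theorem sum_eq_sum_of_rel {α β M : Type*} [AddCommMonoid M] {s : Finset α} {t : Finset β}
    {f : α → M} {g : β → M} (R : α → β → Prop) (h1 : ∀ a ∈ s, ∃ b ∈ t, R a b)
    (h2 : ∀ b ∈ t, ∃ a ∈ s, R a b)
    (h3 : ∀ a ∈ s, ∀ b ∈ t, ∀ b' ∈ t, R a b → R a b' → b = b')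
    (h4 : ∀ b ∈ t, ∀ a ∈ s, ∀ a' ∈ s, R a b → R a' b → a = a')
    (h5 : ∀ a ∈ s, ∀ b ∈ t, R a b → f a = g b) : ∑ a ∈ s, f a = ∑ b ∈ t, g b := by
  choose F hF using h1
  refine Finset.sum_bij F (fun a ha => (hF a ha).1) ?_ ?_
    fun a ha => h5 a ha _ (hF a ha).1 (hF a ha).2
  · intro a ha a' ha' he
    exact h4 _ (hF a ha).1 a ha a' ha' (hF a ha).2 (he ▸ (hF a' ha').2)
  · intro b hb
    obtain ⟨a, ha, hR⟩ := h2 b hb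
    exact ⟨a, ha, h3 a ha _ (hF a ha).1 b hb (hF a ha).2 hR⟩

/-- The stacks of a list of stacks, starting with the empty stack at column `0`. -/
def stackAt (ρ : List (List ℕ)) (x : ℕ) : List ℕ := ([] :: ρ).getD x []

theorem mem_runs_iff {lam : List Step} {ρ : List (List ℕ)} :
    ρ ∈ runs (height lam) lam 0 [] ↔ ρ.length = lam.length ∧ IsRun lam (stackAt ρ) := by
  rw [mem_runs (fits_height lam) ⟨List.Pairwise.nil, by simp⟩, and_congr_right_iff]
  intro _
  simp only [zero_add]
  exact ⟨fun h => ⟨rfl, h⟩, fun h => h.follows⟩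

theorem IsRun.exists_mem_runs {lam : List Step} {τ : ℕ → List ℕ} (h : IsRun lam τ)
    (hτ : ∀ x, lam.length < x → τ x = []) :
    ∃ ρ ∈ runs (height lam) lam 0 [], stackAt ρ = τ := by
  have key : stackAt ((List.range lam.length).map fun i => τ (i + 1)) = τ := by
    funext x
    cases x with
    | zero => rw [h.zero]; rfl
    | succ x =>
      rcases Nat.lt_or_ge x lam.length with hx | hx
      · simp [stackAt, hx]
      · rw [hτ (x + 1) (by omega)]
        simp [stackAt, hx]
  exact ⟨_, mem_runs_iff.2 ⟨by simp, key.symm ▸ h⟩, key⟩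

theorem Records.unique_path {lam mu mu' : List Step} {B : Finpartition (skewShape lam mu)}
    {B' : Finpartition (skewShape lam mu')} {τ : ℕ → List ℕ} (hr : Records lam mu B τ)
    (hr' : Records lam mu' B' τ) (h : mu.length = lam.length) (h' : mu'.length = lam.length) :
    mu = mu' :=
  eq_of_height_eq (h.trans h'.symm) fun i hi => by
    rw [hr.height i (h ▸ hi), hr'.height i (h ▸ hi)]

-- Pairs of an upper path and a tiling of type BI correspond to the runs whose last stack satisfies
-- the parity conditions; `Records` is the correspondence and preserves art.
open Classical in
theorem aeval_genBI (q : ℝ) (lam : List Step) :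
    aeval q (genBI lam) = transfer q (height lam) ∅ lam 0 [] := by
  have h0 : IsStack (height lam) 0 [] := ⟨List.Pairwise.nil, by simp⟩
  have hrec : transfer q (height lam) ∅ lam 0 [] = _ :=
    transfer_eq_sum_runs (q := q) (O := ∅) (fits_height lam) h0
  simp only [zero_add, IsRun.finalWeight_eq, mul_ite, mul_zero, ← pow_add] at hrec
  rw [hrec, ← Finset.sum_filter]
  simp only [genBI, genBetween, map_sum, map_pow, aeval_X]
  rw [Finset.sum_sigma']
  refine sum_eq_sum_of_rel (fun p ρ => Records lam p.1.toList p.2 (stackAt ρ)) ?_ ?_ ?_ ?_ ?_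
  · rintro ⟨mu, B⟩ hp
    simp only [Finset.mem_sigma, Finset.mem_filter, Finset.mem_univ, true_and] at hp
    obtain ⟨τ, h1, h2, h3⟩ := hp.2.exists_run hp.1
    obtain ⟨ρ, hρ, rfl⟩ := h1.exists_mem_runs h2
    exact ⟨ρ, Finset.mem_filter.2 ⟨hρ, (h3.isTypeBI_iff h1).1 hp.2⟩, h3⟩
  · intro ρ hρ
    rw [Finset.mem_filter] at hρ
    have h1 := (mem_runs_iff.1 hρ.1).2
    obtain ⟨mu, B, hab, hr⟩ := h1.exists_records
    refine ⟨⟨⟨mu, hab.1⟩, B⟩, ?_, hr⟩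
    exact Finset.mem_sigma.2 ⟨Finset.mem_filter.2 ⟨Finset.mem_univ _, hab⟩,
      Finset.mem_filter.2 ⟨Finset.mem_univ _, (hr.isTypeBI_iff h1).2 hρ.2⟩⟩
  · rintro p - ρ hρ ρ' hρ' hr hr'
    have h1 := mem_runs_iff.1 (Finset.mem_filter.1 hρ).1
    have h2 := mem_runs_iff.1 (Finset.mem_filter.1 hρ').1
    refine List.ext_getElem (h1.1.trans h2.1.symm) fun i hi hi' => ?_
    have := hr.unique_run hr' h1.2 h2.2 (x := i + 1) (by omega)
    simpa [stackAt, hi, hi'] using this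
  · rintro ρ - ⟨⟨mu, hmu⟩, B⟩ - ⟨⟨mu', hmu'⟩, B'⟩ - hr hr'
    obtain rfl : mu = mu' := hr.unique_path hr' hmu hmu'
    obtain rfl : B = B' := Finpartition.ext (hr.parts.trans hr'.parts.symm)
    rfl
  · rintro ⟨mu, B⟩ - ρ hρ hr
    rw [Finset.mem_filter] at hρ
    obtain ⟨h1, h2⟩ := mem_runs_iff.1 hρ.1
    rw [hr.art_eq h2 hρ.2.1]
    rfl

/-! ### Parsing ballot paths -/

/-- The alternatives are an even or an odd number of unpaired `U`'s, or an unpaired `D`. After a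
first `U`, a word of the last kind closes a pair, and what follows is parsed again. -/
theorem word_cases (w : List Step) : (∃ z₀ l, w = evenWord z₀ l) ∨
    (∃ (z : Forest) (z₀ : Forest) (l : _), w = z.word ++ .U :: evenWord z₀ l) ∨ ∃ (z : Forest) (w' : List Step),
      w = z.word ++ .D :: w' := by
  induction h : w.length using Nat.strong_induction_on generalizing w with
  | _ n ih =>
  subst h
  match w with
  | [] => exact .inl ⟨.nil, [], rfl⟩
  | .D :: w => exact .inr (.inr ⟨.nil, w, rfl⟩)
  | .U :: w =>
    rcases ih _ (by simp) w rfl with ⟨z₀, l, rfl⟩ | ⟨z, z₀, l, rfl⟩ | ⟨z, w', rfl⟩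
    · exact .inr (.inl ⟨.nil, z₀, l, rfl⟩)
    · exact .inl ⟨z₀, (.nil, z) :: l, rfl⟩
    · rcases ih w'.length (by simp; omega) w' rfl with ⟨z₀, l, rfl⟩ | ⟨z', z₀, l, rfl⟩ |
        ⟨z', w'', rfl⟩
      · refine .inl ?_
        cases l with
        | nil => exact ⟨.node z z₀, [], rfl⟩
        | cons z' l => exact ⟨z₀, (.node z z'.1, z'.2) :: l, by simp [evenWord, Forest.word]⟩
      · exact .inr (.inl ⟨.node z z', z₀, l, by simp [Forest.word]⟩)
      · exact .inr (.inr ⟨.node z z', w'', by simp [Forest.word]⟩)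

theorem IsBallot.cases {w : List Step} (h : IsBallot w) : (∃ z₀ l, w = evenWord z₀ l) ∨
    ∃ (z : Forest) (z₀ : Forest) (l : _), w = z.word ++ .U :: evenWord z₀ l := by
  rcases word_cases w with h' | h' | ⟨z, w', rfl⟩
  · exact .inl h'
  · exact .inr h'
  · obtain ⟨h1, h2, -⟩ := (fits_height (z.word ++ .D :: w')).forest
    have h3 := h (0 + 2 * z.size + 1)
    have h4 : height (z.word ++ .D :: w') 0 = 0 := rfl
    simp only [zero_add] at h1 h2 h3
    omega

theorem transfer_eq_rootSum {q : ℝ} (h0 : 0 < q) (h1 : q < 1) {lam : List Step}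
    (h : IsBallot lam) :
    transfer q (height lam) ∅ lam 0 [] =
      rootSum q 0 (tree lam (List.replicate lam.length .U)) 0 := by
  have ht : tree lam (List.replicate lam.length .U) = (readOffset 0 lam).current := by
    rw [tree]
    exact congrArg _ (readWord_eq_readOffset lam [] lam.length (by simp))
  have hf : Fits (height lam) 0 lam := fits_height lam
  rw [ht, ← stackSum_zero lam 0 0 []]
  generalize height lam = hl at hf
  rcases h.cases with ⟨z₀, l, rfl⟩ | ⟨z, z₀, l, rfl⟩
  · rw [stackSum_evenWord h0 h1 z₀ l 0 0 0 hf le_rfl rfl, readOffset_evenWord,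
      rootSum_evenTree h0 h1 z₀ l le_rfl]
    simp [plusProd_zero]
  · have hf' := hf.forest
    have hev := Fits.evenWord hf'.2.2
    rw [(stackSum_odd h0 h1 rfl hev.1 (downs_evenWord z₀ l)
      (fun y hy hy' => hev.2 y hy hy'.le)
      (fun k => stackSum_evenWord h0 h1 z₀ l _ _ k hf'.2.2 le_rfl rfl) z hf rfl le_rfl rfl).1,
      readOffset_oddWord, rootSum_glue_arrow h0 h1 (fun v hv => rootSum_evenTree h0 h1 z₀ l hv)
        (size_evenTree _ _ _) (firstLe_evenTree _ _ _) z rfl le_rfl, risingProd_succ]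
    have : (1 : ℝ) + q ^ (evenSize z₀ l + z.size + 1) ≠ 0 := by positivity
    simp only [plusProd_zero, zero_mul, pow_zero, zero_add, add_zero, one_mul, mul_one, Nat.sub_self]
    -- The factor `1 - q ^ (2 * n)` of the odd level is `(1 - q ^ n) * (1 + q ^ n)`, which cancels
    -- the denominator and leaves the last factor of the rising product.
    rw [two_mul, pow_add]
    field_simp
    ring

/-- Two polynomials that agree on an interval agree, since the interval is infinite. -/
theorem eq_of_forall_aeval_eq {p r : ℤ[X]} (h : ∀ q : ℝ, 0 < q → q < 1 → aeval q p = aeval q r) :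
    p = r := by
  refine Polynomial.map_injective (algebraMap ℤ ℝ) Int.cast_injective ?_
  refine Polynomial.eq_of_infinite_eval_eq _ _ ((Set.Ioo_infinite (zero_lt_one' ℝ)).mono ?_)
  rintro q ⟨h0, h1⟩
  simpa only [Set.mem_ofPred_eq, eval_map_algebraMap] using h q h0 h1

end BallotBI

theorem mainTheorem11 (lam : List BallotBI.Step) (hlam : BallotBI.IsBallot lam) :
    BallotBI.genBI lam =
      ∑ L ∈ BallotBI.labellings
          (BallotBI.tree lam (List.replicate lam.length BallotBI.Step.U)),
        BallotBI.weight L := by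
  refine BallotBI.eq_of_forall_aeval_eq fun q h0 h1 => ?_
  rw [BallotBI.aeval_genBI, BallotBI.transfer_eq_rootSum h0 h1 hlam, BallotBI.rootSum,
    BallotBI.labellingsFrom_zero, map_sum]
  exact Finset.sum_congr rfl fun L _ => (BallotBI.aeval_weight q L).symm
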